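/- Let $V_{\mathbb R}$ be a finite-dimensional real vector space, $n$ an integer, $Q$ a nondegenerate $(-1)^n$-symmetric bilinear form on $V_{\mathbb R}$, and $\mathbf h=(h^{p,n-p})_{p\in\mathbb Z}$ a family of nonnegative integers. Let $\tilde D$ be the set of all weight $n$ Hodge structures on $V_{\mathbb R}$ with Hodge numbers $\mathbf h$ that are polarized by $Q$ (identified with their Hodge filtrations $F$ on $V_{\mathbb C}$; polarized means $Q(F^p,F^{n+1-p})=0$ and $i^{p-q}Q(v,\bar v)>0$ for $0\ne v\in H^{p,q}$). Assume $\tilde D\neq\emptyset$, let $\varphi\in\tilde D$, and let $D=G(\mathbb R)^+\cdot\varphi\subseteq\tilde D$ be its orbit under the identity path component $G(\mathbb R)^+$ of $\mathrm{Aut}(V_{\mathbb R},Q)$. Let $\check D$ be the set of decreasing filtrations $F$ of $V_{\mathbb C}$ with $\dim \mathrm{Gr}_F^p=h^{p,n-p}$ and $Q(F^p,F^{n+1-p})=0$ for all $p$. A polarized mixed Hodge structure (PMHS) on $D$ (respectively, on $\tilde D$) is a pair $(F,N)$ of $F\in\check D$ and a nilpotent $N\in\mathrm{End}(V_{\mathbb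 R},Q)$ (that is, $Q(Nu,v)+Q(u,Nv)=0$) such that, with $W=W(N)[-n]$ the monodromy weight filtration of $N$ centered at $n$: $NF^p\subseteq F^{p-1}$ for all $p$; $F$ induces a Hodge structure of weight $m$ on $\mathrm{Gr}^W_m$ for all $m$; for all $\ell\ge0$ the form $Q(\cdot,N^\ell\cdot)$ polarizes the primitive subspace $\ker(N^{\ell+1})\subseteq\mathrm{Gr}^W_{n+\ell}$; and $e^{zN}F\in D$ (respectively, $\in\tilde D$) for $\mathrm{Im}\,z\gg0$. Let $V_{\mathbb C}=\bigoplus I^{p,q}$ be the Deligne bigrading of the mixed Hodge structure $(F,W)$. The PMHS is $\mathbb R$-split if $\overline{I^{p,q}}=I^{q,p}$ for all $p,q$. Its Hodge diamond is the function $\Diamond(F,N):\mathbb Z^2\to\mathbb Z_{\ge0}$, $(p,q)\mapsto\dim_{\mathbb C} I^{p,q}$. Let $\overline\Psi_D$ be the set of $\mathbb R$-split PMHS $(F,N)$ on $\tilde D$ modulo the action $g\cdot(F,N)=(gF,gNg^{-1})$ of the full group $\mathrm{Aut}(V_{\mathbb R},Q)$. 1. Every function $f:\mathbb Z^2\to\mathbb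 Z_{\ge0}$ satisfying $$\sum_q f(p,q)=h^{p,n-p},\qquad f(p,q)=f(q,p)=f(n-q,n-p)\qquad\text{for all } p,q,$$ $$f(p-1,q-1)\le f(p,q)\qquad\text{whenever } p+q\le n,$$ is the Hodge diamond of an $\mathbb R$-split PMHS on $D$. 2. If $(F_1,N_1)$ and $(F_2,N_2)$ are $\mathbb R$-split PMHS on $\tilde D$, then $\Diamond(F_1,N_1)=\Diamond(F_2,N_2)$ if and only if $[F_1,N_1]=[F_2,N_2]$ in $\overline\Psi_D$. 3. For every $\mathbb R$-split PMHS $(F,N)$ on $\tilde D$ the limit $\phi_\infty(F,N)=\lim_{y\to+\infty}e^{iyN}F$ exists as a filtration of $V_{\mathbb C}$ (in the topology of the flag variety), and $(F,N)\mapsto\phi_\infty(F,N)$ induces a bijection from $\overline\Psi_D$ onto the set $\overline{\mathbf\Delta}_D$ of $\mathrm{Aut}(V_{\mathbb R},Q)$-orbits of such limits. -/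

import Mathlib

open scoped TensorProduct

namespace PeriodDomain

variable {V : Type*} [AddCommGroup V] [Module ℝ V]

/-- The complexification `V_ℂ = ℂ ⊗ V_ℝ`. -/
abbrev Cx (V : Type*) [AddCommGroup V] [Module ℝ V] : Type _ := ℂ ⊗[ℝ] V

/-- Complex conjugation `a ⊗ v ↦ ā ⊗ v` on `V_ℂ`, as a conjugate-linear map. -/
noncomputable def conj (V : Type*) [AddCommGroup V] [Module ℝ V] :
    Cx V →ₛₗ[starRingEnd ℂ] Cx V where
  toFun := TensorProduct.map Complex.conjAe.toLinearMap LinearMap.id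
  map_add' := map_add _
  map_smul' c x := by
    induction x using TensorProduct.induction_on with
    | zero => simp
    | tmul a v => simp [TensorProduct.smul_tmul']
    | add x y hx hy => rw [smul_add, map_add, map_add, smul_add, hx, hy]

/-- The conjugate `Ū` of a complex subspace `U ⊆ V_ℂ`. -/
noncomputable def conjSub (U : Submodule ℂ (Cx V)) : Submodule ℂ (Cx V) := U.map (conj V)

/-- The complex bilinear extension of `Q` to `V_ℂ`. -/
noncomputable def QC (Q : LinearMap.BilinForm ℝ V) : LinearMap.BilinForm ℂ (Cx V) :=
  LinearMap.BilinForm.baseChange ℂ Q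

/-- Families `(F^p)_{p ∈ ℤ}` of complex subspaces of `V_ℂ`. -/
abbrev CFil (V : Type*) [AddCommGroup V] [Module ℝ V] : Type _ := ℤ → Submodule ℂ (Cx V)

/-! ### Period domains -/

/-- The compact dual `Ď`: decreasing exhaustive separated filtrations `F` of `V_ℂ` with
`dim Gr_F^p = h^{p,n-p} = h p` and `Q(F^p, F^{n+1-p}) = 0`. -/
structure IsCompactDual (n : ℤ) (Q : LinearMap.BilinForm ℝ V) (h : ℤ → ℕ) (F : CFil V) :
    Prop where
  anti : Antitone F
  exists_top : ∃ a, F a = ⊤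
  exists_bot : ∃ b, F b = ⊥
  finrank_eq : ∀ p, Module.finrank ℂ (F p) = Module.finrank ℂ (F (p + 1)) + h p
  isotropic : ∀ p, ∀ u ∈ F p, ∀ v ∈ F (n + 1 - p), QC Q u v = 0

/-- The period domain `D̃` of all weight `n` Hodge structures on `V_ℝ` with Hodge numbers
`h^{p,n-p} = h p` that are polarized by `Q`. A Hodge structure is given by its Hodge filtration;
`H^{p,q} = F^p ∩ conj F^q` for `p + q = n`, and polarized means that `Q(F^p, F^{n+1-p}) = 0`
and `i^{p-q} Q(v, v̄) > 0` for `0 ≠ v ∈ H^{p,q}`. -/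
def periodDomain (n : ℤ) (Q : LinearMap.BilinForm ℝ V) (h : ℤ → ℕ) : Set (CFil V) :=
  {F | IsCompactDual n Q h F ∧
    (∀ p, IsCompl (F p) (conjSub (F (n + 1 - p)))) ∧
    ∀ p q, p + q = n → ∀ v ∈ F p ⊓ conjSub (F q), v ≠ 0 →
      0 < (Complex.I ^ (p - q) * QC Q v (conj V v)).re}

/-- The real group `Aut(V_ℝ, Q)`. -/
def autQ (Q : LinearMap.BilinForm ℝ V) : Subgroup (V ≃ₗ[ℝ] V) where
  carrier := {g | ∀ u v, Q (g u) (g v) = Q u v}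
  one_mem' _ _ := rfl
  mul_mem' ha hb u v := by rw [LinearEquiv.mul_apply, LinearEquiv.mul_apply, ha, hb]
  inv_mem' {g} hg u v := by
    rw [← hg]
    exact congrArg₂ (fun a b => Q a b) (g.apply_symm_apply u) (g.apply_symm_apply v)

/-- The identity path component of `Aut(V_ℝ, Q)`. A path is continuous if all its matrix
coefficients are. -/
def autQConn (Q : LinearMap.BilinForm ℝ V) : Set (V ≃ₗ[ℝ] V) :=
  {g | ∃ γ : ℝ → (V ≃ₗ[ℝ] V), γ 0 = 1 ∧ γ 1 = g ∧ (∀ t ∈ Set.Icc (0 : ℝ) 1, γ t ∈ autQ Q) ∧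
    ∀ (v : V) (l : Module.Dual ℝ V), ContinuousOn (fun t => l (γ t v)) (Set.Icc 0 1)}

/-- The action of a real automorphism on filtrations of `V_ℂ`. -/
noncomputable def act (g : V ≃ₗ[ℝ] V) (F : CFil V) : CFil V :=
  fun p => (F p).map ((g : V →ₗ[ℝ] V).baseChange ℂ)

lemma act_one (F : CFil V) : act (1 : V ≃ₗ[ℝ] V) F = F := by
  funext p
  have : ((1 : V ≃ₗ[ℝ] V) : V →ₗ[ℝ] V) = LinearMap.id := rfl
  rw [act, this, LinearMap.baseChange_id, Submodule.map_id]

lemma act_mul (a b : V ≃ₗ[ℝ] V) (F : CFil V) : act (a * b) F = act a (act b F) := by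
  funext p
  have : ((a * b : V ≃ₗ[ℝ] V) : V →ₗ[ℝ] V) = (a : V →ₗ[ℝ] V) ∘ₗ (b : V →ₗ[ℝ] V) := rfl
  rw [act, act, act, this, LinearMap.baseChange_comp, Submodule.map_comp]

/-- The connected period domain `D = G(ℝ)⁺ · φ` of a Hodge filtration `φ`. -/
def connDomain (Q : LinearMap.BilinForm ℝ V) (φ : CFil V) : Set (CFil V) :=
  {F | ∃ g ∈ autQConn Q, F = act g φ}

/-- The `Aut(V_ℝ, Q)`-orbit of a filtration. -/
def orbit (Q : LinearMap.BilinForm ℝ V) (F : CFil V) : Set (CFil V) :=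
  {F' | ∃ g ∈ autQ Q, F' = act g F}

/-! ### Polarized mixed Hodge structures -/

/-- `W = W(N)[-n]`, the monodromy weight filtration of the nilpotent `N`, centered at `n`: the
unique finite increasing filtration of `V_ℝ` with `N W_l ⊆ W_{l-2}` such that
`N^l : Gr^W_{n+l} → Gr^W_{n-l}` is an isomorphism for all `l ≥ 0`. -/
structure IsWeightFil (n : ℤ) (N : Module.End ℝ V) (W : ℤ → Submodule ℝ V) : Prop where
  mono : Monotone W
  exists_bot : ∃ a, W a = ⊥
  exists_top : ∃ b, W b = ⊤
  map_le : ∀ l, (W l).map N ≤ W (l - 2)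
  surj : ∀ l : ℕ, W (n - l) ≤ (W (n + l)).map (N ^ l) ⊔ W (n - l - 1)
  inj : ∀ l : ℕ, ∀ v ∈ W (n + l), (N ^ l) v ∈ W (n - l - 1) → v ∈ W (n + l - 1)

/-- The complexified weight filtration. -/
noncomputable def WC (W : ℤ → Submodule ℝ V) : CFil V := fun l => (W l).baseChange ℂ

/-- The image of a subspace `U ∩ W_m` in `Gr^W_m = W_m / W_{m-1}`, the latter viewed as a subspace
of `V_ℂ / W_{m-1}`. For `U = F^p` this is the filtration induced by `F` on `Gr^W_m`. -/
noncomputable def gr (W : ℤ → Submodule ℝ V) (m : ℤ) (U : Submodule ℂ (Cx V)) :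
    Submodule ℂ (Cx V ⧸ WC W (m - 1)) :=
  (U ⊓ WC W m).map (WC W (m - 1)).mkQ

/-- `F` induces a Hodge structure of weight `m` on `Gr^W_m` for all `m`:
`Gr^W_m = F^p Gr^W_m ⊕ conj(F^{m+1-p} Gr^W_m)` for all `p`. -/
def IsMHS (W : ℤ → Submodule ℝ V) (F : CFil V) : Prop :=
  ∀ m p : ℤ, Disjoint (gr W m (F p)) (gr W m (conjSub (F (m + 1 - p)))) ∧
    gr W m (F p) ⊔ gr W m (conjSub (F (m + 1 - p))) = gr W m ⊤

/-- `v` represents a class in the primitive part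
`ker (N^{l+1} : Gr^W_{n+l} → Gr^W_{n-l-2})` of `Gr^W_{n+l}`. -/
def IsPrim (n : ℤ) (N : Module.End ℝ V) (W : ℤ → Submodule ℝ V) (l : ℕ) (v : Cx V) : Prop :=
  v ∈ WC W (n + l) ∧ (N.baseChange ℂ ^ (l + 1)) v ∈ WC W (n - l - 3)

/-- For all `l ≥ 0` the form `Q_l(u, v) = Q(u, N^l v)` polarizes the weight `n + l` Hodge structure
that `F` induces on the primitive part of `Gr^W_{n+l}`. -/
structure IsPolarized (n : ℤ) (Q : LinearMap.BilinForm ℝ V) (N : Module.End ℝ V)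
    (W : ℤ → Submodule ℝ V) (F : CFil V) : Prop where
  isotropic : ∀ (l : ℕ) (p : ℤ) (u v : Cx V), IsPrim n N W l u → IsPrim n N W l v →
    (WC W (n + l - 1)).mkQ u ∈ gr W (n + l) (F p) →
    (WC W (n + l - 1)).mkQ v ∈ gr W (n + l) (F (n + l + 1 - p)) →
    QC Q u ((N.baseChange ℂ ^ l) v) = 0
  pos : ∀ (l : ℕ) (p q : ℤ), p + q = n + l → ∀ v : Cx V, IsPrim n N W l v →
    (WC W (n + l - 1)).mkQ v ∈ gr W (n + l) (F p) →
    (WC W (n + l - 1)).mkQ v ∈ gr W (n + l) (conjSub (F q)) →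
    (WC W (n + l - 1)).mkQ v ≠ 0 →
    0 < (Complex.I ^ (p - q) * QC Q v ((N.baseChange ℂ ^ l) (conj V v))).re

/-- `(F, W)` is split over `ℝ`: there is a bigrading `V_ℂ = ⨁ J^{p,q}` with
`F^p = ⨁_{r ≥ p} J^{r,s}`, `W_l = ⨁_{r+s ≤ l} J^{r,s}` and `conj J^{p,q} = J^{q,p}`. -/
def IsRSplit (W : ℤ → Submodule ℝ V) (F : CFil V) : Prop :=
  ∃ J : ℤ × ℤ → Submodule ℂ (Cx V), DirectSum.IsInternal J ∧
    (∀ p, F p = ⨆ x : ℤ × ℤ, ⨆ _ : p ≤ x.1, J x) ∧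
    (∀ l, WC W l = ⨆ x : ℤ × ℤ, ⨆ _ : x.1 + x.2 ≤ l, J x) ∧
    ∀ p q, conjSub (J (p, q)) = J (q, p)

/-- The exponential `exp (z N)` of a nilpotent `N`; the sum is the whole series since
`N ^ dim V = 0`. -/
noncomputable def expN (N : Module.End ℝ V) (z : ℂ) : Module.End ℂ (Cx V) :=
  ∑ k ∈ Finset.range (Module.finrank ℝ V + 1), (z ^ k / (k.factorial : ℂ)) • N.baseChange ℂ ^ k

/-- The nilpotent orbit `z ↦ e^{zN} F`. -/
noncomputable def nilOrbit (F : CFil V) (N : Module.End ℝ V) (z : ℂ) : CFil V :=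
  fun p => (F p).map (expN N z)

/-- The `ℝ`-split polarized mixed Hodge structures `(F, W(N))` on `D`, where `D` is
a set of Hodge filtrations in the compact dual determined by `n`, `Q`, `h`. The weight filtration
`W` is determined by `N`. -/
structure RSplitPMHS (n : ℤ) (Q : LinearMap.BilinForm ℝ V) (h : ℤ → ℕ) (D : Set (CFil V)) where
  F : CFil V
  N : Module.End ℝ V
  W : ℤ → Submodule ℝ V
  compactDual : IsCompactDual n Q h F
  nilpotent : IsNilpotent N
  skew : ∀ u v, Q (N u) v + Q u (N v) = 0
  weight : IsWeightFil n N W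
  horizontal : ∀ p, (F p).map (N.baseChange ℂ) ≤ F (p - 1)
  mhs : IsMHS W F
  polarized : IsPolarized n Q N W F
  split : IsRSplit W F
  onD : ∃ c : ℝ, ∀ z : ℂ, c < z.im → nilOrbit F N z ∈ D

/-- The Deligne bigrading
`I^{p,q} = F^p ∩ W_{p+q} ∩ (F̄^q ∩ W_{p+q} + ∑_{j ≥ 1} F̄^{q-j} ∩ W_{p+q-j-1})`. -/
noncomputable def deligne (W : ℤ → Submodule ℝ V) (F : CFil V) (p q : ℤ) : Submodule ℂ (Cx V) :=
  F p ⊓ WC W (p + q) ⊓ (conjSub (F q) ⊓ WC W (p + q) ⊔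
    ⨆ j : ℕ, ⨆ _ : 1 ≤ j, conjSub (F (q - j)) ⊓ WC W (p + q - j - 1))

/-- The Hodge diamond `(p, q) ↦ i^{p,q} = dim I^{p,q}`. -/
noncomputable def RSplitPMHS.diamond {n : ℤ} {Q : LinearMap.BilinForm ℝ V} {h : ℤ → ℕ}
    {D : Set (CFil V)} (x : RSplitPMHS n Q h D) : ℤ × ℤ → ℕ :=
  fun a => Module.finrank ℂ (deligne x.W x.F a.1 a.2)

/-- The numerical conditions on a Hodge diamond: column sums, symmetry and monotonicity. -/
structure IsAdmissible (n : ℤ) (h : ℤ → ℕ) (f : ℤ × ℤ → ℕ) : Prop where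
  finite_col : ∀ p, (Function.support fun q => f (p, q)).Finite
  sum_col : ∀ p, ∑ᶠ q, f (p, q) = h p
  symm : ∀ p q, f (p, q) = f (q, p)
  symm' : ∀ p q, f (p, q) = f (n - q, n - p)
  mono : ∀ p q, p + q ≤ n → f (p - 1, q - 1) ≤ f (p, q)

/-! ### The quotient `Ψ̄_D`, the naive limit map and `Δ̄_D` -/

/-- Conjugacy under the full group `Aut(V_ℝ, Q)`:
`(F₂, N₂) = (g F₁, g N₁ g⁻¹)` for some `g`. -/
noncomputable def conjSetoid (n : ℤ) (Q : LinearMap.BilinForm ℝ V) (h : ℤ → ℕ)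
    (D : Set (CFil V)) : Setoid (RSplitPMHS n Q h D) where
  r x y := ∃ g ∈ autQ Q, y.F = act g x.F ∧ y.N = g.conj x.N
  iseqv :=
    { refl := fun x => ⟨1, one_mem _, (act_one _).symm, rfl⟩
      symm := by
        rintro x y ⟨g, hg, hF, hN⟩
        refine ⟨g⁻¹, inv_mem hg, ?_, ?_⟩
        · rw [hF, ← act_mul, inv_mul_cancel, act_one]
        · rw [hN]
          exact (g.conj.symm_apply_apply x.N).symm
      trans := by
        rintro x y z ⟨g, hg, hF, hN⟩ ⟨k, hk, hF', hN'⟩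
        refine ⟨k * g, mul_mem hk hg, ?_, ?_⟩
        · rw [hF', hF, ← act_mul]
        · rw [hN', hN]
          rfl }

/-- `Ψ̄_D`: the `Aut(V_ℝ, Q)`-conjugacy classes of `ℝ`-split PMHS on the full period domain `D̃`. -/
def PsiBar (n : ℤ) (Q : LinearMap.BilinForm ℝ V) (h : ℤ → ℕ) : Type _ :=
  Quotient (conjSetoid n Q h (periodDomain n Q h))

/-- The class `[F, N] ∈ Ψ̄_D`. -/
noncomputable def cls {n : ℤ} {Q : LinearMap.BilinForm ℝ V} {h : ℤ → ℕ}
    (x : RSplitPMHS n Q h (periodDomain n Q h)) : PsiBar n Q h :=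
  Quotient.mk (conjSetoid n Q h (periodDomain n Q h)) x

/-- Convergence `U y → L` as `y → +∞` in the Grassmannian of `V_ℂ`: there are frames of `U y`
converging to a basis of `L` (coordinatewise, that is, against all linear functionals). -/
def TendstoSub (U : ℝ → Submodule ℂ (Cx V)) (L : Submodule ℂ (Cx V)) : Prop :=
  ∃ (d : ℕ) (b : ℝ → Fin d → Cx V) (e : Fin d → Cx V),
    LinearIndependent ℂ e ∧ Submodule.span ℂ (Set.range e) = L ∧
    (∀ᶠ y in Filter.atTop, Submodule.span ℂ (Set.range (b y)) = U y) ∧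
    ∀ (i : Fin d) (l : Module.Dual ℂ (Cx V)),
      Filter.Tendsto (fun y => l (b y i)) Filter.atTop (nhds (l (e i)))

/-- `L = φ_∞(F, N) = lim_{y → +∞} exp(i y N) F` in the flag variety `Ď`. -/
def IsNaiveLimit (F : CFil V) (N : Module.End ℝ V) (L : CFil V) : Prop :=
  ∀ p, TendstoSub (fun y => nilOrbit F N (Complex.I * (y : ℂ)) p) (L p)

/-- `Δ̄_D`: the `Aut(V_ℝ, Q)`-orbits of the naive limits of `ℝ`-split PMHS on the full period
domain. -/
def DeltaBar (n : ℤ) (Q : LinearMap.BilinForm ℝ V) (h : ℤ → ℕ) : Set (Set (CFil V)) :=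
  {O | ∃ (x : RSplitPMHS n Q h (periodDomain n Q h)) (L : CFil V),
    IsNaiveLimit x.F x.N L ∧ O = orbit Q L}

end PeriodDomain

/-! All three assertions reduce to linear algebra of a bigraded space, isolated in `SplitData`: a
complex space with a conjugation, a form, a nilpotent N of type (-1,-1), and a bigrading whose
primitive parts are polarized. For an ℝ-split PMHS the bigrading is Deligne's
(`RSplitPMHS.splitData`).

Classification. Each primitive part carries a positive Hermitian form, and orthonormal bases can be
chosen so that conjugation carries the basis in type (p,q) to the one in type (q,p). Applying powers
of N gives a basis of strings. In it the matrices of N, of conjugation and of the form depend only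
on the number of strings starting in each bidegree, which is f(p,q) - f(p+1,q+1) for the diamond f.
Hence equal diamonds give isomorphic split data (`SplitData.exists_iso`). The isomorphism commutes
with conjugation, so it is the complexification of an element of Aut(V,Q).

Limits. Let τ(t) act on I^{r,s} by t^{-s}. It preserves F and rescales N by t, so e^{iyN}F is the
τ(y/y₁)-translate of e^{iy₁N}F. For suitable y₁ the space e^{iy₁N}F^p is complementary to the
conjugate of F^{n+1-p}, which is the sum of the I^{r,s} with s ≥ n+1-p. It is therefore a graph over
the sum L^p of the remaining I^{r,s}, and τ contracts this graph to L^p as y grows. The dimensions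
of the intersections of the L^p with the conjugates of the L^q are partial sums of the diamond over
quadrants, so the Aut-orbit of L determines the diamond (`RSplitPMHS.diamond_eq_of_limit`). Together
with the classification this makes the limit map injective on classes; equivariance of limits gives
well-definedness, and also that conjugate PMHS have equal diamonds.

Existence. An admissible f is a sum of strings. A string of length l is realized by polynomials of
degree at most l with N = d/dX and the invariant pairing; then e^{zN} is the translation X ↦ X + z.
The monomials give the split bigrading, while the polynomials (X+i)^m (X-i)^{l-m} diagonalize
e^{iN}F and show that it is a polarized Hodge structure with Hodge numbers h. The classification
with N = 0 identifies it with φ, so the model is transported to V with e^{iN}F = φ exactly. Finally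
e^{zN}F is obtained from φ by a real scaling of the weights followed by e^{xN} with x = Re z. These
are isometries joined to the identity by a path, so the nilpotent orbit stays in the connected
domain (`nilOrbit_mem_connDomain`). -/

namespace PeriodDomain

/-! ### Internal direct sum decompositions -/

section Graded

variable {K : Type*} {ι : Type*} {E : Type*} [Field K] [AddCommGroup E] [Module K E]
  [DecidableEq ι] {J : ι → Submodule K E}

/-- The linear map acting on the summand `J x` of an internal direct sum as the scalar `c x`. -/
noncomputable def scaleBy (h : DirectSum.IsInternal J) (c : ι → K) : E →ₗ[K] E :=
  DirectSum.toModule K ι E (fun x => c x • (J x).subtype) ∘ₗ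
    (LinearEquiv.ofBijective (DirectSum.coeLinearMap J) h).symm.toLinearMap

lemma scaleBy_of_mem (h : DirectSum.IsInternal J) (c : ι → K) {x : ι} {v : E} (hv : v ∈ J x) :
    scaleBy h c v = c x • v := by
  have : (LinearEquiv.ofBijective (DirectSum.coeLinearMap J) h).symm v
      = DirectSum.lof K ι (fun x => J x) x ⟨v, hv⟩ := by
    rw [LinearEquiv.symm_apply_eq]
    exact (DirectSum.coeLinearMap_lof J x ⟨v, hv⟩).symm
  rw [scaleBy, LinearMap.comp_apply, LinearEquiv.coe_toLinearMap, this, DirectSum.toModule_lof]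
  rfl

/-- The projection onto the summand `J x`. -/
noncomputable def proj (h : DirectSum.IsInternal J) (x : ι) : E →ₗ[K] E :=
  scaleBy h (Pi.single x 1)

lemma proj_of_mem (h : DirectSum.IsInternal J) {x : ι} {v : E} (hv : v ∈ J x) :
    proj h x v = v := by
  rw [proj, scaleBy_of_mem h _ hv]; simp

lemma proj_of_mem_ne (h : DirectSum.IsInternal J) {x y : ι} (hxy : y ≠ x) {v : E}
    (hv : v ∈ J y) : proj h x v = 0 := by
  rw [proj, scaleBy_of_mem h _ hv]; simp [hxy]

lemma IsInternal.induction (h : DirectSum.IsInternal J) {motive : E → Prop}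
    (mem : ∀ x, ∀ v ∈ J x, motive v) (zero : motive 0)
    (add : ∀ u v, motive u → motive v → motive (u + v)) (v : E) : motive v := by
  have hv : v ∈ ⨆ x, J x := by rw [h.submodule_iSup_eq_top]; trivial
  exact Submodule.iSup_induction J (motive := motive) hv mem zero add

lemma proj_mem (h : DirectSum.IsInternal J) (x : ι) (v : E) : proj h x v ∈ J x := by
  refine IsInternal.induction h (motive := fun v => proj h x v ∈ J x) ?_ (by simp) ?_ v
  · intro y v hv
    by_cases hxy : y = x
    · subst hxy; rwa [proj_of_mem h hv]
    · rw [proj_of_mem_ne h hxy hv]; exact zero_mem _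
  · intro u v hu hv
    rw [map_add]; exact add_mem hu hv

lemma mem_sum_proj (h : DirectSum.IsInternal J) (v : E) :
    ∃ s : Finset ι, v = ∑ x ∈ s, proj h x v := by
  -- Asking for the identity on every finite set containing s lets the finite sets of two summands
  -- be merged by union.
  have key : ∃ s : Finset ι, ∀ t, s ⊆ t → v = ∑ x ∈ t, proj h x v := by
    refine IsInternal.induction h
      (motive := fun v => ∃ s : Finset ι, ∀ t, s ⊆ t → v = ∑ x ∈ t, proj h x v) ?_ ?_ ?_ v
    · intro x v hv
      refine ⟨{x}, fun t ht => ?_⟩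
      rw [Finset.sum_eq_single x, proj_of_mem h hv]
      · intro y _ hy; exact proj_of_mem_ne h (Ne.symm hy) hv
      · intro hx; exact absurd (ht (Finset.mem_singleton_self x)) hx
    · exact ⟨∅, by simp⟩
    · rintro u v ⟨s, hs⟩ ⟨t, ht⟩
      refine ⟨s ∪ t, fun w hw => ?_⟩
      simp only [map_add, Finset.sum_add_distrib]
      rw [← hs w (Finset.subset_union_left.trans hw), ← ht w (Finset.subset_union_right.trans hw)]
  obtain ⟨s, hs⟩ := key
  exact ⟨s, hs s subset_rfl⟩

lemma eq_zero_of_proj (h : DirectSum.IsInternal J) {v : E} (hv : ∀ x, proj h x v = 0) : v = 0 := by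
  obtain ⟨s, hs⟩ := mem_sum_proj h v
  rw [hs]; exact Finset.sum_eq_zero fun x _ => hv x

lemma eq_of_proj (h : DirectSum.IsInternal J) {u v : E} (huv : ∀ x, proj h x u = proj h x v) :
    u = v :=
  sub_eq_zero.1 (eq_zero_of_proj h fun x => by rw [map_sub, huv, sub_self])

/-- Membership in a sum of summands. -/
lemma mem_iSup_iff_proj (h : DirectSum.IsInternal J) (P : ι → Prop) (v : E) :
    (v ∈ ⨆ x, ⨆ _ : P x, J x) ↔ ∀ x, ¬ P x → proj h x v = 0 := by
  constructor
  · intro hv x hx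
    have : (⨆ x, ⨆ _ : P x, J x) ≤ LinearMap.ker (proj h x) := by
      refine iSup₂_le fun y hy v hv => ?_
      exact proj_of_mem_ne h (by rintro rfl; exact hx hy) hv
    exact this hv
  · intro hv
    obtain ⟨s, hs⟩ := mem_sum_proj h v
    rw [hs]
    refine Submodule.sum_mem _ fun x _ => ?_
    by_cases hx : P x
    · exact (le_iSup₂_of_le (f := fun x (_ : P x) => J x) x hx le_rfl) (proj_mem h x v)
    · rw [hv x hx]; exact zero_mem _

lemma mem_iff_proj (h : DirectSum.IsInternal J) (y : ι) (v : E) :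
    v ∈ J y ↔ ∀ x, x ≠ y → proj h x v = 0 := by
  have := mem_iSup_iff_proj h (fun x => x = y) v
  simpa using this

lemma proj_scaleBy (h : DirectSum.IsInternal J) (c : ι → K) (x : ι) (v : E) :
    proj h x (scaleBy h c v) = c x • proj h x v := by
  refine IsInternal.induction h
    (motive := fun v => proj h x (scaleBy h c v) = c x • proj h x v) ?_ (by simp) ?_ v
  · intro y v hv
    rw [scaleBy_of_mem h c hv, map_smul]
    by_cases hxy : y = x
    · rw [hxy]
    · simp [proj_of_mem_ne h hxy hv]
  · intro u v hu hv
    simp [hu, hv]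

lemma scaleBy_mul (h : DirectSum.IsInternal J) (c d : ι → K) (v : E) :
    scaleBy h c (scaleBy h d v) = scaleBy h (c * d) v := by
  refine eq_of_proj h fun x => ?_
  simp [proj_scaleBy, mul_smul]

lemma scaleBy_one (h : DirectSum.IsInternal J) (v : E) : scaleBy h 1 v = v :=
  eq_of_proj h fun x => by simp [proj_scaleBy]

/-- Projections commute with (semi)linear maps which map summands to summands. -/
lemma proj_map {K' ι' E' : Type*} [Field K'] [AddCommGroup E'] [Module K' E'] [DecidableEq ι']
    {J' : ι' → Submodule K' E'} {τ : K →+* K'} (h : DirectSum.IsInternal J)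
    (h' : DirectSum.IsInternal J') (T : E →ₛₗ[τ] E') {g : ι → ι'} (hg : Function.Injective g)
    (hT : ∀ x, ∀ v ∈ J x, T v ∈ J' (g x)) (x : ι) (v : E) :
    proj h' (g x) (T v) = T (proj h x v) := by
  refine IsInternal.induction h
    (motive := fun v => proj h' (g x) (T v) = T (proj h x v)) ?_ (by simp) ?_ v
  · intro y v hv
    by_cases hxy : y = x
    · subst hxy; rw [proj_of_mem h hv, proj_of_mem h' (hT _ _ hv)]
    · rw [proj_of_mem_ne h hxy hv, proj_of_mem_ne h' (hg.ne hxy) (hT _ _ hv), map_zero]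
  · intro u v hu hv
    simp [hu, hv]

lemma finite_ne_bot [FiniteDimensional K E] (h : DirectSum.IsInternal J) :
    {x | J x ≠ ⊥}.Finite :=
  WellFoundedGT.finite_ne_bot_of_iSupIndep h.submodule_iSupIndep

lemma proj_eq_zero_of_bot (h : DirectSum.IsInternal J) {x : ι} (hx : J x = ⊥) (v : E) :
    proj h x v = 0 := by
  have := proj_mem h x v
  rwa [hx, Submodule.mem_bot] at this

lemma sum_proj [FiniteDimensional K E] (h : DirectSum.IsInternal J) (v : E) :
    v = ∑ x ∈ (finite_ne_bot h).toFinset, proj h x v := by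
  refine eq_of_proj h fun y => ?_
  rw [map_sum]
  by_cases hy : J y = ⊥
  · rw [proj_eq_zero_of_bot h hy]
    exact (Finset.sum_eq_zero fun x _ => proj_eq_zero_of_bot h hy _).symm
  · rw [Finset.sum_eq_single y, proj_of_mem h (proj_mem h y v)]
    · intro x _ hx; exact proj_of_mem_ne h hx (proj_mem h x v)
    · intro hy'; simp [hy] at hy'

/-- A basis together with a grading of its index set gives an internal decomposition. -/
lemma isInternal_span_basis {S : Type*} (β : Module.Basis S K E) (d : S → ι) :
    DirectSum.IsInternal fun x => Submodule.span K (β '' (d ⁻¹' {x})) := by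
  classical
  refine DirectSum.isInternal_submodule_of_iSupIndep_of_iSup_eq_top ?_ ?_
  · intro x
    have : (⨆ y, ⨆ _ : y ≠ x, Submodule.span K (β '' (d ⁻¹' {y})))
        = Submodule.span K (β '' (d ⁻¹' {x}ᶜ)) := by
      simp only [← Submodule.span_iUnion]
      congr 1
      ext v
      simp only [Set.mem_iUnion, Set.mem_image, Set.mem_preimage, Set.mem_singleton_iff,
        Set.mem_compl_iff]
      constructor
      · rintro ⟨y, hy, s, hs, rfl⟩; exact ⟨s, by rw [hs]; exact hy, rfl⟩
      · rintro ⟨s, hs, rfl⟩; exact ⟨d s, hs, s, rfl, rfl⟩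
    rw [this]
    exact β.linearIndependent.disjoint_span_image
      (Set.disjoint_left.2 fun s hs hs' => hs' hs)
  · rw [← Submodule.span_iUnion, eq_top_iff, ← β.span_eq]
    refine Submodule.span_mono ?_
    rintro _ ⟨s, rfl⟩
    exact Set.mem_iUnion.2 ⟨d s, s, rfl, rfl⟩

lemma finrank_span_basis {S : Type*} (β : Module.Basis S K E) (T : Set S) :
    Module.finrank K (Submodule.span K (β '' T)) = Nat.card T := by
  classical
  have hli : LinearIndependent K (fun s : T => β s) :=
    β.linearIndependent.comp _ Subtype.val_injective
  have : β '' T = Set.range (fun s : T => β s) := by rw [Set.image_eq_range]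
  rw [this, Module.finrank_eq_nat_card_basis (Module.Basis.span hli)]

end Graded


/-! ### Exponentials of nilpotent endomorphisms -/

section Exp

variable {E : Type*} [AddCommGroup E] [Module ℂ E]

/-- The exponential of a nilpotent endomorphism of a complex vector space. -/
noncomputable def nexp (A : Module.End ℂ E) : Module.End ℂ E :=
  -- `IsNilpotent.exp` needs a rational structure; it is restricted from ℂ locally and disappears
  -- again in `nexp_eq_sum`.
  letI : Module ℚ (Module.End ℂ E) := Module.compHom _ (algebraMap ℚ ℂ)
  IsNilpotent.exp A

lemma nexp_eq_sum {A : Module.End ℂ E} {k : ℕ} (h : A ^ k = 0) :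
    nexp A = ∑ i ∈ Finset.range k, ((i.factorial : ℂ)⁻¹) • A ^ i := by
  let _ : Module ℚ (Module.End ℂ E) := Module.compHom _ (algebraMap ℚ ℂ)
  rw [nexp, IsNilpotent.exp_eq_sum h]
  refine Finset.sum_congr rfl fun i _ => ?_
  change (algebraMap ℚ ℂ ((i.factorial : ℚ)⁻¹)) • A ^ i = _
  simp

lemma nexp_zero : nexp (0 : Module.End ℂ E) = 1 := by
  let _ : Module ℚ (Module.End ℂ E) := Module.compHom _ (algebraMap ℚ ℂ)
  exact IsNilpotent.exp_zero

lemma nexp_add_smul {A : Module.End ℂ E} (hA : IsNilpotent A) (z w : ℂ) :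
    nexp ((z + w) • A) = nexp (z • A) * nexp (w • A) := by
  let _ : Module ℚ (Module.End ℂ E) := Module.compHom _ (algebraMap ℚ ℂ)
  rw [nexp, add_smul, IsNilpotent.exp_add_of_commute]
  · rfl
  · exact ((Commute.refl A).smul_left z).smul_right w
  · exact hA.smul z
  · exact hA.smul w

lemma nexp_zero_smul (A : Module.End ℂ E) : nexp ((0 : ℂ) • A) = 1 := by
  rw [zero_smul, nexp_zero]

lemma nexp_neg_smul_apply {A : Module.End ℂ E} (hA : IsNilpotent A) (z : ℂ) (v : E) :
    nexp ((-z) • A) (nexp (z • A) v) = v := by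
  rw [← Module.End.mul_apply, ← nexp_add_smul hA, neg_add_cancel, nexp_zero_smul]; rfl

lemma nexp_smul_neg_apply {A : Module.End ℂ E} (hA : IsNilpotent A) (z : ℂ) (v : E) :
    nexp (z • A) (nexp ((-z) • A) v) = v := by
  rw [← Module.End.mul_apply, ← nexp_add_smul hA, add_neg_cancel, nexp_zero_smul]; rfl

/-- Intertwining of exponentials by (semi)linear maps. -/
lemma nexp_intertwine {E' : Type*} [AddCommGroup E'] [Module ℂ E'] {τ : ℂ →+* ℂ}
    {A : Module.End ℂ E} {A' : Module.End ℂ E'} (hA : IsNilpotent A) (hA' : IsNilpotent A')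
    (T : E →ₛₗ[τ] E') (h : ∀ v, T (A v) = A' (T v)) (v : E) :
    T (nexp A v) = nexp A' (T v) := by
  obtain ⟨k, hk⟩ := hA
  obtain ⟨l, hl⟩ := hA'
  -- A common exponent killing both operators makes the two exponentials sums over the same range.
  -- The coefficients 1/j! are fixed by every ring homomorphism, so semilinearity of T does no harm.
  have h1 : A ^ (k + l) = 0 := by rw [pow_add, hk, zero_mul]
  have h2 : A' ^ (k + l) = 0 := by rw [pow_add, hl, mul_zero]
  rw [nexp_eq_sum h1, nexp_eq_sum h2]
  simp only [LinearMap.sum_apply, map_sum]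
  refine Finset.sum_congr rfl fun j _ => ?_
  have hj : ∀ v, T ((A ^ j) v) = (A' ^ j) (T v) := by
    clear * - h
    induction j with
    | zero => simp
    | succ j ih =>
      intro v
      rw [pow_succ, pow_succ, Module.End.mul_apply, Module.End.mul_apply]
      rw [ih (A v), h]
  simp only [LinearMap.smul_apply]
  rw [map_smulₛₗ, hj]
  simp

/-- The exponential of a skew endomorphism is an isometry. -/
lemma nexp_isometry {A : Module.End ℂ E} (hA : IsNilpotent A) (B : LinearMap.BilinForm ℂ E)
    (h : ∀ u v, B (A u) v = - B u (A v)) (z : ℂ) (u v : E) :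
    B (nexp (z • A) u) (nexp (z • A) v) = B u v := by
  obtain ⟨k, hk⟩ := hA
  -- The adjoint of e^{zA} is e^{-zA}, by skewness term by term.
  have key : ∀ u v, B (nexp (z • A) u) v = B u (nexp ((-z) • A) v) := by
    intro u v
    have h1 : (z • A) ^ k = 0 := by rw [smul_pow, hk, smul_zero]
    have h2 : ((-z) • A) ^ k = 0 := by rw [smul_pow, hk, smul_zero]
    rw [nexp_eq_sum h1, nexp_eq_sum h2]
    simp only [LinearMap.sum_apply, map_sum]
    refine Finset.sum_congr rfl fun j _ => ?_
    have hj : ∀ u v, B ((A ^ j) u) v = (-1) ^ j * B u ((A ^ j) v) := by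
      clear * - h
      induction j with
      | zero => simp
      | succ j ih =>
        intro u v
        rw [pow_succ A, Module.End.mul_apply, ih, h, ← Module.End.mul_apply, ← pow_succ',
          ← pow_succ]
        ring
    simp only [LinearMap.smul_apply]
    rw [map_smul, map_smul, smul_pow, smul_pow]
    simp only [LinearMap.smul_apply, map_smul, smul_eq_mul, hj]
    rw [neg_pow z]
    ring
  rw [key, nexp_neg_smul_apply ⟨k, hk⟩]

end Exp

/-! ### The complexification -/

section Complexification

variable {V : Type*} [AddCommGroup V] [Module ℝ V]

/-- The real part `V_ℂ → V`. -/
noncomputable def reV (V : Type*) [AddCommGroup V] [Module ℝ V] : Cx V →ₗ[ℝ] V :=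
  (TensorProduct.lid ℝ V).toLinearMap ∘ₗ Complex.reLm.rTensor V

/-- The imaginary part `V_ℂ → V`. -/
noncomputable def imV (V : Type*) [AddCommGroup V] [Module ℝ V] : Cx V →ₗ[ℝ] V :=
  (TensorProduct.lid ℝ V).toLinearMap ∘ₗ Complex.imLm.rTensor V

@[simp] lemma reV_tmul (a : ℂ) (v : V) : reV V (a ⊗ₜ v) = a.re • v := by simp [reV]

@[simp] lemma imV_tmul (a : ℂ) (v : V) : imV V (a ⊗ₜ v) = a.im • v := by simp [imV]

@[simp] lemma conj_tmul (a : ℂ) (v : V) :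
    conj V (a ⊗ₜ v) = (starRingEnd ℂ a) ⊗ₜ v := by
  change TensorProduct.map Complex.conjAe.toLinearMap LinearMap.id (a ⊗ₜ v) = _
  simp

lemma real_smul (r : ℝ) (x : Cx V) : (r : ℂ) • x = r • x := algebraMap_smul ℂ r x

lemma re_add_im (x : Cx V) :
    x = (1 : ℂ) ⊗ₜ[ℝ] reV V x + Complex.I • ((1 : ℂ) ⊗ₜ[ℝ] imV V x) := by
  induction x using TensorProduct.induction_on with
  | zero => simp
  | tmul a v =>
    simp only [reV_tmul, imV_tmul, TensorProduct.tmul_smul, TensorProduct.smul_tmul',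
      ← TensorProduct.add_tmul]
    congr 1
    apply Complex.ext <;> simp
  | add x y hx hy =>
    simp only [map_add, TensorProduct.tmul_add, smul_add]
    nth_rewrite 1 [hx, hy]
    abel

lemma ext_re_im {x y : Cx V} (h1 : reV V x = reV V y) (h2 : imV V x = imV V y) : x = y := by
  rw [re_add_im x, re_add_im y, h1, h2]

@[simp] lemma conj_conj (x : Cx V) : conj V (conj V x) = x := by
  induction x using TensorProduct.induction_on with
  | zero => simp
  | tmul a v => simp
  | add x y hx hy => rw [map_add, map_add, hx, hy]

@[simp] lemma reV_conj (x : Cx V) : reV V (conj V x) = reV V x := by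
  induction x using TensorProduct.induction_on with
  | zero => simp
  | tmul a v => simp
  | add x y hx hy => rw [map_add, map_add, map_add, hx, hy]

@[simp] lemma imV_conj (x : Cx V) : imV V (conj V x) = - imV V x := by
  induction x using TensorProduct.induction_on with
  | zero => simp
  | tmul a v => simp
  | add x y hx hy => rw [map_add, map_add, map_add, hx, hy, neg_add]

lemma eq_one_tmul_of_conj {x : Cx V} (h : conj V x = x) : x = (1 : ℂ) ⊗ₜ[ℝ] reV V x := by
  have h1 : imV V x = - imV V x := by
    conv_lhs => rw [← h]
    exact imV_conj x
  have h2 : imV V x = 0 := by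
    have h3 : (2 : ℝ) • imV V x = 0 := by
      rw [two_smul]; nth_rewrite 1 [h1]; exact neg_add_cancel _
    exact (smul_eq_zero.1 h3).resolve_left two_ne_zero
  conv_lhs => rw [re_add_im x, h2]
  simp

lemma one_tmul_re (x : Cx V) :
    (1 : ℂ) ⊗ₜ[ℝ] reV V x = (2⁻¹ : ℂ) • (x + conj V x) := by
  refine ext_re_im ?_ ?_
  · have : (2⁻¹ : ℂ) • (x + conj V x) = (2⁻¹ : ℝ) • (x + conj V x) := by
      rw [show (2⁻¹ : ℂ) = ((2⁻¹ : ℝ) : ℂ) by norm_num, real_smul]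
    rw [this, map_smul, map_add, reV_conj, ← two_smul ℝ, smul_smul]
    norm_num
  · have : (2⁻¹ : ℂ) • (x + conj V x) = (2⁻¹ : ℝ) • (x + conj V x) := by
      rw [show (2⁻¹ : ℂ) = ((2⁻¹ : ℝ) : ℂ) by norm_num, real_smul]
    rw [this, map_smul, map_add, imV_conj]
    simp

lemma one_tmul_im (x : Cx V) :
    (1 : ℂ) ⊗ₜ[ℝ] imV V x = (-(2⁻¹ : ℂ) * Complex.I) • (x - conj V x) := by
  have h := re_add_im x
  rw [one_tmul_re] at h
  have h2 : Complex.I • ((1 : ℂ) ⊗ₜ[ℝ] imV V x) = (2⁻¹ : ℂ) • (x - conj V x) := by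
    rw [eq_comm, ← eq_sub_iff_add_eq'] at h
    rw [h, smul_add, smul_sub]
    nth_rewrite 1 [show x = (2⁻¹ : ℂ) • x + (2⁻¹ : ℂ) • x by rw [← add_smul]; norm_num]
    abel
  have h3 : (1 : ℂ) ⊗ₜ[ℝ] imV V x
      = (-Complex.I) • (Complex.I • ((1 : ℂ) ⊗ₜ[ℝ] imV V x)) := by
    rw [smul_smul]; simp
  rw [h3, h2, smul_smul]
  congr 1
  ring

variable {V' : Type*} [AddCommGroup V'] [Module ℝ V']

lemma reV_baseChange (f : V →ₗ[ℝ] V') (x : Cx V) :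
    reV V' (f.baseChange ℂ x) = f (reV V x) := by
  induction x using TensorProduct.induction_on with
  | zero => simp
  | tmul a v => simp
  | add x y hx hy => simp only [map_add, hx, hy]

lemma imV_baseChange (f : V →ₗ[ℝ] V') (x : Cx V) :
    imV V' (f.baseChange ℂ x) = f (imV V x) := by
  induction x using TensorProduct.induction_on with
  | zero => simp
  | tmul a v => simp
  | add x y hx hy => simp only [map_add, hx, hy]

lemma conj_baseChange (f : V →ₗ[ℝ] V') (x : Cx V) :
    conj V' (f.baseChange ℂ x) = f.baseChange ℂ (conj V x) :=
  ext_re_im (by simp [reV_baseChange]) (by simp [imV_baseChange])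

lemma mem_baseChange_iff (U : Submodule ℝ V) (x : Cx V) :
    x ∈ U.baseChange ℂ ↔ reV V x ∈ U ∧ imV V x ∈ U := by
  constructor
  · intro hx
    rw [Submodule.baseChange_eq_span] at hx
    refine Submodule.span_induction ?_ (by simp) ?_ ?_ hx
    · rintro _ ⟨u, hu, rfl⟩
      simpa using hu
    · intro x y _ _ hx hy
      simp only [map_add]
      exact ⟨add_mem hx.1 hy.1, add_mem hx.2 hy.2⟩
    · intro a x _ hx
      have : a • x = (1 : ℂ) ⊗ₜ[ℝ] (a.re • reV V x - a.im • imV V x)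
          + Complex.I • ((1 : ℂ) ⊗ₜ[ℝ] (a.re • imV V x + a.im • reV V x)) := by
        conv_lhs => rw [re_add_im x]
        have e1 : ∀ (r : ℝ) (v : V), (1 : ℂ) ⊗ₜ[ℝ] (r • v) = (r : ℂ) • ((1 : ℂ) ⊗ₜ[ℝ] v) := by
          intro r v
          rw [TensorProduct.tmul_smul, real_smul]
        simp only [TensorProduct.tmul_add, TensorProduct.tmul_sub, e1]
        have e2 : a = (a.re : ℂ) + (a.im : ℂ) * Complex.I := (Complex.re_add_im a).symm
        generalize (a.re : ℂ) = r at e2 ⊢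
        generalize (a.im : ℂ) = s at e2 ⊢
        -- This form of s brings I² = -1 into the comparison of coefficients.
        have e3 : s = -(Complex.I * Complex.I * s) := by rw [Complex.I_mul_I]; ring
        rw [e2]
        conv_rhs => rw [e3]
        match_scalars <;> (ring_nf; try simp)
      rw [this]
      simp only [map_add, reV_tmul, imV_tmul, TensorProduct.smul_tmul', smul_eq_mul, mul_one,
        Complex.one_re, Complex.one_im, Complex.I_re, Complex.I_im, one_smul, zero_smul,
        add_zero, zero_add]
      exact ⟨sub_mem (U.smul_mem _ hx.1) (U.smul_mem _ hx.2),
        add_mem (U.smul_mem _ hx.2) (U.smul_mem _ hx.1)⟩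
  · rintro ⟨h1, h2⟩
    rw [re_add_im x]
    exact add_mem (Submodule.tmul_mem_baseChange_of_mem _ h1)
      (Submodule.smul_mem _ _ (Submodule.tmul_mem_baseChange_of_mem _ h2))

lemma mem_conjSub (U : Submodule ℂ (Cx V)) (x : Cx V) : x ∈ conjSub U ↔ conj V x ∈ U := by
  constructor
  · rintro ⟨y, hy, rfl⟩
    rw [conj_conj]; exact hy
  · intro h
    exact ⟨conj V x, h, conj_conj x⟩

lemma mem_WC (W : ℤ → Submodule ℝ V) (l : ℤ) (x : Cx V) :
    x ∈ WC W l ↔ reV V x ∈ W l ∧ imV V x ∈ W l := mem_baseChange_iff _ _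

lemma conj_mem_WC {W : ℤ → Submodule ℝ V} {l : ℤ} {x : Cx V} (h : x ∈ WC W l) :
    conj V x ∈ WC W l := by
  rw [mem_WC] at h ⊢
  simpa using h

/-- The real points of a complex subspace. -/
def realSub (U : Submodule ℂ (Cx V)) : Submodule ℝ V where
  carrier := {v | (1 : ℂ) ⊗ₜ[ℝ] v ∈ U}
  add_mem' {a b} ha hb := by
    change (1 : ℂ) ⊗ₜ[ℝ] (a + b) ∈ U
    rw [TensorProduct.tmul_add]; exact add_mem ha hb
  zero_mem' := by
    change (1 : ℂ) ⊗ₜ[ℝ] (0 : V) ∈ U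
    simp
  smul_mem' c v hv := by
    change (1 : ℂ) ⊗ₜ[ℝ] (c • v) ∈ U
    rw [TensorProduct.tmul_smul]
    exact (U.restrictScalars ℝ).smul_mem c hv

lemma mem_realSub (U : Submodule ℂ (Cx V)) (v : V) :
    v ∈ realSub U ↔ (1 : ℂ) ⊗ₜ[ℝ] v ∈ U := Iff.rfl

/-- Galois descent: a subspace stable under conjugation contains the real and imaginary parts of its
vectors, these being combinations of x and its conjugate. -/
lemma baseChange_realSub {U : Submodule ℂ (Cx V)} (hU : ∀ x ∈ U, conj V x ∈ U) :
    (realSub U).baseChange ℂ = U := by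
  ext x
  rw [mem_baseChange_iff, mem_realSub, mem_realSub]
  constructor
  · rintro ⟨h1, h2⟩
    rw [re_add_im x]
    exact add_mem h1 (U.smul_mem _ h2)
  · intro hx
    rw [one_tmul_re, one_tmul_im]
    exact ⟨U.smul_mem _ (add_mem hx (hU x hx)), U.smul_mem _ (sub_mem hx (hU x hx))⟩

/-- A complex linear map which commutes with conjugation is defined over `ℝ`. -/
lemma exists_baseChange_eq (T : Cx V →ₗ[ℂ] Cx V') (hT : ∀ x, T (conj V x) = conj V' (T x)) :
    ∃ f : V →ₗ[ℝ] V', f.baseChange ℂ = T := by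
  refine ⟨reV V' ∘ₗ T.restrictScalars ℝ ∘ₗ TensorProduct.mk ℝ ℂ V 1, ?_⟩
  refine TensorProduct.AlgebraTensorModule.curry_injective ?_
  ext v
  simp only [TensorProduct.AlgebraTensorModule.curry_apply, 
    TensorProduct.curry_apply, LinearMap.coe_restrictScalars, LinearMap.baseChange_tmul,
    LinearMap.coe_comp, Function.comp_apply, TensorProduct.mk_apply]
  refine (eq_one_tmul_of_conj ?_).symm
  rw [← hT, conj_tmul, map_one]

lemma baseChange_injective {f g : V →ₗ[ℝ] V'} (h : f.baseChange ℂ = g.baseChange ℂ) : f = g := by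
  ext v
  have := congrArg (reV V') (LinearMap.congr_fun h ((1 : ℂ) ⊗ₜ[ℝ] v))
  simpa using this

/-- A complex linear equivalence which commutes with conjugation is defined over `ℝ`. -/
lemma exists_equiv_baseChange_eq (T : Cx V ≃ₗ[ℂ] Cx V')
    (hT : ∀ x, T (conj V x) = conj V' (T x)) :
    ∃ f : V ≃ₗ[ℝ] V', (f : V →ₗ[ℝ] V').baseChange ℂ = T := by
  obtain ⟨f, hf⟩ := exists_baseChange_eq (T : Cx V →ₗ[ℂ] Cx V') hT
  obtain ⟨g, hg⟩ := exists_baseChange_eq (T.symm : Cx V' →ₗ[ℂ] Cx V) (fun x => by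
    apply T.injective
    simp [hT])
  refine ⟨LinearEquiv.ofLinearMap f g ?_ ?_, hf⟩
  · apply baseChange_injective
    rw [LinearMap.baseChange_comp, hf, hg]
    ext; simp
  · apply baseChange_injective
    rw [LinearMap.baseChange_comp, hf, hg]
    ext; simp

/-! ### The complexified form -/

lemma QC_tmul (Q : LinearMap.BilinForm ℝ V) (a b : ℂ) (u v : V) :
    QC Q (a ⊗ₜ u) (b ⊗ₜ v) = a * b * (Q u v : ℂ) := by
  simp [QC, LinearMap.BilinForm.baseChange_tmul, mul_comm]

lemma QC_re_im (Q : LinearMap.BilinForm ℝ V) (x y : Cx V) :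
    QC Q x y = ((Q (reV V x) (reV V y) - Q (imV V x) (imV V y) : ℝ) : ℂ)
      + Complex.I * ((Q (reV V x) (imV V y) + Q (imV V x) (reV V y) : ℝ) : ℂ) := by
  nth_rewrite 1 [re_add_im x, re_add_im y]
  simp only [map_add, map_smul, LinearMap.add_apply, LinearMap.smul_apply, QC_tmul, smul_eq_mul]
  push_cast
  ring_nf
  simp
  ring

lemma QC_conj (Q : LinearMap.BilinForm ℝ V) (x y : Cx V) :
    QC Q (conj V x) (conj V y) = starRingEnd ℂ (QC Q x y) := by
  rw [QC_re_im, QC_re_im Q x y]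
  simp
  try ring

lemma QC_flip {Q : LinearMap.BilinForm ℝ V} {n : ℤ} (h : ∀ u v, Q u v = (-1 : ℝ) ^ n * Q v u)
    (x y : Cx V) : QC Q x y = (-1 : ℂ) ^ n * QC Q y x := by
  rw [QC_re_im, QC_re_im Q y x, h (reV V x), h (imV V x), h (reV V x), h (imV V x)]
  push_cast
  ring

lemma QC_skew {Q : LinearMap.BilinForm ℝ V} {N : Module.End ℝ V}
    (h : ∀ u v, Q (N u) v + Q u (N v) = 0) (x y : Cx V) :
    QC Q (N.baseChange ℂ x) y = - QC Q x (N.baseChange ℂ y) := by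
  have h' : ∀ u v, Q (N u) v = - Q u (N v) := fun u v => eq_neg_of_add_eq_zero_left (h u v)
  rw [QC_re_im, QC_re_im Q x]
  simp only [reV_baseChange, imV_baseChange, h']
  push_cast
  ring

lemma QC_one_tmul (Q : LinearMap.BilinForm ℝ V) (u v : V) :
    QC Q ((1 : ℂ) ⊗ₜ u) ((1 : ℂ) ⊗ₜ v) = (Q u v : ℂ) := by simp [QC_tmul]

/-! ### Exponentials -/

lemma pow_finrank_eq_zero {K E : Type*} [Field K] [AddCommGroup E] [Module K E]
    [FiniteDimensional K E] {A : Module.End K E} (hA : IsNilpotent A) :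
    A ^ Module.finrank K E = 0 := by
  obtain ⟨k, hk⟩ := hA
  have := Module.End.ker_pow_le_ker_pow_finrank A k
  rw [hk, LinearMap.ker_zero, top_le_iff, LinearMap.ker_eq_top] at this
  exact this

lemma isNilpotent_baseChange {N : Module.End ℝ V} (hN : IsNilpotent N) :
    IsNilpotent (N.baseChange ℂ) := by
  obtain ⟨k, hk⟩ := hN
  refine ⟨k, ?_⟩
  rw [← LinearMap.baseChange_pow, hk, LinearMap.baseChange_zero]

/-- Truncation at dim V loses nothing since N^{dim V} = 0. From here on the group law and the
intertwining property of `nexp` are available. -/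
lemma expN_eq_nexp [FiniteDimensional ℝ V] {N : Module.End ℝ V} (hN : IsNilpotent N) (z : ℂ) :
    expN N z = nexp (z • N.baseChange ℂ) := by
  have h1 : N ^ (Module.finrank ℝ V + 1) = 0 := by
    rw [pow_succ, pow_finrank_eq_zero hN, zero_mul]
  have h2 : (z • N.baseChange ℂ) ^ (Module.finrank ℝ V + 1) = 0 := by
    rw [smul_pow, ← LinearMap.baseChange_pow, h1, LinearMap.baseChange_zero, smul_zero]
  rw [nexp_eq_sum h2, expN]
  refine Finset.sum_congr rfl fun k _ => ?_
  rw [smul_pow, smul_smul, div_eq_inv_mul]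

end Complexification


/-! ### Orthonormal bases -/

/-- A positive definite Hermitian form has an orthonormal basis. -/
lemma exists_orthonormal_basis {𝕜 P : Type*} [RCLike 𝕜] [AddCommGroup P] [Module 𝕜 P]
    [FiniteDimensional 𝕜 P] (f : P → P → 𝕜)
    (conj_symm : ∀ x y, starRingEnd 𝕜 (f y x) = f x y)
    (add_left : ∀ x y z, f (x + y) z = f x z + f y z)
    (smul_left : ∀ x y (r : 𝕜), f (r • x) y = starRingEnd 𝕜 r * f x y)
    (pos : ∀ x, x ≠ 0 → 0 < RCLike.re (f x x)) :
    ∃ b : Module.Basis (Fin (Module.finrank 𝕜 P)) 𝕜 P,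
      ∀ i j, f (b i) (b j) = if i = j then 1 else 0 := by
  have zero_left : ∀ y, f 0 y = 0 := fun y => by simpa using smul_left 0 y 0
  let c : InnerProductSpace.Core 𝕜 P :=
    { inner := f
      conj_inner_symm := conj_symm
      re_inner_nonneg := fun x => by
        by_cases hx : x = 0
        · rw [hx, zero_left]; simp
        · exact (pos x hx).le
      add_left := add_left
      smul_left := smul_left
      definite := fun x hx => by
        by_contra h
        have := pos x h
        change f x x = 0 at hx
        rw [hx] at this; simp at this }
  let _ : NormedAddCommGroup P := c.toNormedAddCommGroup
  let _ : InnerProductSpace 𝕜 P := InnerProductSpace.ofCore c.toCore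
  refine ⟨(stdOrthonormalBasis 𝕜 P).toBasis, fun i j => ?_⟩
  have := orthonormal_iff_ite.1 (stdOrthonormalBasis 𝕜 P).orthonormal i j
  rw [OrthonormalBasis.coe_toBasis]
  exact this

/-- Used with functionals B(·, v*), where v* is the vector dual to v under a Gram matrix with one
nonzero entry per row. -/
lemma linearIndependent_of_dual {K E S : Type*} [Field K] [AddCommGroup E] [Module K E]
    (v : S → E) (φ : S → E →ₗ[K] K) (h : ∀ i, φ i (v i) ≠ 0) (h' : ∀ i j, j ≠ i → φ i (v j) = 0) :
    LinearIndependent K v := by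
  rw [linearIndependent_iff']
  intro s c hc i hi
  have h1 := congrArg (φ i) hc
  rw [map_sum, map_zero, Finset.sum_eq_single i] at h1
  · rw [map_smul, smul_eq_mul] at h1
    exact (mul_eq_zero.1 h1).resolve_right (h i)
  · intro j _ hj
    rw [map_smul, h' i j hj, smul_zero]
  · intro h; exact absurd hi h

/-! ### Real split polarized bigradings -/

/-- The linear algebra of an `ℝ`-split polarized mixed Hodge structure on a complex vector space
with a real structure `σ`: a bigrading `J`, lowered by the nilpotent `N`. -/
structure SplitData (n : ℤ) {E : Type*} [AddCommGroup E] [Module ℂ E]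
    (σ : E →ₛₗ[starRingEnd ℂ] E) (B : LinearMap.BilinForm ℂ E) (N : Module.End ℂ E)
    (J : ℤ × ℤ → Submodule ℂ E) : Prop where
  internal : DirectSum.IsInternal J
  conj_mem : ∀ p q, ∀ v ∈ J (p, q), σ v ∈ J (q, p)
  lower : ∀ p q, ∀ v ∈ J (p, q), N v ∈ J (p - 1, q - 1)
  inj : ∀ (l : ℕ) (p q : ℤ), p + q = n + l → ∀ v ∈ J (p, q), (N ^ l) v = 0 → v = 0
  surj : ∀ (l : ℕ) (p q : ℤ), p + q = n + l → ∀ v ∈ J (p - l, q - l), ∃ w ∈ J (p, q), (N ^ l) w = v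
  conj_conj : ∀ v, σ (σ v) = v
  conj_N : ∀ v, σ (N v) = N (σ v)
  form_conj : ∀ u v, B (σ u) (σ v) = starRingEnd ℂ (B u v)
  form_flip : ∀ u v, B u v = (-1) ^ n * B v u
  skew : ∀ u v, B (N u) v = - B u (N v)
  orth : ∀ p q r s, n < p + r → ∀ u ∈ J (p, q), ∀ v ∈ J (r, s), B u v = 0
  pos : ∀ (l : ℕ) (p q : ℤ), p + q = n + l → ∀ v ∈ J (p, q), (N ^ (l + 1)) v = 0 → v ≠ 0 →
    0 < (Complex.I ^ (p - q) * B v ((N ^ l) (σ v))).re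

namespace SplitData

variable {n : ℤ} {E : Type*} [AddCommGroup E] [Module ℂ E]
  {σ : E →ₛₗ[starRingEnd ℂ] E} {B : LinearMap.BilinForm ℂ E} {N : Module.End ℂ E}
  {J : ℤ × ℤ → Submodule ℂ E}

lemma pow_mem (h : SplitData n σ B N J) (k : ℕ) {p q : ℤ} {v : E} (hv : v ∈ J (p, q)) :
    (N ^ k) v ∈ J (p - k, q - k) := by
  induction k with
  | zero => simpa using hv
  | succ k ih =>
    rw [pow_succ', Module.End.mul_apply]
    have := h.lower _ _ _ ih
    push_cast
    rwa [sub_sub, sub_sub] at this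

lemma skew_pow (h : SplitData n σ B N J) (k : ℕ) (u v : E) :
    B ((N ^ k) u) v = (-1) ^ k * B u ((N ^ k) v) := by
  induction k generalizing u v with
  | zero => simp
  | succ k ih =>
    rw [pow_succ N, Module.End.mul_apply, ih, h.skew, ← Module.End.mul_apply, ← pow_succ',
      ← pow_succ]
    ring

lemma conj_pow (h : SplitData n σ B N J) (k : ℕ) (v : E) : σ ((N ^ k) v) = (N ^ k) (σ v) := by
  induction k generalizing v with
  | zero => simp
  | succ k ih => rw [pow_succ, Module.End.mul_apply, Module.End.mul_apply, ih, h.conj_N]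

/-- The conjugate of the field `orth`: conjugation swaps the two indices. -/
lemma orth' (h : SplitData n σ B N J) {p q r s : ℤ} (hqs : n < q + s) {u v : E}
    (hu : u ∈ J (p, q)) (hv : v ∈ J (r, s)) : B u v = 0 := by
  have h1 := h.orth q p s r hqs _ (h.conj_mem _ _ _ hu) _ (h.conj_mem _ _ _ hv)
  rw [h.form_conj] at h1
  simpa using h1

/-- The conjugates of a basis of U span U'. This replaces the rank comparison for linear maps, σ
being only semilinear. -/
lemma finrank_conj_le [FiniteDimensional ℂ E] (hσ : ∀ v, σ (σ v) = v) {U U' : Submodule ℂ E}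
    (hU : ∀ v ∈ U', σ v ∈ U) : Module.finrank ℂ U' ≤ Module.finrank ℂ U := by
  let b := Module.finBasis ℂ U
  have h1 : U' ≤ Submodule.span ℂ (Set.range fun i => σ (b i)) := by
    intro v hv
    have h2 := b.sum_repr ⟨σ v, hU v hv⟩
    have h3 : σ v = ∑ i, b.repr ⟨σ v, hU v hv⟩ i • (b i : E) := by
      have := congrArg (Submodule.subtype U) h2
      rw [map_sum] at this
      exact this.symm
    rw [← hσ v, h3, map_sum]
    refine Submodule.sum_mem _ fun i _ => ?_
    rw [map_smulₛₗ]
    exact Submodule.smul_mem _ _ (Submodule.subset_span ⟨i, rfl⟩)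
  refine (Submodule.finrank_mono h1).trans ?_
  refine (finrank_range_le_card _).trans ?_
  simp

lemma finrank_symm [FiniteDimensional ℂ E] (h : SplitData n σ B N J) (p q : ℤ) :
    Module.finrank ℂ (J (p, q)) = Module.finrank ℂ (J (q, p)) :=
  le_antisymm (finrank_conj_le h.conj_conj (h.conj_mem p q))
    (finrank_conj_le h.conj_conj (h.conj_mem q p))

variable (N J) in
/-- The primitive part of `J (p, q)`. -/
def prim (l : ℕ) (x : ℤ × ℤ) : Submodule ℂ E := J x ⊓ LinearMap.ker (N ^ (l + 1))

lemma mem_prim {l : ℕ} {x : ℤ × ℤ} {v : E} : v ∈ prim N J l x ↔ v ∈ J x ∧ (N ^ (l + 1)) v = 0 :=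
  Iff.rfl

lemma conj_mem_prim (h : SplitData n σ B N J) {l : ℕ} {p q : ℤ} {v : E}
    (hv : v ∈ prim N J l (p, q)) : σ v ∈ prim N J l (q, p) :=
  ⟨h.conj_mem _ _ _ hv.1, by
    change (N ^ (l + 1)) (σ v) = 0
    rw [← h.conj_pow, (mem_prim.1 hv).2, map_zero]⟩

/-- Rank and nullity of N^{l+1} : J(p,q) → J(p-l-1,q-l-1), whose kernel is the primitive part. It is
onto because already N^{l+2} maps J(p+1,q+1) isomorphically onto the same target. -/
lemma finrank_prim [FiniteDimensional ℂ E] (h : SplitData n σ B N J) {l : ℕ} {p q : ℤ}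
    (hpq : p + q = n + l) :
    Module.finrank ℂ (prim N J l (p, q)) + Module.finrank ℂ (J (p + 1, q + 1))
      = Module.finrank ℂ (J (p, q)) := by
  have h1 : Module.finrank ℂ (J (p + 1, q + 1))
      = Module.finrank ℂ (J (p - (l + 1), q - (l + 1))) := by
    refine LinearEquiv.finrank_eq (LinearEquiv.ofBijective
      ((N ^ (l + 2)).restrict (p := J (p + 1, q + 1)) (q := J (p - (l + 1), q - (l + 1)))
        fun v hv => ?_) ⟨?_, ?_⟩)
    · have := h.pow_mem (l + 2) hv
      convert this using 3 <;> push_cast <;> ring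
    · rw [← LinearMap.ker_eq_bot, LinearMap.ker_eq_bot']
      rintro ⟨v, hv⟩ hv'
      have h2 : (N ^ (l + 2)) v = 0 := congrArg Subtype.val hv'
      exact Subtype.ext (h.inj (l + 2) _ _ (by push_cast; linarith) v hv h2)
    · rintro ⟨v, hv⟩
      obtain ⟨w, hw, hwv⟩ := h.surj (l + 2) (p + 1) (q + 1) (by push_cast; linarith) v
        (by convert hv using 3 <;> push_cast <;> ring)
      exact ⟨⟨w, hw⟩, Subtype.ext hwv⟩
  let f : J (p, q) →ₗ[ℂ] J (p - (l + 1), q - (l + 1)) :=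
    (N ^ (l + 1)).restrict fun v hv => by
      have := h.pow_mem (l + 1) hv
      convert this using 3 <;> push_cast <;> ring
  have hf : Function.Surjective f := by
    rintro ⟨v, hv⟩
    obtain ⟨w, hw, hwv⟩ := h.surj (l + 2) (p + 1) (q + 1) (by push_cast; linarith) v
      (by convert hv using 3 <;> push_cast <;> ring)
    refine ⟨⟨N w, by simpa using h.lower _ _ _ hw⟩, Subtype.ext ?_⟩
    change (N ^ (l + 1)) (N w) = v
    rw [← hwv, ← Module.End.mul_apply, ← pow_succ]
  have h2 := LinearMap.finrank_range_add_finrank_ker f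
  rw [LinearMap.range_eq_top.2 hf, finrank_top, ← h1] at h2
  have h3 : Module.finrank ℂ (LinearMap.ker f) = Module.finrank ℂ (prim N J l (p, q)) := by
    have : prim N J l (p, q) = (LinearMap.ker f).map (J (p, q)).subtype := by
      ext v
      constructor
      · rintro ⟨hv, hv'⟩
        exact ⟨⟨v, hv⟩, Subtype.ext hv', rfl⟩
      · rintro ⟨⟨v, hv⟩, hv', rfl⟩
        exact ⟨hv, congrArg Subtype.val hv'⟩
    rw [this]
    exact (Submodule.finrank_map_subtype_eq _ _).symm
  omega

/-- The Hermitian form on the primitive part of weight `n + l`, conjugate linear in the first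
variable. -/
noncomputable def herm (σ : E →ₛₗ[starRingEnd ℂ] E) (B : LinearMap.BilinForm ℂ E)
    (N : Module.End ℂ E) (l : ℕ) (p q : ℤ) (u v : E) : ℂ :=
  Complex.I ^ (p - q) * B v ((N ^ l) (σ u))

/-- The sign (-1)^n from exchanging the arguments of B and the sign (-1)^l from moving N^l across
combine to i^{2(p+q)}, which turns i^{q-p} into i^{p-q} up to i^{4q} = 1. This is why `herm` is
Hermitian. -/
lemma I_zpow_aux {n p q : ℤ} {l : ℕ} (hpq : p + q = n + l) :
    Complex.I ^ (q - p) * ((-1) ^ n * (-1) ^ l) = Complex.I ^ (p - q) := by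
  have h1 : ((-1 : ℂ) ^ n * (-1) ^ l) = Complex.I ^ (2 * (p + q)) := by
    rw [hpq, zpow_mul, show Complex.I ^ (2 : ℤ) = -1 from Complex.I_sq,
      zpow_add₀ (by norm_num), zpow_natCast]
  have h4 : Complex.I ^ (4 * q) = 1 := by
    rw [zpow_mul, show Complex.I ^ (4 : ℤ) = 1 from Complex.I_pow_four, one_zpow]
  rw [h1, ← zpow_add₀ Complex.I_ne_zero,
    show q - p + 2 * (p + q) = (p - q) + 4 * q by ring, zpow_add₀ Complex.I_ne_zero, h4, mul_one]

lemma conj_I_zpow (m : ℤ) : starRingEnd ℂ (Complex.I ^ m) = Complex.I ^ (-m) := by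
  rw [map_zpow₀, Complex.conj_I, ← Complex.inv_I, inv_zpow, zpow_neg]

lemma herm_symm (h : SplitData n σ B N J) {l : ℕ} {p q : ℤ} (hpq : p + q = n + l) (u v : E) :
    starRingEnd ℂ (herm σ B N l p q v u) = herm σ B N l p q u v := by
  rw [herm, map_mul, conj_I_zpow, ← h.form_conj, h.conj_pow, h.conj_conj, h.form_flip,
    h.skew_pow, herm, neg_sub, ← I_zpow_aux hpq]
  ring

lemma herm_conj (h : SplitData n σ B N J) (l : ℕ) (p q : ℤ) (u v : E) :
    herm σ B N l p q (σ u) (σ v) = starRingEnd ℂ (herm σ B N l q p u v) := by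
  rw [herm, herm, map_mul, conj_I_zpow, ← h.form_conj, h.conj_pow, neg_sub]

/-- The primitive part has an orthonormal basis, which is real if `p = q`. -/
lemma exists_basis_prim [FiniteDimensional ℂ E] (h : SplitData n σ B N J) {l : ℕ} {p q : ℤ}
    (hpq : p + q = n + l) :
    ∃ b : Module.Basis (Fin (Module.finrank ℂ (prim N J l (p, q)))) ℂ (prim N J l (p, q)),
      (∀ i j, herm σ B N l p q (b i) (b j) = if i = j then 1 else 0) ∧
      (p = q → ∀ i, σ (b i) = b i) := by
  by_cases hne : p = q
  · subst hne
    -- In type (p,p) conjugation acts on the primitive part. On its real points R the Hermitian form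
    -- is real, so Gram-Schmidt over ℝ produces conjugation-fixed vectors, and a real basis of R is
    -- a complex basis of the whole.
    let R : Submodule ℝ E :=
      { carrier := {v | v ∈ prim N J l (p, p) ∧ σ v = v}
        add_mem' := fun {a b} ha hb => ⟨add_mem ha.1 hb.1, by rw [map_add, ha.2, hb.2]⟩
        zero_mem' := ⟨zero_mem _, map_zero _⟩
        smul_mem' := fun c v hv => by
          have e : c • v = (c : ℂ) • v := (Complex.coe_smul c v).symm
          refine ⟨?_, ?_⟩
          · rw [e]; exact Submodule.smul_mem _ _ hv.1
          · rw [e, map_smulₛₗ, hv.2, Complex.conj_ofReal] }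
    have hreal : ∀ u v : R, ((herm σ B N l p p (u : E) v).re : ℂ) = herm σ B N l p p (u : E) v := by
      intro u v
      rw [← Complex.conj_eq_iff_re, ← h.herm_conj, u.2.2, v.2.2]
    obtain ⟨r, hr⟩ := exists_orthonormal_basis (𝕜 := ℝ) (P := R)
      (fun u v => (herm σ B N l p p (u : E) v).re)
      (fun u v => by
        have := congrArg Complex.re (h.herm_symm hpq (u : E) v)
        simpa using this)
      (fun u v w => by
        simp [herm, mul_add])
      (fun u v c => by
        have e : ((c • u : R) : E) = (c : ℂ) • (u : E) := (Complex.coe_smul c (u : E)).symm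
        simp only [e, herm, map_smulₛₗ, smul_eq_mul, Complex.conj_ofReal,
          RingHom.id_apply, conj_trivial]
        rw [mul_left_comm, Complex.re_ofReal_mul])
      (fun u hu => by
        have hp := h.pos l p p hpq u u.2.1.1 u.2.1.2 (fun h0 => hu (Subtype.ext h0))
        simpa [herm] using hp)
    have hr' : ∀ i j, herm σ B N l p p (r i) (r j) = if i = j then 1 else 0 := by
      intro i j
      rw [← hreal, hr]
      split_ifs <;> simp
    let w : Fin (Module.finrank ℝ R) → prim N J l (p, p) := fun i => ⟨r i, (r i).2.1⟩
    have hli : LinearIndependent ℂ w := by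
      refine linearIndependent_of_dual w
        (fun i => (B.flip ((N ^ l) (σ (r i)))) ∘ₗ (prim N J l (p, p)).subtype) ?_ ?_
      · intro i
        have := hr' i i
        simp only [herm, sub_self, zpow_zero, one_mul, if_true] at this
        simp [w, this]
      · intro i j hij
        have := hr' i j
        simp only [herm, sub_self, zpow_zero, one_mul, if_neg (Ne.symm hij)] at this
        simp [w, this]
    have hRspan : ∀ u ∈ R, u ∈ Submodule.span ℂ (Set.range fun i => (r i : E)) := by
      intro u hu
      have h2 := r.sum_repr ⟨u, hu⟩
      have h3 : u = ∑ i, ((r.repr ⟨u, hu⟩ i : ℝ) : ℂ) • (r i : E) := by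
        have := congrArg (Submodule.subtype R) h2
        rw [map_sum] at this
        refine (show _ = u from this).symm.trans ?_
        exact Finset.sum_congr rfl fun i _ => (Complex.coe_smul _ (r i : E)).symm
      rw [h3]
      exact Submodule.sum_mem _ fun i _ => Submodule.smul_mem _ _ (Submodule.subset_span ⟨i, rfl⟩)
    have hsp : ⊤ ≤ Submodule.span ℂ (Set.range w) := by
      rintro ⟨v, hv⟩ -
      have h1 : (v + σ v) ∈ R := ⟨add_mem hv (h.conj_mem_prim hv), by
        rw [map_add, h.conj_conj, add_comm]⟩
      have h2 : Complex.I • (v - σ v) ∈ R :=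
        ⟨Submodule.smul_mem _ _ (sub_mem hv (h.conj_mem_prim hv)), by
          rw [map_smulₛₗ, map_sub, h.conj_conj, Complex.conj_I, neg_smul, ← smul_neg, neg_sub]⟩
      -- Both v + σv and i(v - σv) are fixed by σ, so v is a complex combination of elements of R.
      have h3 : v = (2⁻¹ : ℂ) • (v + σ v) + (-(2⁻¹ : ℂ) * Complex.I) • (Complex.I • (v - σ v)) := by
        rw [smul_smul, mul_assoc, Complex.I_mul_I]
        module
      have h4 : v ∈ Submodule.span ℂ (Set.range fun i => (r i : E)) := by
        rw [h3]
        exact add_mem (Submodule.smul_mem _ _ (hRspan _ h1))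
          (Submodule.smul_mem _ _ (hRspan _ h2))
      have h5 : (Set.range fun i => (r i : E)) = (prim N J l (p, p)).subtype '' (Set.range w) := by
        rw [← Set.range_comp]; rfl
      rw [h5, ← Submodule.map_span] at h4
      obtain ⟨x, hx, hxv⟩ := h4
      have : x = ⟨v, hv⟩ := Subtype.ext hxv
      rwa [this] at hx
    let b := Module.Basis.mk hli hsp
    have hcard : Module.finrank ℝ R = Module.finrank ℂ (prim N J l (p, p)) := by
      rw [Module.finrank_eq_card_basis b, Fintype.card_fin]
    refine ⟨b.reindex (finCongr hcard), ?_, ?_⟩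
    · intro i j
      simp only [Module.Basis.coe_reindex, Function.comp_apply, b, Module.Basis.coe_mk, w, hr']
      simp
    · intro _ i
      simp only [Module.Basis.coe_reindex, Function.comp_apply, b, Module.Basis.coe_mk, w]
      exact (r _).2.2
  · obtain ⟨b, hb⟩ := exists_orthonormal_basis (𝕜 := ℂ) (P := prim N J l (p, q))
      (fun u v => herm σ B N l p q (u : E) v)
      (fun u v => h.herm_symm hpq _ _)
      (fun u v w => by simp [herm, mul_add])
      (fun u v c => by simp [herm, map_smulₛₗ, mul_left_comm])
      (fun u hu => h.pos l p q hpq u u.2.1 u.2.2 (fun h0 => hu (Subtype.ext h0)))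
    exact ⟨b, hb, fun h => absurd h hne⟩

end SplitData

/-! ### String bases and the classification of split data -/

namespace SplitData

variable {n : ℤ} {E : Type*} [AddCommGroup E] [Module ℂ E]
  {σ : E →ₛₗ[starRingEnd ℂ] E} {B : LinearMap.BilinForm ℂ E} {N : Module.End ℂ E}
  {J : ℤ × ℤ → Submodule ℂ E}

/-- `b p q i`, `i < dim`, is an orthonormal basis of the primitive part of `J (p, q)`, and these
bases are compatible with the real structure. -/
structure IsFrame (n : ℤ) (σ : E →ₛₗ[starRingEnd ℂ] E) (B : LinearMap.BilinForm ℂ E)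
    (N : Module.End ℂ E) (J : ℤ × ℤ → Submodule ℂ E) (l : ℕ) (p q : ℤ) (b : ℕ → E) : Prop where
  mem : ∀ i < Module.finrank ℂ (prim N J l (p, q)), b i ∈ prim N J l (p, q)
  herm_eq : ∀ i < Module.finrank ℂ (prim N J l (p, q)), ∀ j < Module.finrank ℂ (prim N J l (p, q)),
    herm σ B N l p q (b i) (b j) = if i = j then 1 else 0
  le_span : prim N J l (p, q)
    ≤ Submodule.span ℂ (b '' {i | i < Module.finrank ℂ (prim N J l (p, q))})

lemma finrank_prim_symm [FiniteDimensional ℂ E] (h : SplitData n σ B N J) (l : ℕ) (p q : ℤ) :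
    Module.finrank ℂ (prim N J l (p, q)) = Module.finrank ℂ (prim N J l (q, p)) :=
  le_antisymm (finrank_conj_le h.conj_conj fun _ hv => h.conj_mem_prim hv)
    (finrank_conj_le h.conj_conj fun _ hv => h.conj_mem_prim hv)

lemma IsFrame.conj [FiniteDimensional ℂ E] (h : SplitData n σ B N J) {l : ℕ} {p q : ℤ} {b : ℕ → E}
    (hb : IsFrame n σ B N J l p q b) : IsFrame n σ B N J l q p (fun i => σ (b i)) where
  mem i hi := by
    rw [← h.finrank_prim_symm] at hi
    exact h.conj_mem_prim (hb.mem i hi)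
  herm_eq i hi j hj := by
    rw [← h.finrank_prim_symm] at hi hj
    rw [h.herm_conj, hb.herm_eq i hi j hj]
    split_ifs <;> simp
  le_span v hv := by
    rw [← h.finrank_prim_symm]
    have h1 := hb.le_span (h.conj_mem_prim hv)
    rw [← h.conj_conj v]
    refine Submodule.span_induction (p := fun x _ => σ x ∈ _) ?_ ?_ ?_ ?_ h1
    · rintro _ ⟨i, hi, rfl⟩
      exact Submodule.subset_span ⟨i, hi, rfl⟩
    · rw [map_zero]; exact zero_mem _
    · intro x y _ _ hx hy
      rw [map_add]; exact add_mem hx hy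
    · intro a x _ hx
      rw [map_smulₛₗ]; exact Submodule.smul_mem _ _ hx

lemma exists_frame_one [FiniteDimensional ℂ E] (h : SplitData n σ B N J) {l : ℕ} {p q : ℤ}
    (hpq : p + q = n + l) :
    ∃ b : ℕ → E, IsFrame n σ B N J l p q b ∧
      (p = q → ∀ i < Module.finrank ℂ (prim N J l (p, q)), σ (b i) = b i) := by
  obtain ⟨b, hb, hb'⟩ := h.exists_basis_prim hpq
  -- The basis is extended by 0 to all of ℕ. Frames of different types then have the same index type
  -- and can be compared without casts along equalities of dimensions.
  have e : ∀ i (hi : i < Module.finrank ℂ (prim N J l (p, q))),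
      (if hi : i < Module.finrank ℂ (prim N J l (p, q)) then (b ⟨i, hi⟩ : E) else 0)
        = b ⟨i, hi⟩ := fun i hi => dif_pos hi
  refine ⟨fun i => if hi : i < Module.finrank ℂ (prim N J l (p, q)) then b ⟨i, hi⟩ else 0,
    ⟨?_, ?_, ?_⟩, ?_⟩
  · intro i hi
    rw [e i hi]; exact (b ⟨i, hi⟩).2
  · intro i hi j hj
    rw [e i hi, e j hj, hb]
    simp
  · intro v hv
    have h2 := b.sum_repr ⟨v, hv⟩
    have h3 : ∑ i, b.repr ⟨v, hv⟩ i • (b i : E) = v := by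
      have := congrArg (Submodule.subtype _) h2
      rw [map_sum] at this
      exact this
    rw [← h3]
    refine Submodule.sum_mem _ fun i _ => Submodule.smul_mem _ _ (Submodule.subset_span ?_)
    exact ⟨i, i.2, e i i.2⟩
  · intro hpq' i hi
    simp only [e i hi]; exact hb' hpq' _

/-- Frames are free for p > q and conjugated over to p < q. On the diagonal no freedom is left, and
the real orthonormal basis is needed. -/
lemma exists_frame [FiniteDimensional ℂ E] (h : SplitData n σ B N J) :
    ∃ b : ℤ → ℤ → ℕ → E, ∀ (l : ℕ) (p q : ℤ), p + q = n + l →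
      IsFrame n σ B N J l p q (b p q) ∧
      ∀ i < Module.finrank ℂ (prim N J l (p, q)), σ (b p q i) = b q p i := by
  have h0 : ∀ p q : ℤ, ∃ b : ℕ → E, ∀ l : ℕ, p + q = n + l → IsFrame n σ B N J l p q b ∧
      (p = q → ∀ i < Module.finrank ℂ (prim N J l (p, q)), σ (b i) = b i) := by
    intro p q
    by_cases hl : ∃ l : ℕ, p + q = n + l
    · obtain ⟨l, hl⟩ := hl
      obtain ⟨b, hb⟩ := h.exists_frame_one hl
      refine ⟨b, fun l' hl' => ?_⟩
      have : l' = l := by omega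
      rwa [this]
    · exact ⟨0, fun l hl' => absurd ⟨l, hl'⟩ hl⟩
  choose b0 hb0 using h0
  refine ⟨fun p q i => if p < q then σ (b0 q p i) else b0 p q i, fun l p q hpq => ⟨?_, ?_⟩⟩
  · by_cases hlt : p < q
    · simp only [hlt, if_true]
      exact IsFrame.conj h (hb0 q p l (by linarith)).1
    · simp only [hlt, if_false]
      exact (hb0 p q l hpq).1
  · intro i hi
    rcases lt_trichotomy p q with hlt | heq | hgt
    · simp only [hlt, if_true, not_lt.2 hlt.le, if_false, h.conj_conj]
    · subst heq
      simp only [lt_irrefl, if_false]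
      exact (hb0 p p l hpq).2 rfl i hi
    · simp only [hgt, if_true, not_lt.2 hgt.le, if_false]

/-- The index set of the string basis: `(p, q, i, k)` stands for `N ^ k` applied to the `i`-th
primitive vector of type `(p, q)`. -/
def StringIdx (n : ℤ) (d : ℤ → ℤ → ℕ) : Set (ℤ × ℤ × ℕ × ℕ) :=
  {x | n ≤ x.1 + x.2.1 ∧ x.2.2.1 < d x.1 x.2.1 ∧ (x.2.2.2 : ℤ) ≤ x.1 + x.2.1 - n}

variable (N) in
/-- The vectors of the string basis. -/
def stringVec (b : ℤ → ℤ → ℕ → E) (x : ℤ × ℤ × ℕ × ℕ) : E := (N ^ x.2.2.2) (b x.1 x.2.1 x.2.2.1)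

/-- The dimension of the primitive part in terms of the Hodge diamond. -/
noncomputable def primDim (J : ℤ × ℤ → Submodule ℂ E) (p q : ℤ) : ℕ :=
  Module.finrank ℂ (J (p, q)) - Module.finrank ℂ (J (p + 1, q + 1))

/-- In weights at least n the truncated subtraction in `primDim` is an honest one. -/
lemma finrank_prim_eq [FiniteDimensional ℂ E] (h : SplitData n σ B N J) {l : ℕ} {p q : ℤ}
    (hpq : p + q = n + l) : Module.finrank ℂ (prim N J l (p, q)) = primDim J p q := by
  have := h.finrank_prim hpq
  rw [primDim]; omega

/-- A string basis of split data. -/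
structure IsStringBasis (n : ℤ) (σ : E →ₛₗ[starRingEnd ℂ] E) (B : LinearMap.BilinForm ℂ E)
    (N : Module.End ℂ E) (J : ℤ × ℤ → Submodule ℂ E) (d : ℤ → ℤ → ℕ) (b : ℤ → ℤ → ℕ → E) :
    Prop where
  symm : ∀ p q, n ≤ p + q → d p q = d q p
  mem : ∀ p q, n ≤ p + q → ∀ i < d p q, b p q i ∈ J (p, q)
  ker : ∀ (l : ℕ) p q, p + q = n + l → ∀ i < d p q, (N ^ (l + 1)) (b p q i) = 0
  form : ∀ (l : ℕ) p q, p + q = n + l → ∀ i < d p q, ∀ j < d p q,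
    Complex.I ^ (p - q) * B (b p q j) ((N ^ l) (b q p i)) = if i = j then 1 else 0
  conj : ∀ p q, n ≤ p + q → ∀ i < d p q, σ (b p q i) = b q p i
  le_span : ∀ (l : ℕ) p q, p + q = n + l → ∀ v ∈ J (p, q), (N ^ (l + 1)) v = 0 →
    v ∈ Submodule.span ℂ (b p q '' {i | i < d p q})

lemma exists_stringBasis [FiniteDimensional ℂ E] (h : SplitData n σ B N J) :
    ∃ b : ℤ → ℤ → ℕ → E, IsStringBasis n σ B N J (primDim J) b := by
  obtain ⟨b, hb⟩ := h.exists_frame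
  have hl : ∀ {p q : ℤ}, n ≤ p + q → p + q = n + (p + q - n).toNat := fun hpq => by omega
  refine ⟨b, ⟨?_, ?_, ?_, ?_, ?_, ?_⟩⟩
  · intro p q hpq
    rw [primDim, primDim, h.finrank_symm p q, h.finrank_symm (p + 1)]
  · intro p q hpq i hi
    rw [← h.finrank_prim_eq (hl hpq)] at hi
    exact ((hb _ p q (hl hpq)).1.mem i hi).1
  · intro l p q hpq i hi
    rw [← h.finrank_prim_eq hpq] at hi
    exact ((hb _ p q hpq).1.mem i hi).2
  · intro l p q hpq i hi j hj
    rw [← h.finrank_prim_eq hpq] at hi hj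
    rw [← (hb _ p q hpq).2 i hi]
    exact (hb _ p q hpq).1.herm_eq i hi j hj
  · intro p q hpq i hi
    rw [← h.finrank_prim_eq (hl hpq)] at hi
    exact (hb _ p q (hl hpq)).2 i hi
  · intro l p q hpq v hv hv'
    rw [← h.finrank_prim_eq hpq]
    exact (hb _ p q hpq).1.le_span ⟨hv, hv'⟩

variable {d : ℤ → ℤ → ℕ} {b : ℤ → ℤ → ℕ → E}

/-- The span of the string vectors of type `(p, q)`. -/
def stringSpan (n : ℤ) (N : Module.End ℂ E) (d : ℤ → ℤ → ℕ) (b : ℤ → ℤ → ℕ → E) (p q : ℤ) :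
    Submodule ℂ E :=
  Submodule.span ℂ (stringVec N b ''
    {x | x ∈ StringIdx n d ∧ x.1 - x.2.2.2 = p ∧ x.2.1 - x.2.2.2 = q})

lemma IsStringBasis.map_stringVec (hb : IsStringBasis n σ B N J d b) {x : ℤ × ℤ × ℕ × ℕ}
    (hx : x ∈ StringIdx n d) :
    N (stringVec N b x) = if (x.2.2.2 : ℤ) + 1 ≤ x.1 + x.2.1 - n
      then stringVec N b (x.1, x.2.1, x.2.2.1, x.2.2.2 + 1) else 0 := by
  obtain ⟨p, q, i, k⟩ := x
  obtain ⟨h1, h2, h3⟩ := hx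
  simp only at h1 h2 h3 ⊢
  rw [stringVec, ← Module.End.mul_apply, ← pow_succ']
  split_ifs with hk
  · rfl
  · exact hb.ker k p q (by linarith) i h2

lemma IsStringBasis.map_mem_stringSpan (hb : IsStringBasis n σ B N J d b) {p q : ℤ} {v : E}
    (hv : v ∈ stringSpan n N d b p q) : N v ∈ stringSpan n N d b (p - 1) (q - 1) := by
  have : stringSpan n N d b p q ≤ (stringSpan n N d b (p - 1) (q - 1)).comap N := by
    refine Submodule.span_le.2 ?_
    rintro _ ⟨x, ⟨hx, hx1, hx2⟩, rfl⟩
    change N (stringVec N b x) ∈ stringSpan n N d b (p - 1) (q - 1)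
    rw [hb.map_stringVec hx]
    split_ifs with hk
    · refine Submodule.subset_span ⟨(x.1, x.2.1, x.2.2.1, x.2.2.2 + 1),
        ⟨⟨hx.1, hx.2.1, ?_⟩, ?_, ?_⟩, rfl⟩
      · push_cast; linarith
      · push_cast; linarith
      · push_cast; linarith
    · exact zero_mem _
  exact this hv

lemma IsStringBasis.pow_map_mem_stringSpan (hb : IsStringBasis n σ B N J d b) (k : ℕ) {p q : ℤ}
    {v : E} (hv : v ∈ stringSpan n N d b p q) :
    (N ^ k) v ∈ stringSpan n N d b (p - k) (q - k) := by
  induction k with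
  | zero => simpa using hv
  | succ k ih =>
    rw [pow_succ', Module.End.mul_apply]
    have := hb.map_mem_stringSpan ih
    push_cast
    rwa [sub_sub, sub_sub] at this

/-- Descending induction on the weight, down to n. If w in J(p+1,q+1) satisfies N^{l+2} w = N^{l+1}
v, then v - Nw is primitive, and Nw is covered by the previous step. Below weight n every vector is
N^l of one in the mirror weight. -/
lemma IsStringBasis.mem_stringSpan [FiniteDimensional ℂ E] (h : SplitData n σ B N J)
    (hb : IsStringBasis n σ B N J d b) {p q : ℤ} {v : E} (hv : v ∈ J (p, q)) :
    v ∈ stringSpan n N d b p q := by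
  obtain ⟨M, hM⟩ : ∃ M : ℤ, ∀ p q, M ≤ p + q → J (p, q) = ⊥ := by
    obtain ⟨M, hM⟩ := ((finite_ne_bot h.internal).image fun x => x.1 + x.2).bddAbove
    refine ⟨M + 1, fun p q hpq => ?_⟩
    by_contra hne
    have := hM ⟨(p, q), hne, rfl⟩
    simp only at this
    linarith
  have key : ∀ (m : ℕ) (l : ℕ) (p q : ℤ), M ≤ p + q + m → p + q = n + l → ∀ v ∈ J (p, q),
      v ∈ stringSpan n N d b p q := by
    intro m
    induction m with
    | zero =>
      intro l p q hm _ v hv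
      rw [hM p q (by simpa using hm), Submodule.mem_bot] at hv
      rw [hv]; exact zero_mem _
    | succ m ih =>
      intro l p q hm hpq v hv
      obtain ⟨w, hw, hwv⟩ := h.surj (l + 2) (p + 1) (q + 1) (by push_cast; linarith)
        ((N ^ (l + 1)) v) (by
          have := h.pow_mem (l + 1) hv
          convert this using 3 <;> push_cast <;> ring)
      have h1 := hb.map_mem_stringSpan
        (ih (l + 2) (p + 1) (q + 1) (by push_cast at hm ⊢; linarith) (by push_cast; linarith) w hw)
      rw [add_sub_cancel_right, add_sub_cancel_right] at h1
      have h2 : N w ∈ J (p, q) := by simpa using h.lower _ _ _ hw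
      have h3 := hb.le_span l p q hpq (v - N w) (sub_mem hv h2) (by
        rw [map_sub, ← hwv, pow_succ N (l + 1), Module.End.mul_apply, sub_self])
      have h4 : v - N w ∈ stringSpan n N d b p q := by
        refine Submodule.span_mono ?_ h3
        rintro _ ⟨i, hi, rfl⟩
        refine ⟨(p, q, i, 0), ⟨⟨?_, hi, ?_⟩, ?_, ?_⟩, ?_⟩ <;> simp [stringVec] <;> linarith
      have := add_mem h4 h1
      rwa [sub_add_cancel] at this
  rcases le_total n (p + q) with hle | hle
  · exact key (M - (p + q)).toNat (p + q - n).toNat p q (by omega) (by omega) v hv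
  · obtain ⟨l, hl⟩ : ∃ l : ℕ, p + q = n - l := ⟨(n - (p + q)).toNat, by omega⟩
    obtain ⟨w, hw, rfl⟩ := h.surj l (p + l) (q + l) (by linarith) v (by simpa using hv)
    have := hb.pow_map_mem_stringSpan l
      (key (M - (p + l + (q + l))).toNat l (p + l) (q + l) (by omega) (by linarith) w hw)
    simpa using this

/-- The index of the string vector dual to a given one. -/
def dualIdx (n : ℤ) (x : ℤ × ℤ × ℕ × ℕ) : ℤ × ℤ × ℕ × ℕ :=
  (x.2.1, x.1, x.2.2.1, (x.1 + x.2.1 - n - x.2.2.2).toNat)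

lemma IsStringBasis.dualIdx_mem (hb : IsStringBasis n σ B N J d b) {x : ℤ × ℤ × ℕ × ℕ}
    (hx : x ∈ StringIdx n d) : dualIdx n x ∈ StringIdx n d := by
  obtain ⟨p, q, i, k⟩ := x
  obtain ⟨h1, h2, h3⟩ := hx
  simp only at h1 h2 h3
  refine ⟨?_, ?_, ?_⟩
  · simp only [dualIdx]; linarith
  · simp only [dualIdx]; rwa [← hb.symm p q h1]
  · simp only [dualIdx]; omega

/-- The Gram matrix of the string basis. -/
lemma IsStringBasis.gram (h : SplitData n σ B N J) (hb : IsStringBasis n σ B N J d b)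
    {x y : ℤ × ℤ × ℕ × ℕ} (hx : x ∈ StringIdx n d) (hy : y ∈ StringIdx n d) :
    B (stringVec N b x) (stringVec N b y)
      = if y = dualIdx n x then (-1) ^ x.2.2.2 * Complex.I ^ (x.2.1 - x.1) else 0 := by
  obtain ⟨p, q, i, k⟩ := x
  obtain ⟨r, s, j, m⟩ := y
  obtain ⟨hx1, hx2, hx3⟩ := hx
  obtain ⟨hy1, hy2, hy3⟩ := hy
  obtain ⟨l, hl⟩ : ∃ l : ℕ, p + q = n + l := ⟨(p + q - n).toNat, by simp only at hx1; omega⟩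
  obtain ⟨l', hl'⟩ : ∃ l' : ℕ, r + s = n + l' := ⟨(r + s - n).toNat, by simp only at hy1; omega⟩
  simp only [stringVec, dualIdx, Prod.mk.injEq] at *
  have hp := hb.mem p q hx1 i hx2
  have hr := hb.mem r s hy1 j hy2
  -- All powers of N can be collected on either argument, so the pairing vanishes once k + m exceeds
  -- the length of either string.
  have hflip : B ((N ^ k) (b p q i)) ((N ^ m) (b r s j))
      = (-1) ^ k * B (b p q i) ((N ^ (k + m)) (b r s j)) := by
    rw [h.skew_pow, pow_add, Module.End.mul_apply]
  have hflip' : B ((N ^ k) (b p q i)) ((N ^ m) (b r s j))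
      = (-1) ^ m * B ((N ^ (k + m)) (b p q i)) (b r s j) := by
    have e := h.skew_pow m ((N ^ k) (b p q i)) (b r s j)
    rw [← Module.End.mul_apply, ← pow_add] at e
    rw [add_comm k m, e, ← mul_assoc, ← mul_pow]
    simp
  split_ifs with hxy
  · obtain ⟨rfl, rfl, rfl, hm⟩ := hxy
    have hkm : k + m = l := by omega
    rw [hflip, hkm]
    congr 1
    have := hb.form l s r hl j hx2 j hx2
    rw [if_pos rfl] at this
    rw [← neg_sub s r, zpow_neg]
    exact eq_inv_of_mul_eq_one_right this
  · have van : ∀ (l : ℕ) (p q : ℤ), p + q = n + l → ∀ i < d p q, ∀ k, l < k →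
        (N ^ k) (b p q i) = 0 := by
      intro l p q hpq i hi k hk
      obtain ⟨t, rfl⟩ := Nat.exists_eq_add_of_lt hk
      rw [show l + t + 1 = t + (l + 1) by ring, pow_add, Module.End.mul_apply,
        hb.ker l p q hpq i hi, map_zero]
    by_cases h1 : l < k + m
    · rw [hflip', van l p q hl i hx2 _ h1]; simp
    by_cases h2 : l' < k + m
    · rw [hflip, van l' r s hl' j hy2 _ h2]; simp
    have hmem := h.pow_mem (k + m) hr
    rw [hflip]
    by_cases h3 : n < p + (r - (k + m : ℕ))
    · rw [h.orth _ _ _ _ h3 _ hp _ hmem, mul_zero]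
    by_cases h4 : n < q + (s - (k + m : ℕ))
    · rw [h.orth' h4 hp hmem, mul_zero]
    -- Adding the two remaining inequalities gives l + l' ≤ 2(k + m), while k + m ≤ l and k + m ≤
    -- l'. Hence k + m = l = l' and (r,s) = (q,p), and only orthonormality of the frame is left to
    -- use.
    push_cast at h3 h4
    have e1 : r = q := by omega
    have e2 : s = p := by omega
    subst e1 e2
    have hkm : k + m = l := by omega
    have hij : j ≠ i := by
      rintro rfl
      exact hxy ⟨rfl, rfl, rfl, by omega⟩
    have := hb.form l s r hl j (by rw [hb.symm s r hx1]; exact hy2) i hx2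
    rw [if_neg hij] at this
    rw [hkm, (mul_eq_zero.1 this).resolve_left (zpow_ne_zero _ Complex.I_ne_zero), mul_zero]

lemma dualIdx_dualIdx {x : ℤ × ℤ × ℕ × ℕ} (hx : x ∈ StringIdx n d) :
    dualIdx n (dualIdx n x) = x := by
  obtain ⟨p, q, i, k⟩ := x
  obtain ⟨h1, h2, h3⟩ := hx
  simp only [dualIdx, Prod.mk.injEq, true_and] at *
  omega

/-- Independence is read off the Gram matrix, which pairs each string vector with exactly one other
index under the involution `dualIdx`. -/
lemma IsStringBasis.exists_basis [FiniteDimensional ℂ E] (h : SplitData n σ B N J)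
    (hb : IsStringBasis n σ B N J d b) :
    ∃ β : Module.Basis (StringIdx n d) ℂ E, ∀ x, β x = stringVec N b x := by
  have hli : LinearIndependent ℂ (fun x : StringIdx n d => stringVec N b x) := by
    refine linearIndependent_of_dual _
      (fun x => B.flip (stringVec N b (dualIdx n x))) ?_ ?_
    · intro x
      change B (stringVec N b x) (stringVec N b (dualIdx n x)) ≠ 0
      rw [hb.gram h x.2 (hb.dualIdx_mem x.2), if_pos rfl]
      exact mul_ne_zero (pow_ne_zero _ (by norm_num)) (zpow_ne_zero _ Complex.I_ne_zero)
    · intro x y hxy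
      change B (stringVec N b y) (stringVec N b (dualIdx n x)) = 0
      rw [hb.gram h y.2 (hb.dualIdx_mem x.2), if_neg]
      intro he
      apply hxy
      apply Subtype.ext
      rw [← dualIdx_dualIdx x.2, he, dualIdx_dualIdx y.2]
  refine ⟨Module.Basis.mk hli ?_, fun x => Module.Basis.mk_apply hli _ x⟩
  rw [← h.internal.submodule_iSup_eq_top]
  refine iSup_le ?_
  rintro ⟨p, q⟩ v hv
  refine Submodule.span_mono ?_ (hb.mem_stringSpan h hv)
  rintro _ ⟨x, ⟨hx, -⟩, rfl⟩
  exact ⟨⟨x, hx⟩, rfl⟩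

/-- The pairing of `J (p, q)` and `J (r, s)` vanishes unless `(r, s) = (n - p, n - q)`. -/
lemma orth_of_ne [FiniteDimensional ℂ E] (h : SplitData n σ B N J) {p q r s : ℤ}
    (hne : ¬ (r = n - p ∧ s = n - q)) {u v : E} (hu : u ∈ J (p, q)) (hv : v ∈ J (r, s)) :
    B u v = 0 := by
  obtain ⟨b, hb⟩ := h.exists_stringBasis
  have hu' := hb.mem_stringSpan h hu
  have hv' := hb.mem_stringSpan h hv
  refine Submodule.span_induction₂ (p := fun u v _ _ => B u v = 0) ?_ ?_ ?_ ?_ ?_ ?_ ?_ hu' hv'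
  · rintro _ _ ⟨x, ⟨hx, hx1, hx2⟩, rfl⟩ ⟨y, ⟨hy, hy1, hy2⟩, rfl⟩
    rw [hb.gram h hx hy, if_neg]
    -- The dual of a string vector of type (p,q) has type (n-p,n-q).
    rintro rfl
    apply hne
    obtain ⟨p', q', i, k⟩ := x
    obtain ⟨h1, h2, h3⟩ := hx
    simp only [dualIdx] at *
    omega
  · simp
  · simp
  · intro x y z _ _ _ h1 h2; rw [map_add, LinearMap.add_apply, h1, h2, add_zero]
  · intro x y z _ _ _ h1 h2; rw [map_add, h1, h2, add_zero]
  · intro r x y _ _ h1; rw [map_smul, LinearMap.smul_apply, h1, smul_zero]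
  · intro r x y _ _ h1; rw [map_smul, h1, smul_zero]

/-- Split data with the same Hodge diamond are isomorphic. -/
theorem exists_iso [FiniteDimensional ℂ E] (h : SplitData n σ B N J)
    {E' : Type*} [AddCommGroup E'] [Module ℂ E'] [FiniteDimensional ℂ E']
    {σ' : E' →ₛₗ[starRingEnd ℂ] E'} {B' : LinearMap.BilinForm ℂ E'} {N' : Module.End ℂ E'}
    {J' : ℤ × ℤ → Submodule ℂ E'} (h' : SplitData n σ' B' N' J')
    (hdim : ∀ x, Module.finrank ℂ (J x) = Module.finrank ℂ (J' x)) :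
    ∃ T : E ≃ₗ[ℂ] E', (∀ v, T (σ v) = σ' (T v)) ∧ (∀ v, T (N v) = N' (T v)) ∧
      (∀ u v, B' (T u) (T v) = B u v) ∧ ∀ x, (J x).map (T : E →ₗ[ℂ] E') = J' x := by
  obtain ⟨b, hb⟩ := h.exists_stringBasis
  obtain ⟨b', hb'⟩ := h'.exists_stringBasis
  have hd : primDim J' = primDim J := by
    funext p q
    rw [primDim, primDim, hdim, hdim]
  rw [hd] at hb'
  obtain ⟨β, hβ⟩ := hb.exists_basis h
  obtain ⟨β', hβ'⟩ := hb'.exists_basis h'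
  let T := β.equiv β' (Equiv.refl _)
  have hT : ∀ x ∈ StringIdx n (primDim J), T (stringVec N b x) = stringVec N' b' x := by
    intro x hx
    have := β.equiv_apply (b' := β') ⟨x, hx⟩ (Equiv.refl _)
    rwa [hβ, Equiv.refl_apply, hβ'] at this
  have hle : ∀ x, (J x).map (T : E →ₗ[ℂ] E') ≤ J' x := by
    rintro ⟨p, q⟩
    rintro _ ⟨v, hv, rfl⟩
    have hv' := hb.mem_stringSpan h hv
    refine Submodule.span_induction (p := fun v _ => (T : E →ₗ[ℂ] E') v ∈ J' (p, q))
      ?_ ?_ ?_ ?_ hv'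
    · rintro _ ⟨x, ⟨hx, hx1, hx2⟩, rfl⟩
      rw [LinearEquiv.coe_coe, hT x hx, ← hx1, ← hx2]
      exact h'.pow_mem _ (hb'.mem _ _ hx.1 _ hx.2.1)
    · simp
    · intro x y _ _ hx hy; rw [map_add]; exact add_mem hx hy
    · intro a x _ hx; rw [map_smul]; exact Submodule.smul_mem _ _ hx
  refine ⟨T, ?_, ?_, ?_, fun x => ?_⟩
  · have : (T : E →ₗ[ℂ] E').comp σ = σ'.comp (T : E →ₗ[ℂ] E') := by
      refine β.ext fun x => ?_
      have hx := x.2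
      have hx' : (x.1.2.1, x.1.1, x.1.2.2.1, x.1.2.2.2) ∈ StringIdx n (primDim J) := by
        refine ⟨?_, ?_, ?_⟩
        · simp only; linarith [hx.1]
        · simp only; rw [← hb.symm _ _ hx.1]; exact hx.2.1
        · simp only; linarith [hx.2.2]
      rw [hβ, LinearMap.comp_apply, LinearMap.comp_apply, LinearEquiv.coe_coe, hT _ hx,
        stringVec, stringVec, h.conj_pow, h'.conj_pow, hb.conj _ _ hx.1 _ hx.2.1,
        hb'.conj _ _ hx.1 _ hx.2.1]
      exact hT _ hx'
    exact fun v => LinearMap.congr_fun this v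
  · have : (T : E →ₗ[ℂ] E') ∘ₗ N = N' ∘ₗ (T : E →ₗ[ℂ] E') := by
      refine β.ext fun x => ?_
      have hx := x.2
      rw [hβ, LinearMap.comp_apply, LinearMap.comp_apply, LinearEquiv.coe_coe, hT _ hx,
        hb.map_stringVec hx, hb'.map_stringVec hx]
      split_ifs with hk
      · refine hT _ ⟨hx.1, hx.2.1, ?_⟩
        push_cast
        exact hk
      · exact map_zero _
    exact fun v => LinearMap.congr_fun this v
  · have : B'.compl₁₂ (T : E →ₗ[ℂ] E') (T : E →ₗ[ℂ] E') = B := by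
      refine LinearMap.BilinForm.ext_basis β fun x y => ?_
      rw [LinearMap.compl₁₂_apply, hβ, hβ, LinearEquiv.coe_coe, hT _ x.2, hT _ y.2,
        hb.gram h x.2 y.2, hb'.gram h' x.2 y.2]
    exact fun u v => LinearMap.congr_fun₂ this u v
  · refine Submodule.eq_of_le_of_finrank_eq (hle x) ?_
    rw [LinearEquiv.finrank_map_eq, hdim]

end SplitData


/-! ### From ℝ-split polarized mixed Hodge structures to split data -/

section Splitting

variable {V : Type*} [AddCommGroup V] [Module ℝ V]

/-- `J` is a bigrading which splits the mixed Hodge structure `(F, W)` over `ℝ`. -/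
structure IsSplitting (W : ℤ → Submodule ℝ V) (F : CFil V) (J : ℤ × ℤ → Submodule ℂ (Cx V)) :
    Prop where
  internal : DirectSum.IsInternal J
  hodge : ∀ p, F p = ⨆ x : ℤ × ℤ, ⨆ _ : p ≤ x.1, J x
  weight : ∀ l, WC W l = ⨆ x : ℤ × ℤ, ⨆ _ : x.1 + x.2 ≤ l, J x
  conjSub_eq : ∀ p q, conjSub (J (p, q)) = J (q, p)

variable {W : ℤ → Submodule ℝ V} {F : CFil V} {J : ℤ × ℤ → Submodule ℂ (Cx V)}

namespace IsSplitting

lemma conj_mem (h : IsSplitting W F J) {x : ℤ × ℤ} {v : Cx V} (hv : v ∈ J x) :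
    conj V v ∈ J x.swap := by
  rw [Prod.swap, ← h.conjSub_eq, mem_conjSub, conj_conj]
  exact hv

lemma proj_conj (h : IsSplitting W F J) (x : ℤ × ℤ) (v : Cx V) :
    proj h.internal x.swap (conj V v) = conj V (proj h.internal x v) :=
  proj_map h.internal h.internal (conj V) Prod.swap_injective (fun _ _ hv => h.conj_mem hv) x v

lemma mem_hodge (h : IsSplitting W F J) {p : ℤ} {v : Cx V} :
    v ∈ F p ↔ ∀ x : ℤ × ℤ, x.1 < p → proj h.internal x v = 0 := by
  rw [h.hodge, mem_iSup_iff_proj h.internal]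
  simp only [not_le]

lemma mem_weight (h : IsSplitting W F J) {l : ℤ} {v : Cx V} :
    v ∈ WC W l ↔ ∀ x : ℤ × ℤ, l < x.1 + x.2 → proj h.internal x v = 0 := by
  rw [h.weight, mem_iSup_iff_proj h.internal]
  simp only [not_le]

lemma mem_conj_hodge (h : IsSplitting W F J) {q : ℤ} {v : Cx V} :
    v ∈ conjSub (F q) ↔ ∀ x : ℤ × ℤ, x.2 < q → proj h.internal x v = 0 := by
  rw [mem_conjSub, h.mem_hodge]
  constructor
  · intro hv x hx
    have h1 := hv x.swap hx
    rw [h.proj_conj] at h1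
    rw [← conj_conj (proj h.internal x v), h1, map_zero]
  · intro hv x hx
    have h1 := h.proj_conj x.swap v
    rw [Prod.swap_swap, hv x.swap hx, map_zero] at h1
    exact h1

/-- The inequalities r ≥ p, s ≥ q and r + s ≤ p + q leave only (r,s) = (p,q). Thus a splitting is
determined by F and W. -/
lemma mem_iff (h : IsSplitting W F J) {p q : ℤ} {v : Cx V} :
    v ∈ J (p, q) ↔ v ∈ F p ∧ v ∈ conjSub (F q) ∧ v ∈ WC W (p + q) := by
  rw [mem_iff_proj h.internal, h.mem_hodge, h.mem_conj_hodge, h.mem_weight]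
  constructor
  · intro hv
    refine ⟨fun x hx => hv x ?_, fun x hx => hv x ?_, fun x hx => hv x ?_⟩ <;>
    · rintro rfl
      simp only at hx
      omega
  · rintro ⟨h1, h2, h3⟩ ⟨r, s⟩ hx
    by_cases hr : r < p
    · exact h1 _ hr
    by_cases hs : s < q
    · exact h2 _ hs
    refine h3 _ ?_
    have : ¬ (r = p ∧ s = q) := by rintro ⟨rfl, rfl⟩; exact hx rfl
    simp only
    omega

/-- The Deligne bigrading of a split mixed Hodge structure is its splitting. -/
lemma deligne_eq (h : IsSplitting W F J) (p q : ℤ) : deligne W F p q = J (p, q) := by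
  apply le_antisymm
  · rintro v ⟨⟨h1, h2⟩, h3⟩
    -- In the correction terms s ≥ q - j and r + s ≤ p + q - j - 1 force r < p. Intersecting with
    -- F^p removes these summands.
    have hle : (conjSub (F q) ⊓ WC W (p + q) ⊔
        ⨆ j : ℕ, ⨆ _ : 1 ≤ j, conjSub (F (q - j)) ⊓ WC W (p + q - j - 1))
        ≤ ⨆ x : ℤ × ℤ, ⨆ _ : x.1 < p ∨ x = (p, q), J x := by
      refine sup_le ?_ (iSup₂_le fun j hj => ?_)
      · rintro w ⟨hw1, hw2⟩
        rw [mem_iSup_iff_proj h.internal]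
        rintro ⟨r, s⟩ hx
        rw [not_or, not_lt] at hx
        by_cases hs : s < q
        · exact h.mem_conj_hodge.1 hw1 _ hs
        · refine h.mem_weight.1 hw2 _ ?_
          have : ¬ (r = p ∧ s = q) := by rintro ⟨rfl, rfl⟩; exact hx.2 rfl
          simp only at hx ⊢
          omega
      · rintro w ⟨hw1, hw2⟩
        rw [mem_iSup_iff_proj h.internal]
        rintro ⟨r, s⟩ hx
        rw [not_or, not_lt] at hx
        by_cases hs : s < q - j
        · exact h.mem_conj_hodge.1 hw1 _ hs
        · refine h.mem_weight.1 hw2 _ ?_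
          simp only at hx ⊢
          omega
    have h4 := (mem_iSup_iff_proj h.internal _ _).1 (hle h3)
    rw [mem_iff_proj h.internal]
    intro x hx
    by_cases hr : x.1 < p
    · exact h.mem_hodge.1 h1 x hr
    · exact h4 x (by rintro (h5 | h5); exacts [hr h5, hx h5])
  · intro v hv
    obtain ⟨h1, h2, h3⟩ := h.mem_iff.1 hv
    exact ⟨⟨h1, h3⟩, Submodule.mem_sup_left ⟨h2, h3⟩⟩

end IsSplitting

namespace IsWeightFil

variable {n : ℤ} {N : Module.End ℝ V}

lemma baseChange_pow_apply (N : Module.End ℝ V) (l : ℕ) (v : Cx V) :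
    (N.baseChange ℂ ^ l) v = (N ^ l).baseChange ℂ v := by
  rw [LinearMap.baseChange_pow]

lemma map_mem_WC (h : IsWeightFil n N W) {l : ℤ} {v : Cx V} (hv : v ∈ WC W l) :
    N.baseChange ℂ v ∈ WC W (l - 2) := by
  rw [mem_WC] at hv ⊢
  rw [reV_baseChange, imV_baseChange]
  exact ⟨h.map_le l ⟨_, hv.1, rfl⟩, h.map_le l ⟨_, hv.2, rfl⟩⟩

lemma inj_WC (h : IsWeightFil n N W) (l : ℕ) {v : Cx V} (hv : v ∈ WC W (n + l))
    (hv' : (N.baseChange ℂ ^ l) v ∈ WC W (n - l - 1)) : v ∈ WC W (n + l - 1) := by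
  rw [baseChange_pow_apply] at hv'
  rw [mem_WC] at *
  rw [reV_baseChange, imV_baseChange] at hv'
  exact ⟨h.inj l _ hv.1 hv'.1, h.inj l _ hv.2 hv'.2⟩

lemma surj_WC (h : IsWeightFil n N W) (l : ℕ) {v : Cx V} (hv : v ∈ WC W (n - l)) :
    ∃ w ∈ WC W (n + l), ∃ r ∈ WC W (n - l - 1), v = (N.baseChange ℂ ^ l) w + r := by
  rw [mem_WC] at hv
  obtain ⟨_, ⟨a, ha, rfl⟩, b, hb, hab⟩ := Submodule.mem_sup.1 (h.surj l hv.1)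
  obtain ⟨_, ⟨a', ha', rfl⟩, b', hb', hab'⟩ := Submodule.mem_sup.1 (h.surj l hv.2)
  refine ⟨(1 : ℂ) ⊗ₜ[ℝ] a + Complex.I • ((1 : ℂ) ⊗ₜ[ℝ] a'), ?_,
    (1 : ℂ) ⊗ₜ[ℝ] b + Complex.I • ((1 : ℂ) ⊗ₜ[ℝ] b'), ?_, ?_⟩
  · rw [mem_WC]
    simpa [TensorProduct.smul_tmul'] using ⟨ha, ha'⟩
  · rw [mem_WC]
    simpa [TensorProduct.smul_tmul'] using ⟨hb, hb'⟩
  · rw [baseChange_pow_apply, re_add_im v, ← hab, ← hab']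
    simp only [map_add, map_smul, LinearMap.baseChange_tmul, TensorProduct.tmul_add, smul_add]
    abel

end IsWeightFil

namespace RSplitPMHS

variable {n : ℤ} {Q : LinearMap.BilinForm ℝ V} {h : ℤ → ℕ} {D : Set (CFil V)}

lemma exists_splitting (x : RSplitPMHS n Q h D) :
    ∃ J : ℤ × ℤ → Submodule ℂ (Cx V), IsSplitting x.W x.F J := by
  obtain ⟨J, h1, h2, h3, h4⟩ := x.split
  exact ⟨J, h1, h2, h3, h4⟩

lemma diamond_eq (x : RSplitPMHS n Q h D) {J : ℤ × ℤ → Submodule ℂ (Cx V)}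
    (hJ : IsSplitting x.W x.F J) (a : ℤ × ℤ) : x.diamond a = Module.finrank ℂ (J a) := by
  rw [diamond, hJ.deligne_eq]

/-- Since N is real, horizontality holds for the conjugate filtration too; N also drops the weight
by 2. The three conditions of `mem_iff` follow. -/
lemma lower (x : RSplitPMHS n Q h D) {J : ℤ × ℤ → Submodule ℂ (Cx V)}
    (hJ : IsSplitting x.W x.F J) (p q : ℤ) (v : Cx V) (hv : v ∈ J (p, q)) :
    x.N.baseChange ℂ v ∈ J (p - 1, q - 1) := by
  obtain ⟨h1, h2, h3⟩ := hJ.mem_iff.1 hv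
  rw [hJ.mem_iff]
  refine ⟨x.horizontal p ⟨v, h1, rfl⟩, ?_, ?_⟩
  · rw [mem_conjSub] at h2 ⊢
    rw [conj_baseChange]
    exact x.horizontal q ⟨_, h2, rfl⟩
  · have := x.weight.map_mem_WC h3
    rwa [show p - 1 + (q - 1) = p + q - 2 by ring]

/-- The splitting of an `ℝ`-split polarized mixed Hodge structure. -/
theorem splitData (x : RSplitPMHS n Q h D) (hsymm : ∀ u v, Q u v = (-1 : ℝ) ^ n * Q v u)
    {J : ℤ × ℤ → Submodule ℂ (Cx V)} (hJ : IsSplitting x.W x.F J) :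
    SplitData n (conj V) (QC Q) (x.N.baseChange ℂ) J := by
  have hpow : ∀ (k : ℕ) (y : ℤ × ℤ), ∀ v ∈ J y,
      (x.N.baseChange ℂ ^ k) v ∈ J (y.1 - k, y.2 - k) := by
    intro k y v hv
    induction k with
    | zero => simpa using hv
    | succ k ih =>
      rw [pow_succ', Module.End.mul_apply]
      have := x.lower hJ _ _ _ ih
      push_cast
      rwa [sub_sub, sub_sub] at this
  -- J(p,q) embeds in the graded quotient of weight p + q, so the conditions on quotients transfer
  -- to the bigrading.
  have hprojW : ∀ {p q : ℤ} {v : Cx V}, v ∈ J (p, q) → v ∈ WC x.W (p + q - 1) → v = 0 := by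
    intro p q v hv hv'
    rw [← proj_of_mem hJ.internal hv]
    exact hJ.mem_weight.1 hv' _ (by simp)
  refine ⟨hJ.internal, fun p q v hv => hJ.conj_mem hv, x.lower hJ, ?_, ?_, conj_conj,
    fun v => conj_baseChange x.N v, QC_conj Q, QC_flip hsymm, QC_skew x.skew, ?_, ?_⟩
  · intro l p q hpq v hv hv'
    refine hprojW hv ?_
    rw [hpq]
    refine x.weight.inj_WC l ?_ (by rw [hv']; exact zero_mem _)
    rw [← hpq]
    exact (hJ.mem_iff.1 hv).2.2
  · intro l p q hpq v hv
    have hw : v ∈ WC x.W (n - l) := by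
      have := (hJ.mem_iff.1 hv).2.2
      rwa [show p - l + (q - l) = n - l by linarith] at this
    obtain ⟨w, hw, r, hr, hv'⟩ := x.weight.surj_WC l hw
    -- The preimage from the weight filtration is correct only modulo lower weight. Its
    -- (p,q)-component is exact, because the error has no component in bidegree (p-l,q-l).
    refine ⟨proj hJ.internal (p, q) w, proj_mem _ _ _, ?_⟩
    have h1 := proj_map hJ.internal hJ.internal (x.N.baseChange ℂ ^ l)
      (g := fun y => (y.1 - (l : ℤ), y.2 - (l : ℤ)))
      (fun a b hab => by
        simp only [Prod.mk.injEq, sub_left_inj] at hab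
        exact Prod.ext hab.1 hab.2) (hpow l) (p, q) w
    rw [← h1, ← proj_of_mem hJ.internal hv]
    conv_rhs => rw [hv', map_add]
    rw [hJ.mem_weight.1 hr (p - l, q - l) (by simp only; linarith), add_zero]
  · intro p q r s hpr u hu v hv
    refine x.compactDual.isotropic p u (hJ.mem_iff.1 hu).1 v ?_
    exact x.compactDual.anti (by linarith : n + 1 - p ≤ r) (hJ.mem_iff.1 hv).1
  · intro l p q hpq v hv hv' hne
    obtain ⟨h1, h2, h3⟩ := hJ.mem_iff.1 hv
    rw [hpq] at h3
    refine x.polarized.pos l p q hpq v ⟨h3, by rw [hv']; exact zero_mem _⟩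
      ⟨v, ⟨h1, h3⟩, rfl⟩ ⟨v, ⟨h2, h3⟩, rfl⟩ ?_
    intro h0
    rw [Submodule.mkQ_apply, Submodule.Quotient.mk_eq_zero] at h0
    exact hne (hprojW hv (by rwa [hpq]))

end RSplitPMHS

end Splitting


/-! ### Uniqueness of limits in the Grassmannian -/

section Uniqueness

variable {V : Type*} [AddCommGroup V] [Module ℝ V]

lemma exists_dual_family {K E : Type*} [Field K] [AddCommGroup E] [Module K E] {d : ℕ}
    {e : Fin d → E} (he : LinearIndependent K e) :
    ∃ l : Fin d → Module.Dual K E, ∀ i k, l i (e k) = if i = k then 1 else 0 := by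
  have h1 : ∀ i, ∃ l : Module.Dual K E, ∀ k, l (e k) = if i = k then 1 else 0 := by
    intro i
    obtain ⟨l, hl⟩ := LinearMap.exists_extend ((Module.Basis.span he).coord i)
    refine ⟨l, fun k => ?_⟩
    have h2 := LinearMap.congr_fun hl (Module.Basis.span he k)
    rw [Module.Basis.coord_apply, Module.Basis.repr_self, Finsupp.single_apply,
      LinearMap.comp_apply, Submodule.subtype_apply, Module.Basis.span_apply] at h2
    rw [h2]
    simp [eq_comm]
  choose l hl using h1
  exact ⟨l, hl⟩

/-- If a vector e' of L' lay outside L, some functional φ would vanish on L but not at e'. The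
approximating vectors b' are combinations of the frames b converging to a basis of L. Cramer's rule
expresses det(A) φ(b') through the values φ(b), where A → 1, and passing to the limit gives φ(e') =
0. The adjugate avoids inverting A. -/
lemma TendstoSub.le {U : ℝ → Submodule ℂ (Cx V)} {L L' : Submodule ℂ (Cx V)}
    (h : TendstoSub U L) (h' : TendstoSub U L') : L' ≤ L := by
  obtain ⟨d, b, e, he, hL, hb, hlim⟩ := h
  obtain ⟨d', b', e', -, hL', hb', hlim'⟩ := h'
  rw [← hL', Submodule.span_le]
  rintro _ ⟨j, rfl⟩
  by_contra hj
  obtain ⟨φ, hφ, hφL⟩ := Submodule.exists_le_ker_of_notMem hj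
  obtain ⟨l, hl⟩ := exists_dual_family he
  let A : ℝ → Matrix (Fin d) (Fin d) ℂ := fun y => Matrix.of fun i k => l i (b y k)
  let m : ℝ → Fin d → ℂ := fun y i => l i (b' y j)
  have hA : Filter.Tendsto A Filter.atTop (nhds 1) := by
    refine tendsto_pi_nhds.2 fun i => tendsto_pi_nhds.2 fun k => ?_
    have := hlim k (l i)
    rw [hl] at this
    rwa [Matrix.one_apply]
  have key : ∀ᶠ y in Filter.atTop,
      (A y).det * φ (b' y j) = ((A y).adjugate.mulVec (m y)) ⬝ᵥ (fun k => φ (b y k)) := by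
    filter_upwards [hb, hb'] with y hy hy'
    have h1 : b' y j ∈ Submodule.span ℂ (Set.range (b y)) := by
      rw [hy, ← hy']; exact Submodule.subset_span ⟨j, rfl⟩
    obtain ⟨c, hc⟩ := (Submodule.mem_span_range_iff_exists_fun ℂ).1 h1
    have h2 : m y = (A y).mulVec c := by
      funext i
      simp only [m, A, ← hc, map_sum, map_smul, smul_eq_mul, Matrix.mulVec, dotProduct,
        Matrix.of_apply]
      exact Finset.sum_congr rfl fun k _ => mul_comm _ _
    rw [h2, Matrix.mulVec_mulVec, Matrix.adjugate_mul, Matrix.smul_mulVec, Matrix.one_mulVec,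
      smul_dotProduct, smul_eq_mul, ← hc, map_sum]
    congr 1
    simp only [dotProduct, map_smul, smul_eq_mul]
  have hl1 : Filter.Tendsto (fun y => (A y).det * φ (b' y j)) Filter.atTop
      (nhds ((1 : Matrix (Fin d) (Fin d) ℂ).det * φ (e' j))) := by
    have hdet : Continuous fun M : Matrix (Fin d) (Fin d) ℂ => M.det := Continuous.matrix_det continuous_id
    exact ((hdet.tendsto 1).comp hA).mul (hlim' j φ)
  have hl2 : Filter.Tendsto
      (fun y => ((A y).adjugate.mulVec (m y)) ⬝ᵥ (fun k => φ (b y k))) Filter.atTop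
      (nhds (((1 : Matrix (Fin d) (Fin d) ℂ).adjugate.mulVec (fun i => l i (e' j)))
        ⬝ᵥ (fun k => φ (e k)))) := by
    have hadj : Filter.Tendsto (fun y => (A y).adjugate) Filter.atTop
        (nhds (1 : Matrix (Fin d) (Fin d) ℂ).adjugate) :=
      ((Continuous.matrix_adjugate continuous_id).tendsto 1).comp hA
    have hadj' : ∀ i k, Filter.Tendsto (fun y => (A y).adjugate i k) Filter.atTop
        (nhds ((1 : Matrix (Fin d) (Fin d) ℂ).adjugate i k)) :=
      fun i k => tendsto_pi_nhds.1 (tendsto_pi_nhds.1 hadj i) k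
    simp only [dotProduct, Matrix.mulVec]
    exact tendsto_finsetSum _ fun i _ =>
      (tendsto_finsetSum _ fun k _ => (hadj' i k).mul (hlim' j (l k))).mul (hlim i φ)
  have h3 := tendsto_nhds_unique (hl1.congr' key) hl2
  have h4 : (fun k => φ (e k)) = 0 := by
    funext k
    exact hφL (by rw [← hL]; exact Submodule.subset_span ⟨k, rfl⟩)
  rw [h4, dotProduct_zero, Matrix.det_one, one_mul] at h3
  exact hφ h3

lemma IsNaiveLimit.unique {F L L' : CFil V} {N : Module.End ℝ V} (h : IsNaiveLimit F N L)
    (h' : IsNaiveLimit F N L') : L = L' :=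
  funext fun p => le_antisymm ((h' p).le (h p)) ((h p).le (h' p))

end Uniqueness

/-! ### Coordinate subspaces of a graded space and homogeneous bases -/

section GradedBasis

lemma iSup_coord_sup {K ι E : Type*} [Field K] [AddCommGroup E] [Module K E]
    {J : ι → Submodule K E} (P R : ι → Prop) :
    (⨆ x, ⨆ _ : P x, J x) ⊔ (⨆ x, ⨆ _ : R x, J x) = ⨆ x, ⨆ _ : P x ∨ R x, J x := by
  simp only [iSup_or, iSup_sup_eq]

variable {K ι E : Type*} [Field K] [AddCommGroup E] [Module K E] [DecidableEq ι]
  {J : ι → Submodule K E}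

lemma iSup_coord_inf (h : DirectSum.IsInternal J) (P R : ι → Prop) :
    (⨆ x, ⨆ _ : P x, J x) ⊓ (⨆ x, ⨆ _ : R x, J x) = ⨆ x, ⨆ _ : P x ∧ R x, J x := by
  ext v
  rw [Submodule.mem_inf, mem_iSup_iff_proj h, mem_iSup_iff_proj h, mem_iSup_iff_proj h]
  constructor
  · rintro ⟨h1, h2⟩ x hx
    by_cases hP : P x
    · exact h2 x fun hR => hx ⟨hP, hR⟩
    · exact h1 x hP
  · intro hv
    exact ⟨fun x hx => hv x fun hh => hx hh.1, fun x hx => hv x fun hh => hx hh.2⟩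

lemma map_scaleBy_coord (h : DirectSum.IsInternal J) {c : ι → K} (hc : ∀ x, c x ≠ 0)
    (P : ι → Prop) : (⨆ x, ⨆ _ : P x, J x).map (scaleBy h c) = ⨆ x, ⨆ _ : P x, J x := by
  apply le_antisymm
  · rintro _ ⟨v, hv, rfl⟩
    rw [SetLike.mem_coe, mem_iSup_iff_proj h] at hv
    rw [mem_iSup_iff_proj h]
    intro x hx
    rw [proj_scaleBy, hv x hx, smul_zero]
  · intro v hv
    refine ⟨scaleBy h c⁻¹ v, ?_, ?_⟩
    · rw [mem_iSup_iff_proj h] at hv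
      rw [SetLike.mem_coe, mem_iSup_iff_proj h]
      intro x hx
      rw [proj_scaleBy, hv x hx, smul_zero]
    · rw [scaleBy_mul, show c * c⁻¹ = 1 from funext fun x => mul_inv_cancel₀ (hc x), scaleBy_one]

/-- A sum of summands has a homogeneous basis. -/
lemma exists_adapted_basis [FiniteDimensional K E] (h : DirectSum.IsInternal J) (P : ι → Prop) :
    ∃ (d : ℕ) (e : Fin d → E) (g : Fin d → ι), LinearIndependent K e ∧
      Submodule.span K (Set.range e) = (⨆ x, ⨆ _ : P x, J x) ∧ ∀ k, e k ∈ J (g k) ∧ P (g k) := by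
  let β := h.collectedBasis fun x => Module.finBasis K (J x)
  have hβ : ∀ s, β s = (Module.finBasis K (J s.1) s.2 : E) := fun s => by
    simp only [β, DirectSum.IsInternal.collectedBasis_coe]
  have hfin : Finite (Σ x, Fin (Module.finrank K (J x))) := Module.Finite.finite_basis β
  let T : Type _ := {s : Σ x, Fin (Module.finrank K (J x)) // P s.1}
  have hT : Finite T := inferInstanceAs (Finite {s : Σ x, Fin (Module.finrank K (J x)) // P s.1})
  let ε := (Finite.equivFin T).symm
  refine ⟨Nat.card T, fun k => β (ε k).1, fun k => (ε k).1.1, ?_, ?_, fun k => ⟨?_, (ε k).2⟩⟩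
  · exact β.linearIndependent.comp _ (Subtype.val_injective.comp ε.injective)
  · apply le_antisymm
    · rw [Submodule.span_le]
      rintro _ ⟨k, rfl⟩
      simp only [hβ]
      exact (le_iSup₂_of_le (f := fun x (_ : P x) => J x) (ε k).1.1 (ε k).2 le_rfl)
        (Submodule.coe_mem _)
    · refine iSup₂_le fun x hx v hv => ?_
      have h1 := (Module.finBasis K (J x)).sum_repr ⟨v, hv⟩
      have h2 : ∑ i, (Module.finBasis K (J x)).repr ⟨v, hv⟩ i • (Module.finBasis K (J x) i : E)
          = v := by
        have := congrArg (Submodule.subtype _) h1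
        rw [map_sum] at this
        exact this
      rw [← h2]
      refine Submodule.sum_mem _ fun i _ => Submodule.smul_mem _ _ (Submodule.subset_span ?_)
      exact ⟨ε.symm ⟨⟨x, i⟩, hx⟩, by simp [hβ]⟩
  · simp only [hβ]
    exact Submodule.coe_mem _

end GradedBasis

/-! ### The naive limit -/

section Limit

variable {E : Type*} [AddCommGroup E] [Module ℂ E]

/-- The exponential as an automorphism. -/
noncomputable def nexpEquiv {A : Module.End ℂ E} (hA : IsNilpotent A) (z : ℂ) : E ≃ₗ[ℂ] E :=
  LinearEquiv.ofLinearMap (nexp (z • A)) (nexp ((-z) • A))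
    (LinearMap.ext fun v => nexp_smul_neg_apply hA z v)
    (LinearMap.ext fun v => nexp_neg_smul_apply hA z v)

/-- Scaling a bigraded space intertwines the exponentials of a lowering operator. -/
lemma scaleBy_nexp {J : ℤ × ℤ → Submodule ℂ E} (h : DirectSum.IsInternal J) {A : Module.End ℂ E}
    (hA : IsNilpotent A) (lower : ∀ x, ∀ v ∈ J x, A v ∈ J (x.1 - 1, x.2 - 1))
    {c : ℤ × ℤ → ℂ} {t : ℂ} (hc : ∀ x, c (x.1 - 1, x.2 - 1) = t * c x) (z : ℂ) (v : E) :
    scaleBy h c (nexp (z • A) v) = nexp ((t * z) • A) (scaleBy h c v) := by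
  refine nexp_intertwine (hA.smul z) (hA.smul (t * z)) (scaleBy h c) (fun v => ?_) v
  refine IsInternal.induction h
    (motive := fun v => scaleBy h c ((z • A) v) = ((t * z) • A) (scaleBy h c v)) ?_ (by simp) ?_ v
  · intro x v hv
    rw [LinearMap.smul_apply, map_smul, scaleBy_of_mem h c (lower x v hv), scaleBy_of_mem h c hv,
      LinearMap.smul_apply, map_smul, hc, smul_smul, smul_smul]
    congr 1
    ring
  · intro u v hu hv
    simp only [map_add, hu, hv]

end Limit

section Limit

variable {V : Type*} [AddCommGroup V] [Module ℝ V]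

lemma nilOrbit_eq [FiniteDimensional ℝ V] {N : Module.End ℝ V} (hN : IsNilpotent N) (F : CFil V) (z : ℂ) (p : ℤ) :
    nilOrbit F N z p = (F p).map (nexp (z • N.baseChange ℂ)) := by
  rw [nilOrbit, expN_eq_nexp hN]

lemma conjSub_map_nexp {N : Module.End ℝ V} (hN : IsNilpotent N) (z : ℂ)
    (U : Submodule ℂ (Cx V)) :
    conjSub (U.map (nexp (z • N.baseChange ℂ)))
      = (conjSub U).map (nexp ((starRingEnd ℂ z) • N.baseChange ℂ)) := by
  have hint : ∀ v, conj V (nexp (z • N.baseChange ℂ) v)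
      = nexp ((starRingEnd ℂ z) • N.baseChange ℂ) (conj V v) := by
    intro v
    refine nexp_intertwine ((isNilpotent_baseChange hN).smul z) ((isNilpotent_baseChange hN).smul _) (conj V) (fun v => ?_) v
    rw [LinearMap.smul_apply, LinearMap.smul_apply, map_smulₛₗ, conj_baseChange]
  ext v
  constructor
  · rintro ⟨_, ⟨u, hu, rfl⟩, rfl⟩
    exact ⟨conj V u, ⟨u, hu, rfl⟩, (hint u).symm⟩
  · rintro ⟨_, ⟨u, hu, rfl⟩, rfl⟩
    exact ⟨_, ⟨u, hu, rfl⟩, hint u⟩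

/-- The filtration `L^p = ⨁_{s ≤ n - p} J^{r,s}`. -/
noncomputable def limitFil (n : ℤ) (J : ℤ × ℤ → Submodule ℂ (Cx V)) : CFil V :=
  fun p => ⨆ x : ℤ × ℤ, ⨆ _ : x.2 ≤ n - p, J x

lemma tendsto_ofReal_zpow_neg {m : ℤ} (hm : m < 0) {y₁ : ℝ} (hy₁ : 0 < y₁) :
    Filter.Tendsto (fun y : ℝ => ((y / y₁ : ℝ) : ℂ) ^ m) Filter.atTop (nhds 0) := by
  have h1 : Filter.Tendsto (fun t : ℝ => t ^ m) Filter.atTop (nhds 0) := by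
    obtain ⟨k, rfl⟩ : ∃ k : ℕ, m = -(k : ℤ) := ⟨(-m).toNat, by omega⟩
    exact tendsto_pow_neg_atTop (by omega)
  have h2 := h1.comp (Filter.tendsto_id.atTop_div_const hy₁)
  have h3 := (Complex.continuous_ofReal.tendsto 0).comp h2
  rw [Complex.ofReal_zero] at h3
  refine h3.congr fun y => ?_
  simp

/-- The limit of `e^{iyN} F` for a split mixed Hodge structure such that `e^{iyN} F^p` and the
conjugate of `F^{n+1-p}` are opposed for some `y > 0`. -/
lemma tendstoSub_nilOrbit [FiniteDimensional ℝ V] {n : ℤ} {W : ℤ → Submodule ℝ V} {F : CFil V} {N : Module.End ℝ V}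
    (hN : IsNilpotent N) {J : ℤ × ℤ → Submodule ℂ (Cx V)} (hJ : IsSplitting W F J)
    (lower : ∀ x, ∀ v ∈ J x, N.baseChange ℂ v ∈ J (x.1 - 1, x.2 - 1)) {p : ℤ} {y₁ : ℝ}
    (hy₁ : 0 < y₁)
    (hcompl : IsCompl ((F p).map (nexp ((Complex.I * (y₁ : ℂ)) • N.baseChange ℂ)))
      (conjSub (F (n + 1 - p)))) :
    TendstoSub (fun y => nilOrbit F N (Complex.I * (y : ℂ)) p) (limitFil n J p) := by
  have hA := isNilpotent_baseChange hN
  set U₁ := (F p).map (nexp ((Complex.I * (y₁ : ℂ)) • N.baseChange ℂ)) with hU₁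
  obtain ⟨d, e, g, he, hspan, hg⟩ := exists_adapted_basis hJ.internal
    (fun x : ℤ × ℤ => x.2 ≤ n - p)
  have hu : ∀ k, ∃ u ∈ U₁, u - e k ∈ conjSub (F (n + 1 - p)) := by
    intro k
    have h1 : e k ∈ U₁ ⊔ conjSub (F (n + 1 - p)) := by rw [hcompl.sup_eq_top]; trivial
    obtain ⟨u, hu, c, hc, huc⟩ := Submodule.mem_sup.1 h1
    refine ⟨u, hu, ?_⟩
    rw [← huc, sub_add_cancel_left]
    exact neg_mem hc
  choose u hu hue using hu
  -- Scaling by the second index alone separates the limit (s ≤ n-p) from the complement (s ≥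
  -- n+1-p). N lowers s by one, so τ t carries e^{zN}F to e^{tzN}F.
  let τ : ℝ → Cx V →ₗ[ℂ] Cx V := fun t => scaleBy hJ.internal fun x => (t : ℂ) ^ (-x.2)
  -- The extra factor undoes the scaling of e k, so that b y k is e k plus a term tending to 0.
  let b : ℝ → Fin d → Cx V := fun y k => ((y / y₁ : ℝ) : ℂ) ^ (g k).2 • τ (y / y₁) (u k)
  refine ⟨d, b, e, he, hspan, ?_, ?_⟩
  · filter_upwards [Filter.eventually_gt_atTop (0 : ℝ)] with y hy
    have ht : ((y / y₁ : ℝ) : ℂ) ≠ 0 := by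
      exact_mod_cast (div_pos hy hy₁).ne'
    have hspu : Submodule.span ℂ (Set.range u) = U₁ := by
      apply le_antisymm
      · rw [Submodule.span_le]
        rintro _ ⟨k, rfl⟩
        exact hu k
      · intro v hv
        -- This is the projection to the limit along the conjugate of F^{n+1-p}. A vector of U₁ is
        -- determined by it, so the u k span U₁.
        let l := scaleBy hJ.internal (fun x => if x.2 ≤ n - p then 1 else 0) v
        have hl : l ∈ Submodule.span ℂ (Set.range e) := by
          rw [hspan, mem_iSup_iff_proj hJ.internal]
          intro x hx
          simp only [l, proj_scaleBy, hx, if_false, zero_smul]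
        have hlc : v - l ∈ conjSub (F (n + 1 - p)) := by
          rw [hJ.mem_conj_hodge]
          intro x hx
          have hx' : x.2 ≤ n - p := by linarith
          simp only [l, map_sub, proj_scaleBy, hx', if_true, one_smul, sub_self]
        obtain ⟨a, ha⟩ := (Submodule.mem_span_range_iff_exists_fun ℂ).1 hl
        have hv' : v = ∑ k, a k • u k := by
          rw [← sub_eq_zero]
          have h1 : v - ∑ k, a k • u k ∈ U₁ :=
            sub_mem hv (Submodule.sum_mem _ fun k _ => Submodule.smul_mem _ _ (hu k))
          have h2 : v - ∑ k, a k • u k ∈ conjSub (F (n + 1 - p)) := by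
            have e1 : v - ∑ k, a k • u k = (v - l) - ∑ k, a k • (u k - e k) := by
              simp only [smul_sub, Finset.sum_sub_distrib, ha]
              abel
            rw [e1]
            exact sub_mem hlc
              (Submodule.sum_mem _ fun k _ => Submodule.smul_mem _ _ (hue k))
          exact (Submodule.disjoint_def.1 hcompl.disjoint) _ h1 h2
        rw [hv']
        exact Submodule.sum_mem _ fun k _ =>
          Submodule.smul_mem _ _ (Submodule.subset_span ⟨k, rfl⟩)
    have h1 : Submodule.span ℂ (Set.range (b y)) = U₁.map (τ (y / y₁)) := by
      rw [← hspu, Submodule.map_span]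
      apply le_antisymm
      · rw [Submodule.span_le]
        rintro _ ⟨k, rfl⟩
        exact Submodule.smul_mem _ _ (Submodule.subset_span ⟨u k, ⟨k, rfl⟩, rfl⟩)
      · rw [Submodule.span_le]
        rintro _ ⟨_, ⟨k, rfl⟩, rfl⟩
        have e1 : τ (y / y₁) (u k) = (((y / y₁ : ℝ) : ℂ) ^ (g k).2)⁻¹ • b y k := by
          rw [smul_smul, inv_mul_cancel₀ (zpow_ne_zero _ ht), one_smul]
        rw [e1]
        exact Submodule.smul_mem _ _ (Submodule.subset_span ⟨k, rfl⟩)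
    rw [h1, nilOrbit_eq hN, hU₁, ← Submodule.map_comp]
    have h2 : τ (y / y₁) ∘ₗ nexp ((Complex.I * (y₁ : ℂ)) • N.baseChange ℂ)
        = nexp ((Complex.I * (y : ℂ)) • N.baseChange ℂ) ∘ₗ τ (y / y₁) := by
      refine LinearMap.ext fun v => ?_
      rw [LinearMap.comp_apply, LinearMap.comp_apply]
      simp only [τ]
      rw [scaleBy_nexp hJ.internal hA lower (t := ((y / y₁ : ℝ) : ℂ))]
      · congr 3
        push_cast
        have : (y₁ : ℂ) ≠ 0 := by exact_mod_cast hy₁.ne'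
        field_simp
      · intro x
        rw [show -(x.2 - 1) = 1 + -x.2 by ring, zpow_add₀ ht, zpow_one]
    rw [h2, Submodule.map_comp]
    congr 1
    rw [hJ.hodge]
    exact map_scaleBy_coord hJ.internal (fun x => zpow_ne_zero _ ht) _
  · intro k l
    have hlim : Filter.Tendsto (fun y : ℝ => l (e k) + ∑ x ∈ (finite_ne_bot hJ.internal).toFinset,
        ((y / y₁ : ℝ) : ℂ) ^ ((g k).2 - x.2) * l (proj hJ.internal x (u k - e k)))
        Filter.atTop (nhds (l (e k) + ∑ x ∈ (finite_ne_bot hJ.internal).toFinset, 0)) := by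
      refine tendsto_const_nhds.add (tendsto_finsetSum _ fun x _ => ?_)
      by_cases hx : x.2 < n + 1 - p
      · rw [hJ.mem_conj_hodge.1 (hue k) x hx]
        simp
      -- The exponent is negative because (g k).2 ≤ n - p < x.2.
      · have := tendsto_ofReal_zpow_neg (m := (g k).2 - x.2) (by have := (hg k).2; omega) hy₁
        simpa using this.mul_const (l (proj hJ.internal x (u k - e k)))
    rw [Finset.sum_const_zero, add_zero] at hlim
    refine hlim.congr' ?_
    filter_upwards [Filter.eventually_gt_atTop (0 : ℝ)] with y hy
    have ht : ((y / y₁ : ℝ) : ℂ) ≠ 0 := by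
      exact_mod_cast (div_pos hy hy₁).ne'
    have e1 : u k = e k + ∑ x ∈ (finite_ne_bot hJ.internal).toFinset,
        proj hJ.internal x (u k - e k) := by
      rw [← sum_proj]; abel
    have e2 : b y k = e k + ∑ x ∈ (finite_ne_bot hJ.internal).toFinset,
        ((y / y₁ : ℝ) : ℂ) ^ ((g k).2 - x.2) • proj hJ.internal x (u k - e k) := by
      simp only [b]
      nth_rewrite 1 [e1]
      simp only [τ]
      rw [map_add, map_sum, smul_add, scaleBy_of_mem _ _ (hg k).1, smul_smul,
        ← zpow_add₀ ht, add_neg_cancel, zpow_zero, one_smul, Finset.smul_sum]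
      congr 1
      refine Finset.sum_congr rfl fun x _ => ?_
      rw [scaleBy_of_mem _ _ (proj_mem _ x _), smul_smul, ← zpow_add₀ ht]
      rfl
    rw [e2, map_add, map_sum]
    simp only [map_smul, smul_eq_mul]

variable {n : ℤ} {Q : LinearMap.BilinForm ℝ V} {h : ℤ → ℕ}

/-- The naive limit of an `ℝ`-split polarized mixed Hodge structure. -/
theorem RSplitPMHS.isNaiveLimit [FiniteDimensional ℝ V]
    (x : RSplitPMHS n Q h (periodDomain n Q h))
    {J : ℤ × ℤ → Submodule ℂ (Cx V)} (hJ : IsSplitting x.W x.F J) :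
    IsNaiveLimit x.F x.N (limitFil n J) := by
  intro p
  have hA := isNilpotent_baseChange x.nilpotent
  obtain ⟨c, hc⟩ := x.onD
  set y₀ : ℝ := max c 0 + 1
  have hy₀ : 0 < y₀ := by positivity
  have hD := hc (Complex.I * (y₀ : ℂ)) (by
    simp only [Complex.I_mul_im, Complex.ofReal_re, y₀]
    linarith [le_max_left c 0])
  have h1 := hD.2.1 p
  rw [nilOrbit_eq x.nilpotent, nilOrbit_eq x.nilpotent, conjSub_map_nexp x.nilpotent] at h1
  -- At height y₀ the opposed spaces are e^{iy₀N}F^p and e^{-iy₀N} applied to the conjugate of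
  -- F^{n+1-p}. Applying e^{iy₀N} to both cancels the second exponential and doubles the first,
  -- whence 2 * y₀.
  refine tendstoSub_nilOrbit x.nilpotent hJ (fun y v hv => x.lower hJ _ _ v hv)
    (y₁ := 2 * y₀) (by positivity) ?_
  have h2 := (Submodule.orderIsoMapComap (nexpEquiv hA (Complex.I * (y₀ : ℂ)))).isCompl h1
  have e1 : ∀ U : Submodule ℂ (Cx V),
      Submodule.orderIsoMapComap (nexpEquiv hA (Complex.I * (y₀ : ℂ))) U
        = U.map (nexp ((Complex.I * (y₀ : ℂ)) • x.N.baseChange ℂ)) := fun U => rfl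
  rw [e1, e1, ← Submodule.map_comp, ← Submodule.map_comp, ← Module.End.mul_eq_comp,
    ← Module.End.mul_eq_comp, ← nexp_add_smul hA, ← nexp_add_smul hA] at h2
  have e2 : Complex.I * (y₀ : ℂ) + (starRingEnd ℂ) (Complex.I * (y₀ : ℂ)) = 0 := by simp
  have e3 : Complex.I * (y₀ : ℂ) + Complex.I * (y₀ : ℂ) = Complex.I * ((2 * y₀ : ℝ) : ℂ) := by
    push_cast; ring
  rw [e2, e3, nexp_zero_smul, Module.End.one_eq_id, Submodule.map_id] at h2
  exact h2



end Limit


/-! ### The Hodge diamond is determined by the limit -/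

section Diamond

lemma iSup_coord_congr {K ι E : Type*} [Field K] [AddCommGroup E] [Module K E]
    {J : ι → Submodule K E} {P R : ι → Prop} (h : ∀ x, P x ↔ R x) :
    (⨆ x, ⨆ _ : P x, J x) = ⨆ x, ⨆ _ : R x, J x :=
  iSup_congr fun x => by rw [h x]

variable {E : Type*} [AddCommGroup E] [Module ℂ E] [FiniteDimensional ℂ E]
  {J : ℤ × ℤ → Submodule ℂ E}

/-- The dimension of a summand by inclusion and exclusion. -/
lemma finrank_quadrant (h : DirectSum.IsInternal J) (a b : ℤ) :
    Module.finrank ℂ (J (a, b))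
      + Module.finrank ℂ (⨆ x : ℤ × ℤ, ⨆ _ : x.1 ≤ a - 1 ∧ x.2 ≤ b, J x : Submodule ℂ E)
      + Module.finrank ℂ (⨆ x : ℤ × ℤ, ⨆ _ : x.1 ≤ a ∧ x.2 ≤ b - 1, J x : Submodule ℂ E)
      = Module.finrank ℂ (⨆ x : ℤ × ℤ, ⨆ _ : x.1 ≤ a ∧ x.2 ≤ b, J x : Submodule ℂ E)
      + Module.finrank ℂ (⨆ x : ℤ × ℤ, ⨆ _ : x.1 ≤ a - 1 ∧ x.2 ≤ b - 1, J x : Submodule ℂ E) := by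
  have h1 := Submodule.finrank_sup_add_finrank_inf_eq
    (⨆ x : ℤ × ℤ, ⨆ _ : x.1 ≤ a - 1 ∧ x.2 ≤ b, J x)
    (⨆ x : ℤ × ℤ, ⨆ _ : x.1 ≤ a ∧ x.2 ≤ b - 1, J x)
  rw [iSup_coord_inf h, iSup_coord_sup] at h1
  -- The closed quadrant is the corner (a,b) together with the union of the two smaller quadrants,
  -- disjointly.
  have h2 := Submodule.finrank_sup_add_finrank_inf_eq (⨆ x : ℤ × ℤ, ⨆ _ : x = (a, b), J x)
    (⨆ x : ℤ × ℤ, ⨆ _ : (x.1 ≤ a - 1 ∧ x.2 ≤ b) ∨ (x.1 ≤ a ∧ x.2 ≤ b - 1), J x)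
  rw [iSup_coord_inf h, iSup_coord_sup] at h2
  rw [iSup_coord_congr (P := fun x : ℤ × ℤ => (x.1 ≤ a - 1 ∧ x.2 ≤ b) ∧ _)
    (R := fun x : ℤ × ℤ => x.1 ≤ a - 1 ∧ x.2 ≤ b - 1)
    fun x => by constructor <;> intro hx <;> omega] at h1
  rw [iSup_coord_congr (P := fun x => x = (a, b) ∧ _) (R := fun _ => False) (by
      rintro ⟨r, s⟩
      simp only [Prod.mk.injEq, iff_false]
      omega),
    iSup_coord_congr (P := fun x => x = (a, b) ∨ _)
      (R := fun x : ℤ × ℤ => x.1 ≤ a ∧ x.2 ≤ b) (by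
      rintro ⟨r, s⟩
      simp only [Prod.mk.injEq]
      constructor <;> intro hx <;> omega),
    iSup_iSup_eq_left] at h2
  have h3 : (⨆ x : ℤ × ℤ, ⨆ _ : False, J x) = ⊥ := by simp
  rw [h3, finrank_bot] at h2
  omega

end Diamond

/-! ### Equivariance of limits and invariants of their orbits -/

section Conjugation

variable {V : Type*} [AddCommGroup V] [Module ℝ V]

lemma conjSub_limitFil {W : ℤ → Submodule ℝ V} {F : CFil V} {J : ℤ × ℤ → Submodule ℂ (Cx V)}
    (hJ : IsSplitting W F J) (n q : ℤ) :
    conjSub (limitFil n J q) = ⨆ x : ℤ × ℤ, ⨆ _ : x.1 ≤ n - q, J x := by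
  ext v
  rw [mem_conjSub, limitFil, mem_iSup_iff_proj hJ.internal, mem_iSup_iff_proj hJ.internal]
  constructor
  · intro hv x hx
    have h1 := hv x.swap hx
    rw [hJ.proj_conj] at h1
    rw [← conj_conj (proj hJ.internal x v), h1, map_zero]
  · intro hv x hx
    have h1 := hJ.proj_conj x.swap v
    rw [Prod.swap_swap, hv x.swap hx, map_zero] at h1
    exact h1

/-- The left side is computed from the limit and the real structure alone. The right side sums the
diamond over a quadrant, and `finrank_quadrant` recovers the individual entries. -/
lemma finrank_limitFil_inf {W : ℤ → Submodule ℝ V} {F : CFil V}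
    {J : ℤ × ℤ → Submodule ℂ (Cx V)} (hJ : IsSplitting W F J) (n a b : ℤ) :
    Module.finrank ℂ (limitFil n J (n - b) ⊓ conjSub (limitFil n J (n - a)) : Submodule ℂ (Cx V))
      = Module.finrank ℂ (⨆ x : ℤ × ℤ, ⨆ _ : x.1 ≤ a ∧ x.2 ≤ b, J x : Submodule ℂ (Cx V)) := by
  rw [conjSub_limitFil hJ, limitFil, iSup_coord_inf hJ.internal,
    iSup_coord_congr fun x => by rw [sub_sub_cancel, sub_sub_cancel, and_comm]]

/-- The complexification of a real automorphism. -/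
noncomputable def cxEquiv (g : V ≃ₗ[ℝ] V) : Cx V ≃ₗ[ℂ] Cx V :=
  LinearEquiv.ofLinearMap ((g : V →ₗ[ℝ] V).baseChange ℂ) ((g.symm : V →ₗ[ℝ] V).baseChange ℂ)
    (by rw [← LinearMap.baseChange_comp]; simp)
    (by rw [← LinearMap.baseChange_comp]; simp)

lemma act_eq (g : V ≃ₗ[ℝ] V) (F : CFil V) (p : ℤ) :
    act g F p = (F p).map (cxEquiv g : Cx V →ₗ[ℂ] Cx V) := rfl

lemma conjSub_act (g : V ≃ₗ[ℝ] V) (F : CFil V) (p : ℤ) :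
    conjSub (act g F p) = (conjSub (F p)).map (cxEquiv g : Cx V →ₗ[ℂ] Cx V) := by
  ext v
  constructor
  · rintro ⟨_, ⟨u, hu, rfl⟩, rfl⟩
    exact ⟨conj V u, ⟨u, hu, rfl⟩, (conj_baseChange _ u).symm⟩
  · rintro ⟨_, ⟨u, hu, rfl⟩, rfl⟩
    exact ⟨_, ⟨u, hu, rfl⟩, conj_baseChange _ u⟩

lemma finrank_act_inf (g : V ≃ₗ[ℝ] V) (L : CFil V) (p q : ℤ) :
    Module.finrank ℂ (act g L p ⊓ conjSub (act g L q) : Submodule ℂ (Cx V))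
      = Module.finrank ℂ (L p ⊓ conjSub (L q) : Submodule ℂ (Cx V)) := by
  rw [conjSub_act, act_eq, ← Submodule.map_inf _ (cxEquiv g).injective,
    LinearEquiv.finrank_map_eq]

lemma conj_baseChange_apply (g : V ≃ₗ[ℝ] V) (N : Module.End ℝ V) (v : Cx V) :
    (g.conj N).baseChange ℂ ((g : V →ₗ[ℝ] V).baseChange ℂ v)
      = (g : V →ₗ[ℝ] V).baseChange ℂ (N.baseChange ℂ v) := by
  rw [← LinearMap.comp_apply, ← LinearMap.comp_apply, ← LinearMap.baseChange_comp,
    ← LinearMap.baseChange_comp]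
  congr 2
  ext u
  simp [LinearEquiv.conj_apply]

lemma nilOrbit_act [FiniteDimensional ℝ V] (g : V ≃ₗ[ℝ] V) (F : CFil V) {N : Module.End ℝ V}
    (hN : IsNilpotent N) (z : ℂ) :
    nilOrbit (act g F) (g.conj N) z = act g (nilOrbit F N z) := by
  have hN' : IsNilpotent (g.conj N) := by
    obtain ⟨k, hk⟩ := hN
    refine ⟨k, ?_⟩
    have : (g.conj N) ^ k = g.conj (N ^ k) := (map_pow g.conjRingEquiv N k).symm
    rw [this, hk, map_zero]
  funext p
  rw [nilOrbit_eq hN', act, act, nilOrbit_eq hN, ← Submodule.map_comp, ← Submodule.map_comp]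
  congr 1
  refine LinearMap.ext fun v => ?_
  refine (nexp_intertwine ((isNilpotent_baseChange hN).smul z)
    ((isNilpotent_baseChange hN').smul z) ((g : V →ₗ[ℝ] V).baseChange ℂ) (fun v => ?_) v).symm
  rw [LinearMap.smul_apply, LinearMap.smul_apply, map_smul, conj_baseChange_apply]

lemma TendstoSub.map {U : ℝ → Submodule ℂ (Cx V)} {L : Submodule ℂ (Cx V)} (h : TendstoSub U L)
    (T : Cx V ≃ₗ[ℂ] Cx V) :
    TendstoSub (fun y => (U y).map (T : Cx V →ₗ[ℂ] Cx V)) (L.map (T : Cx V →ₗ[ℂ] Cx V)) := by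
  obtain ⟨d, b, e, he, hL, hb, hlim⟩ := h
  have hspan : ∀ w : Fin d → Cx V, Submodule.span ℂ (Set.range fun k => T (w k))
      = (Submodule.span ℂ (Set.range w)).map (T : Cx V →ₗ[ℂ] Cx V) := by
    intro w
    rw [Submodule.map_span, ← Set.range_comp]
    rfl
  refine ⟨d, fun y k => T (b y k), fun k => T (e k), ?_, ?_, ?_, fun k l => ?_⟩
  · exact he.map' (T : Cx V →ₗ[ℂ] Cx V) T.ker
  · rw [hspan, hL]
  · filter_upwards [hb] with y hy
    rw [hspan, hy]
  · exact hlim k (l ∘ₗ (T : Cx V →ₗ[ℂ] Cx V))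

lemma IsNaiveLimit.act [FiniteDimensional ℝ V] {F L : CFil V} {N : Module.End ℝ V}
    (hN : IsNilpotent N) (h : IsNaiveLimit F N L) (g : V ≃ₗ[ℝ] V) :
    IsNaiveLimit (PeriodDomain.act g F) (g.conj N) (PeriodDomain.act g L) := by
  intro p
  have := (h p).map (cxEquiv g)
  simp only [nilOrbit_act g F hN]
  exact this

end Conjugation

/-! ### Conjugacy classes, diamonds and orbits of limits -/

section Classes

variable {V : Type*} [AddCommGroup V] [Module ℝ V] [FiniteDimensional ℝ V]
  {n : ℤ} {Q : LinearMap.BilinForm ℝ V} {h : ℤ → ℕ}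

lemma RSplitPMHS.exists_naiveLimit (x : RSplitPMHS n Q h (periodDomain n Q h)) :
    ∃! L : CFil V, IsNaiveLimit x.F x.N L := by
  obtain ⟨J, hJ⟩ := x.exists_splitting
  exact ⟨_, x.isNaiveLimit hJ, fun L hL => hL.unique (x.isNaiveLimit hJ)⟩

/-- The Hodge diamond is determined by the `Aut(V, Q)`-orbit of the naive limit. -/
theorem RSplitPMHS.diamond_eq_of_limit (x y : RSplitPMHS n Q h (periodDomain n Q h))
    {L : CFil V} (hL : IsNaiveLimit x.F x.N L) {g : V ≃ₗ[ℝ] V}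
    (hg : IsNaiveLimit y.F y.N (act g L)) : x.diamond = y.diamond := by
  obtain ⟨J, hJ⟩ := x.exists_splitting
  obtain ⟨J', hJ'⟩ := y.exists_splitting
  have e1 : L = limitFil n J := hL.unique (x.isNaiveLimit hJ)
  have e2 : act g L = limitFil n J' := hg.unique (y.isNaiveLimit hJ')
  have key : ∀ a b : ℤ,
      Module.finrank ℂ (⨆ x : ℤ × ℤ, ⨆ _ : x.1 ≤ a ∧ x.2 ≤ b, J x : Submodule ℂ (Cx V))
      = Module.finrank ℂ (⨆ x : ℤ × ℤ, ⨆ _ : x.1 ≤ a ∧ x.2 ≤ b, J' x : Submodule ℂ (Cx V)) := by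
    intro a b
    rw [← finrank_limitFil_inf hJ n, ← finrank_limitFil_inf hJ' n, ← e1, ← e2, finrank_act_inf]
  funext ⟨a, b⟩
  rw [x.diamond_eq hJ, y.diamond_eq hJ']
  have h1 := finrank_quadrant hJ.internal a b
  have h2 := finrank_quadrant hJ'.internal a b
  rw [key, key, key, key] at h1
  omega

/-- `ℝ`-split polarized mixed Hodge structures with the same Hodge diamond are conjugate. -/
theorem RSplitPMHS.exists_conj (hsymm : ∀ u v, Q u v = (-1 : ℝ) ^ n * Q v u)
    {D D' : Set (CFil V)} (x : RSplitPMHS n Q h D)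
    (y : RSplitPMHS n Q h D') (hxy : x.diamond = y.diamond) :
    ∃ g ∈ autQ Q, y.F = act g x.F ∧ y.N = g.conj x.N := by
  obtain ⟨J, hJ⟩ := x.exists_splitting
  obtain ⟨J', hJ'⟩ := y.exists_splitting
  obtain ⟨T, hTσ, hTN, hTB, hTJ⟩ := (x.splitData hsymm hJ).exists_iso (y.splitData hsymm hJ')
    (fun a => by rw [← x.diamond_eq hJ, ← y.diamond_eq hJ', hxy])
  -- The isomorphism of split data commutes with conjugation, so it is defined over ℝ.
  obtain ⟨g, hg⟩ := exists_equiv_baseChange_eq T hTσ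
  have hg' : ∀ v, (g : V →ₗ[ℝ] V).baseChange ℂ v = T v := fun v => LinearMap.congr_fun hg v
  refine ⟨g, fun u v => ?_, ?_, ?_⟩
  · have := hTB ((1 : ℂ) ⊗ₜ u) ((1 : ℂ) ⊗ₜ v)
    rw [← hg', ← hg', LinearMap.baseChange_tmul, LinearMap.baseChange_tmul, QC_one_tmul,
      QC_one_tmul] at this
    exact_mod_cast this
  · funext p
    rw [act, hg, hJ.hodge, hJ'.hodge]
    simp only [Submodule.map_iSup, hTJ]
  · apply baseChange_injective
    refine LinearMap.ext fun v => ?_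
    obtain ⟨w, rfl⟩ := T.surjective v
    rw [← hTN, ← hg', ← hg', conj_baseChange_apply]

/-- Conjugacy relates F and N only, whereas the diamond also involves W. The direction from classes
to diamonds therefore passes through the limits, which are equivariant and determine the diamond,
and needs no comparison of weight filtrations. -/
lemma RSplitPMHS.diamond_eq_iff (hsymm : ∀ u v, Q u v = (-1 : ℝ) ^ n * Q v u)
    (x y : RSplitPMHS n Q h (periodDomain n Q h)) : x.diamond = y.diamond ↔ cls x = cls y := by
  constructor
  · intro hxy
    exact Quotient.sound (x.exists_conj hsymm y hxy)
  · intro hxy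
    obtain ⟨g, -, hF, hN⟩ := Quotient.exact hxy
    obtain ⟨L, hL, -⟩ := x.exists_naiveLimit
    refine x.diamond_eq_of_limit y hL (g := g) ?_
    rw [hF, hN]
    exact hL.act x.nilpotent g

/-- The naive limit induces a bijection from conjugacy classes to orbits of limits. -/
theorem exists_limit_bijection (hsymm : ∀ u v, Q u v = (-1 : ℝ) ^ n * Q v u) :
    ∃ Φ : PsiBar n Q h → DeltaBar n Q h,
      (∀ (x : RSplitPMHS n Q h (periodDomain n Q h)) (L : CFil V), IsNaiveLimit x.F x.N L →
        (Φ (cls x) : Set (CFil V)) = orbit Q L) ∧ Function.Bijective Φ := by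
  choose lim hlim huniq using fun x : RSplitPMHS n Q h (periodDomain n Q h) => x.exists_naiveLimit
  let Φ₀ : RSplitPMHS n Q h (periodDomain n Q h) → DeltaBar n Q h :=
    fun x => ⟨orbit Q (lim x), x, lim x, hlim x, rfl⟩
  have orbit_act : ∀ (g : V ≃ₗ[ℝ] V) (L : CFil V), g ∈ autQ Q → orbit Q (act g L) = orbit Q L := by
    intro g L hg
    ext F
    constructor
    · rintro ⟨k, hk, rfl⟩
      exact ⟨k * g, mul_mem hk hg, (act_mul k g L).symm⟩
    · rintro ⟨k, hk, rfl⟩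
      refine ⟨k * g⁻¹, mul_mem hk (inv_mem hg), ?_⟩
      rw [← act_mul, inv_mul_cancel_right]
  have hΦ₀ : ∀ x y, (conjSetoid n Q h (periodDomain n Q h)).r x y → Φ₀ x = Φ₀ y := by
    rintro x y ⟨g, hg, hF, hN⟩
    have h1 : act g (lim x) = lim y := by
      refine huniq y _ ?_
      change IsNaiveLimit y.F y.N (act g (lim x))
      rw [hF, hN]
      exact (hlim x).act x.nilpotent g
    apply Subtype.ext
    change orbit Q (lim x) = orbit Q (lim y)
    rw [← h1, orbit_act g _ hg]
  refine ⟨Quotient.lift Φ₀ hΦ₀, ?_, ?_, ?_⟩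
  · intro x L hL
    change orbit Q (lim x) = orbit Q L
    rw [huniq x L hL]
  · intro a b
    induction a using Quotient.inductionOn with | _ x
    induction b using Quotient.inductionOn with | _ y
    intro hab
    have h1 : orbit Q (lim x) = orbit Q (lim y) := congrArg Subtype.val hab
    have h2 : lim y ∈ orbit Q (lim x) := by
      rw [h1]; exact ⟨1, one_mem _, (act_one _).symm⟩
    obtain ⟨g, -, hg⟩ := h2
    -- Limits in one orbit give equal diamonds, and equal diamonds give the same class.
    refine (RSplitPMHS.diamond_eq_iff hsymm x y).1 ?_
    exact x.diamond_eq_of_limit y (hlim x) (g := g) (hg ▸ hlim y)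
  · rintro ⟨_, x, L, hL, rfl⟩
    refine ⟨cls x, Subtype.ext ?_⟩
    change orbit Q (lim x) = orbit Q L
    rw [huniq x L hL]

end Classes


/-! ### The Hodge decomposition of a point of the period domain -/

section Hodge

variable {V : Type*} [AddCommGroup V] [Module ℝ V]

/-- The Hodge decomposition `H^{p,q} = F^p ∩ conj F^q`, `p + q = n`, as a bigrading. -/
noncomputable def hodgePiece (n : ℤ) (F : CFil V) (x : ℤ × ℤ) : Submodule ℂ (Cx V) :=
  if x.1 + x.2 = n then F x.1 ⊓ conjSub (F x.2) else ⊥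

lemma mem_hodgePiece {n : ℤ} {F : CFil V} {p q : ℤ} {v : Cx V} :
    v ∈ hodgePiece n F (p, q) ↔ v = 0 ∨ (p + q = n ∧ v ∈ F p ∧ conj V v ∈ F q) := by
  rw [hodgePiece]
  split_ifs with h
  · rw [Submodule.mem_inf, mem_conjSub]
    simp only at h
    simp only [h, true_and]
    constructor
    · exact Or.inr
    · rintro (rfl | h')
      · simp
      · exact h'
  · simp only at h
    simp [h]

variable {n : ℤ} {Q : LinearMap.BilinForm ℝ V} {h : ℤ → ℕ} {F : CFil V}

lemma hodgePiece_le (hF : Antitone F) {p : ℤ} {x : ℤ × ℤ} (hx : p ≤ x.1) :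
    hodgePiece n F x ≤ F p := by
  rw [hodgePiece]
  split_ifs
  · exact inf_le_left.trans (hF hx)
  · exact bot_le

/-- Opposedness at p + 1 splits v in F^p as a + b with a in F^{p+1} and b in the conjugate of
F^{n-p}; then b = v - a lies in F^p as well. -/
lemma hodge_step (hF : F ∈ periodDomain n Q h) (p : ℤ) :
    F p = hodgePiece n F (p, n - p) ⊔ F (p + 1) := by
  have hc := hF.2.1 (p + 1)
  rw [show n + 1 - (p + 1) = n - p by ring] at hc
  apply le_antisymm
  · intro v hv
    have h1 : v ∈ F (p + 1) ⊔ conjSub (F (n - p)) := by rw [hc.sup_eq_top]; trivial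
    obtain ⟨a, ha, b, hb, rfl⟩ := Submodule.mem_sup.1 h1
    refine Submodule.mem_sup.2 ⟨b, ?_, a, ha, add_comm _ _⟩
    rw [mem_hodgePiece]
    refine Or.inr ⟨by ring, ?_, (mem_conjSub _ _).1 hb⟩
    have := sub_mem hv (hF.1.anti (by linarith : p ≤ p + 1) ha)
    rwa [add_sub_cancel_left] at this
  · exact sup_le (hodgePiece_le hF.1.anti le_rfl) (hF.1.anti (by linarith))

lemma hodge_disjoint (hF : F ∈ periodDomain n Q h) (p : ℤ) :
    hodgePiece n F (p, n - p) ⊓ F (p + 1) = ⊥ := by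
  have hc := hF.2.1 (p + 1)
  rw [show n + 1 - (p + 1) = n - p by ring] at hc
  rw [eq_bot_iff]
  rintro v ⟨hv, hv'⟩
  rcases mem_hodgePiece.1 hv with rfl | ⟨-, -, h2⟩
  · exact zero_mem _
  · exact (Submodule.disjoint_def.1 hc.disjoint) v hv' ((mem_conjSub _ _).2 h2)

lemma finrank_hodgePiece [FiniteDimensional ℝ V] (hF : F ∈ periodDomain n Q h) (p : ℤ) :
    Module.finrank ℂ (hodgePiece n F (p, n - p)) = h p := by
  have h1 := Submodule.finrank_sup_add_finrank_inf_eq (hodgePiece n F (p, n - p)) (F (p + 1))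
  rw [← hodge_step hF, hodge_disjoint hF, finrank_bot, hF.1.finrank_eq] at h1
  omega

lemma hodge_eq_iSup (hF : F ∈ periodDomain n Q h) (p : ℤ) :
    F p = ⨆ x : ℤ × ℤ, ⨆ _ : p ≤ x.1, hodgePiece n F x := by
  apply le_antisymm
  · obtain ⟨b, hb⟩ := hF.1.exists_bot
    have key : ∀ (k : ℕ) (p : ℤ), b ≤ p + k →
        F p ≤ ⨆ x : ℤ × ℤ, ⨆ _ : p ≤ x.1, hodgePiece n F x := by
      intro k
      induction k with
      | zero =>
        intro p hp
        refine (hF.1.anti (by simpa using hp)).trans ?_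
        rw [hb]; exact bot_le
      | succ k ih =>
        intro p hp
        rw [hodge_step hF p]
        refine sup_le ?_ ((ih (p + 1) (by push_cast at hp; linarith)).trans ?_)
        · exact le_iSup₂_of_le (p, n - p) le_rfl le_rfl
        · exact iSup₂_le fun x hx => le_iSup₂_of_le x (by linarith) le_rfl
    exact key (b - p).toNat p (by omega)
  · exact iSup₂_le fun x hx => hodgePiece_le hF.1.anti hx

lemma hodge_orth (hF : F ∈ periodDomain n Q h) {p q r s : ℤ} (hpr : n < p + r) {u v : Cx V}
    (hu : u ∈ hodgePiece n F (p, q)) (hv : v ∈ hodgePiece n F (r, s)) : QC Q u v = 0 := by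
  rcases mem_hodgePiece.1 hu with rfl | ⟨-, h1, -⟩
  · simp
  rcases mem_hodgePiece.1 hv with rfl | ⟨-, h2, -⟩
  · simp
  exact hF.1.isotropic p u h1 v (hF.1.anti (by linarith) h2)

lemma conj_mem_hodgePiece {p q : ℤ} {v : Cx V} (hv : v ∈ hodgePiece n F (p, q)) :
    conj V v ∈ hodgePiece n F (q, p) := by
  rw [mem_hodgePiece] at hv ⊢
  rcases hv with rfl | ⟨h1, h2, h3⟩
  · simp
  · rw [conj_conj]
    exact Or.inr ⟨by linarith, h3, h2⟩

/-- The split data of a polarized Hodge structure. -/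
theorem hodge_splitData (hsymm : ∀ u v, Q u v = (-1 : ℝ) ^ n * Q v u)
    (hF : F ∈ periodDomain n Q h) :
    SplitData n (conj V) (QC Q) (0 : Module.End ℂ (Cx V)) (hodgePiece n F) := by
  have hbot : ∀ {p q : ℤ} {v : Cx V}, v ∈ hodgePiece n F (p, q) → p + q ≠ n → v = 0 := by
    intro p q v hv hpq
    rcases mem_hodgePiece.1 hv with rfl | ⟨h1, -⟩
    · rfl
    · exact absurd h1 hpq
  have hpos : ∀ {p q : ℤ} {v : Cx V}, v ∈ hodgePiece n F (p, q) → v ≠ 0 →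
      0 < (Complex.I ^ (p - q) * QC Q v (conj V v)).re := by
    intro p q v hv hne
    rcases mem_hodgePiece.1 hv with rfl | ⟨h1, h2, h3⟩
    · exact absurd rfl hne
    · exact hF.2.2 p q h1 v ⟨h2, (mem_conjSub _ _).2 h3⟩ hne
  -- For different types, either Q(u, v̄) or its conjugate Q(ū, v) has first indices adding to more
  -- than n.
  have horth : ∀ {x y : ℤ × ℤ} {u v : Cx V}, y ≠ x → u ∈ hodgePiece n F y →
      v ∈ hodgePiece n F x → QC Q u (conj V v) = 0 := by
    rintro ⟨p, q⟩ ⟨r, s⟩ v u hxy hv hu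
    rcases mem_hodgePiece.1 hv with rfl | ⟨h1, -⟩
    · simp
    rcases mem_hodgePiece.1 hu with rfl | ⟨h2, -⟩
    · simp
    have hne : p ≠ r := by
      rintro rfl
      exact hxy (Prod.ext rfl (by simp only; linarith))
    rcases lt_or_gt_of_ne hne with hlt | hgt
    · exact hodge_orth hF (by linarith : n < r + q) hv (conj_mem_hodgePiece hu)
    · have h3 := hodge_orth hF (by linarith : n < s + p) (conj_mem_hodgePiece hv) hu
      rw [← conj_conj u, QC_conj] at h3
      simpa using h3
  refine ⟨?_, fun p q v hv => conj_mem_hodgePiece hv, fun p q v _ => zero_mem _, ?_, ?_,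
    conj_conj, fun v => by simp, QC_conj Q, QC_flip hsymm, fun u v => by simp,
    fun p q r s hpr u hu v hv => hodge_orth hF hpr hu hv, ?_⟩
  · refine DirectSum.isInternal_submodule_of_iSupIndep_of_iSup_eq_top ?_ ?_
    · rw [iSupIndep_def]
      rintro ⟨p, q⟩
      rw [Submodule.disjoint_def]
      intro v hv hv'
      by_contra hne
      -- A vector of one piece lying in the sum of the others would be orthogonal to itself for the
      -- Hermitian form, against positivity.
      have h1 : (⨆ y, ⨆ _ : y ≠ (p, q), hodgePiece n F y)
          ≤ LinearMap.ker (LinearMap.BilinForm.flip (QC Q) (conj V v)) :=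
        iSup₂_le fun y hy u hu => by
          rw [LinearMap.mem_ker, LinearMap.BilinForm.flip_apply]
          exact horth hy hu hv
      have h2 : QC Q v (conj V v) = 0 := by
        have := h1 hv'
        rwa [LinearMap.mem_ker, LinearMap.BilinForm.flip_apply] at this
      have h3 := hpos hv hne
      rw [h2] at h3
      simp at h3
    · obtain ⟨a, ha⟩ := hF.1.exists_top
      rw [eq_top_iff, ← ha, hodge_eq_iSup hF a]
      exact iSup₂_le fun x _ => le_iSup _ x
  · intro l p q hpq v hv hv'
    rcases l with - | l
    · simpa using hv'
    · exact hbot hv (by push_cast at hpq; linarith)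
  · intro l p q hpq v hv
    rcases l with - | l
    · exact ⟨v, by simpa using hv, by simp⟩
    · refine ⟨0, zero_mem _, ?_⟩
      rw [hbot hv (by push_cast at hpq ⊢; linarith), map_zero]
  · intro l p q hpq v hv _ hne
    rcases l with - | l
    · simpa using hpos hv hne
    · exact absurd (hbot hv (by push_cast at hpq; linarith)) hne

end Hodge


/-! ### Weight filtration and isometries of split data -/

namespace SplitData

section General

variable {n : ℤ} {E : Type*} [AddCommGroup E] [Module ℂ E]
  {σ : E →ₛₗ[starRingEnd ℂ] E} {B : LinearMap.BilinForm ℂ E} {N : Module.End ℂ E}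
  {J : ℤ × ℤ → Submodule ℂ E}

lemma nilpotent [FiniteDimensional ℂ E] (h : SplitData n σ B N J) : IsNilpotent N := by
  obtain ⟨K, hK⟩ := ((finite_ne_bot h.internal).image fun x => |x.1|).bddAbove
  have hbot : ∀ x : ℤ × ℤ, K < |x.1| → J x = ⊥ := by
    intro x hx
    by_contra hne
    exact absurd (hK ⟨x, hne, rfl⟩) (not_le.2 hx)
  -- First indices of nonzero pieces lie in [-K, K], and 2K + 1 steps down leave this interval.
  refine ⟨(2 * K + 1).toNat, LinearMap.ext fun v => ?_⟩
  refine IsInternal.induction h.internal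
    (motive := fun v => (N ^ (2 * K + 1).toNat) v = (0 : Module.End ℂ E) v) ?_ (by simp) ?_ v
  · rintro ⟨p, q⟩ v hv
    by_cases hp : K < |p|
    · rw [hbot (p, q) hp, Submodule.mem_bot] at hv
      rw [hv]; simp
    · have h1 := h.pow_mem (2 * K + 1).toNat hv
      rw [hbot _ ?_, Submodule.mem_bot] at h1
      · rw [h1]; simp
      · simp only
        have h2 := abs_nonneg p
        have h3 := abs_le.1 (not_lt.1 hp)
        rw [Int.toNat_of_nonneg (by linarith)]
        rw [lt_abs]
        right
        linarith
  · intro u v hu hv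
    rw [map_add, hu, hv, map_add]

lemma proj_pow (h : SplitData n σ B N J) (k : ℕ) (p q : ℤ) (v : E) :
    proj h.internal (p - k, q - k) ((N ^ k) v) = (N ^ k) (proj h.internal (p, q) v) :=
  proj_map h.internal h.internal (N ^ k) (g := fun y => (y.1 - (k : ℤ), y.2 - (k : ℤ)))
    (fun a b hab => by
      simp only [Prod.mk.injEq, sub_left_inj] at hab
      exact Prod.ext hab.1 hab.2) (fun _ _ hv => h.pow_mem k hv) (p, q) v

lemma proj_pow' (h : SplitData n σ B N J) (k : ℕ) (x : ℤ × ℤ) (v : E) :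
    proj h.internal x ((N ^ k) v) = (N ^ k) (proj h.internal (x.1 + k, x.2 + k) v) := by
  have := h.proj_pow k (x.1 + k) (x.2 + k) v
  simpa using this

/-- The weight filtration of split data. -/
def wt (J : ℤ × ℤ → Submodule ℂ E) (l : ℤ) : Submodule ℂ E :=
  ⨆ x : ℤ × ℤ, ⨆ _ : x.1 + x.2 ≤ l, J x

lemma mem_wt (h : SplitData n σ B N J) {l : ℤ} {v : E} :
    v ∈ wt J l ↔ ∀ x : ℤ × ℤ, l < x.1 + x.2 → proj h.internal x v = 0 := by
  rw [wt, mem_iSup_iff_proj h.internal]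
  simp only [not_le]

lemma mem_wt_of_mem {l : ℤ} {x : ℤ × ℤ} (hx : x.1 + x.2 ≤ l) {v : E} (hv : v ∈ J x) :
    v ∈ wt J l :=
  (le_iSup₂_of_le (f := fun (x : ℤ × ℤ) (_ : x.1 + x.2 ≤ l) => J x) x hx le_rfl) hv

lemma wt_mono {l m : ℤ} (hlm : l ≤ m) : wt J l ≤ wt J m :=
  iSup₂_le fun x hx => le_iSup₂_of_le x (hx.trans hlm) le_rfl

lemma pow_mem_wt (h : SplitData n σ B N J) (k : ℕ) {l : ℤ} {v : E} (hv : v ∈ wt J l) :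
    (N ^ k) v ∈ wt J (l - 2 * k) := by
  rw [h.mem_wt] at hv ⊢
  intro x hx
  rw [h.proj_pow', hv _ (by simp only; linarith), map_zero]

lemma wt_inj (h : SplitData n σ B N J) (l : ℕ) {v : E} (hv : v ∈ wt J (n + l))
    (hv' : (N ^ l) v ∈ wt J (n - l - 1)) : v ∈ wt J (n + l - 1) := by
  rw [h.mem_wt] at *
  rintro ⟨p, q⟩ hx
  by_cases hlt : n + l < p + q
  · exact hv _ hlt
  · simp only at hx
    have hpq : p + q = n + l := by omega
    refine h.inj l p q hpq _ (proj_mem _ _ _) ?_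
    rw [← h.proj_pow]
    exact hv' _ (by simp only; linarith)

lemma wt_surj (h : SplitData n σ B N J) (l : ℕ) :
    wt J (n - l) ≤ (wt J (n + l)).map (N ^ l) ⊔ wt J (n - l - 1) := by
  refine iSup₂_le ?_
  rintro ⟨p, q⟩ hx v hv
  simp only at hx
  by_cases hlt : p + q ≤ n - l - 1
  · exact Submodule.mem_sup_right (mem_wt_of_mem hlt hv)
  · obtain ⟨w, hw, rfl⟩ := h.surj l (p + l) (q + l) (by omega) v (by simpa using hv)
    exact Submodule.mem_sup_left ⟨w, mem_wt_of_mem (by simp only; omega) hw, rfl⟩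

/-- Only pieces of types (p,q) and (n-p,n-q) pair nontrivially, and their weights add to 2n. -/
lemma wt_orth [FiniteDimensional ℂ E] (h : SplitData n σ B N J) {a b : ℤ} (hab : a + b < 2 * n) {u v : E}
    (hu : u ∈ wt J a) (hv : v ∈ wt J b) : B u v = 0 := by
  rw [h.mem_wt] at hu hv
  rw [sum_proj h.internal u, sum_proj h.internal v]
  simp only [map_sum, LinearMap.sum_apply]
  refine Finset.sum_eq_zero fun x _ => Finset.sum_eq_zero fun y _ => ?_
  by_cases hx : a < y.1 + y.2
  · rw [hu _ hx, map_zero, LinearMap.zero_apply]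
  by_cases hy : b < x.1 + x.2
  · rw [hv _ hy, map_zero]
  refine h.orth_of_ne (p := y.1) (q := y.2) (r := x.1) (s := x.2) ?_ (proj_mem _ _ _)
    (proj_mem _ _ _)
  omega

lemma exists_wt_bot [FiniteDimensional ℂ E] (h : SplitData n σ B N J) : ∃ a, wt J a = ⊥ := by
  obtain ⟨K, hK⟩ := ((finite_ne_bot h.internal).image fun x => x.1 + x.2).bddBelow
  refine ⟨K - 1, ?_⟩
  rw [eq_bot_iff]
  refine iSup₂_le fun x hx => ?_
  by_contra hne
  have hne' : J x ≠ ⊥ := fun h0 => hne h0.le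
  have := hK ⟨x, hne', rfl⟩
  simp only at this
  linarith

lemma exists_wt_top [FiniteDimensional ℂ E] (h : SplitData n σ B N J) : ∃ b, wt J b = ⊤ := by
  obtain ⟨K, hK⟩ := ((finite_ne_bot h.internal).image fun x => x.1 + x.2).bddAbove
  refine ⟨K, ?_⟩
  rw [eq_top_iff]
  intro v _
  rw [h.mem_wt]
  intro x hx
  refine proj_eq_zero_of_bot _ ?_ v
  by_contra hne
  have := hK ⟨x, hne, rfl⟩
  simp only at this
  linarith

/-- Pieces that pair nontrivially are scaled by reciprocal factors. -/
lemma scaleBy_isometry [FiniteDimensional ℂ E] (h : SplitData n σ B N J) {c : ℤ × ℤ → ℂ}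
    (hc : ∀ p q, c (p, q) * c (n - p, n - q) = 1) (u v : E) :
    B (scaleBy h.internal c u) (scaleBy h.internal c v) = B u v := by
  refine IsInternal.induction h.internal
    (motive := fun u => B (scaleBy h.internal c u) (scaleBy h.internal c v) = B u v) ?_ (by simp)
    (fun a b ha hb => by simp only [map_add, LinearMap.add_apply, ha, hb]) u
  rintro ⟨p, q⟩ u hu
  refine IsInternal.induction h.internal
    (motive := fun v => B (scaleBy h.internal c u) (scaleBy h.internal c v) = B u v) ?_ (by simp)
    (fun a b ha hb => by simp only [map_add, ha, hb]) v
  rintro ⟨r, s⟩ v hv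
  rw [scaleBy_of_mem _ _ hu, scaleBy_of_mem _ _ hv, map_smul, map_smul, LinearMap.smul_apply,
    smul_eq_mul, smul_eq_mul]
  by_cases hne : r = n - p ∧ s = n - q
  · obtain ⟨rfl, rfl⟩ := hne
    rw [← mul_assoc, mul_comm (c (n - p, n - q)), hc, one_mul]
  · rw [h.orth_of_ne hne hu hv]; simp

lemma conj_scaleBy (h : SplitData n σ B N J) {c : ℤ × ℤ → ℂ}
    (hc : ∀ p q, starRingEnd ℂ (c (p, q)) = c (q, p)) (v : E) :
    σ (scaleBy h.internal c v) = scaleBy h.internal c (σ v) := by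
  refine IsInternal.induction h.internal
    (motive := fun v => σ (scaleBy h.internal c v) = scaleBy h.internal c (σ v)) ?_ (by simp)
    (fun a b ha hb => by simp only [map_add, ha, hb]) v
  rintro ⟨p, q⟩ v hv
  rw [scaleBy_of_mem _ _ hv, scaleBy_of_mem _ _ (h.conj_mem _ _ _ hv), map_smulₛₗ, hc]

lemma conj_nexp [FiniteDimensional ℂ E] (h : SplitData n σ B N J) (s : ℝ) (v : E) :
    σ (nexp ((s : ℂ) • N) v) = nexp ((s : ℂ) • N) (σ v) := by
  refine nexp_intertwine (h.nilpotent.smul _) (h.nilpotent.smul _) σ (fun v => ?_) v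
  rw [LinearMap.smul_apply, LinearMap.smul_apply, map_smulₛₗ, h.conj_N, Complex.conj_ofReal]

end General

end SplitData

/-! ### From split data on the complexification to a mixed Hodge structure -/

section Realization

variable {V : Type*} [AddCommGroup V] [Module ℝ V]
  {n : ℤ} {Q : LinearMap.BilinForm ℝ V} {h : ℤ → ℕ}
  {A : Module.End ℂ (Cx V)} {J : ℤ × ℤ → Submodule ℂ (Cx V)}

/-- The real weight filtration of split data. -/
noncomputable def realWt (J : ℤ × ℤ → Submodule ℂ (Cx V)) (l : ℤ) : Submodule ℝ V :=
  realSub (SplitData.wt J l)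

/-- The Hodge filtration of split data. -/
noncomputable def hodgeFil (J : ℤ × ℤ → Submodule ℂ (Cx V)) : CFil V :=
  fun p => ⨆ x : ℤ × ℤ, ⨆ _ : p ≤ x.1, J x

/-- Conjugation swaps p and q and so preserves p + q; the weight filtration is therefore defined
over ℝ. -/
lemma WC_realWt (hS : SplitData n (conj V) (QC Q) A J) (l : ℤ) :
    WC (realWt J) l = SplitData.wt J l := by
  refine baseChange_realSub fun x hx => ?_
  rw [hS.mem_wt] at hx ⊢
  intro y hy
  have h1 := proj_map hS.internal hS.internal (conj V) Prod.swap_injective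
    (fun z v hv => hS.conj_mem z.1 z.2 v hv) y.swap x
  rw [Prod.swap_swap] at h1
  rw [h1, hx _ (by simpa [add_comm] using hy), map_zero]

lemma isSplitting_of_splitData (hS : SplitData n (conj V) (QC Q) A J) :
    IsSplitting (realWt J) (hodgeFil J) J where
  internal := hS.internal
  hodge _ := rfl
  weight l := WC_realWt hS l
  conjSub_eq p q := by
    ext v
    rw [mem_conjSub]
    exact ⟨fun hv => by simpa using hS.conj_mem _ _ _ hv, fun hv => hS.conj_mem _ _ _ hv⟩

variable [FiniteDimensional ℝ V]

lemma isWeightFil_of_splitData {N : Module.End ℝ V}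
    (hS : SplitData n (conj V) (QC Q) (N.baseChange ℂ) J) : IsWeightFil n N (realWt J) := by
  have hW := WC_realWt hS
  have hpow : ∀ (l : ℕ) (v : V), (1 : ℂ) ⊗ₜ[ℝ] (N ^ l) v
      = (N.baseChange ℂ ^ l) ((1 : ℂ) ⊗ₜ[ℝ] v) := fun l v => by
    rw [IsWeightFil.baseChange_pow_apply, LinearMap.baseChange_tmul]
  refine ⟨fun l m hlm v hv => SplitData.wt_mono hlm hv, ?_, ?_, ?_, ?_, ?_⟩
  · obtain ⟨a, ha⟩ := hS.exists_wt_bot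
    refine ⟨a, eq_bot_iff.2 fun v hv => ?_⟩
    rw [realWt, mem_realSub, ha, Submodule.mem_bot] at hv
    have := congrArg (reV V) hv
    simpa using this
  · obtain ⟨b, hb⟩ := hS.exists_wt_top
    refine ⟨b, eq_top_iff.2 fun v _ => ?_⟩
    rw [realWt, mem_realSub, hb]
    trivial
  · rintro l _ ⟨v, hv, rfl⟩
    have h1 := hS.pow_mem_wt 1 hv
    rw [← hpow, pow_one] at h1
    rw [realWt, mem_realSub]
    simpa using h1
  · intro l v hv
    obtain ⟨_, ⟨w, hw, rfl⟩, r, hr, hwr⟩ := Submodule.mem_sup.1 (hS.wt_surj l hv)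
    rw [SetLike.mem_coe, ← hW, mem_WC] at hw
    rw [← hW, mem_WC] at hr
    -- The real part of a complex solution is a real solution, N being real.
    refine Submodule.mem_sup.2 ⟨(N ^ l) (reV V w), ⟨_, hw.1, rfl⟩, reV V r, hr.1, ?_⟩
    have := congrArg (reV V) hwr
    rw [map_add, IsWeightFil.baseChange_pow_apply, reV_baseChange] at this
    simpa using this
  · intro l v hv hv'
    refine hS.wt_inj l hv ?_
    rw [← hpow]
    exact hv'

/-- The graded quotient of weight m is the sum of the J(r,s) with r + s = m, and exactly one of r ≥
p and s ≥ m + 1 - p holds. -/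
lemma isMHS_of_splitData (hS : SplitData n (conj V) (QC Q) A J) :
    IsMHS (realWt J) (hodgeFil J) := by
  have hJ := isSplitting_of_splitData hS
  intro m p
  constructor
  · rw [Submodule.disjoint_def]
    rintro _ ⟨u, ⟨hu1, hu2⟩, rfl⟩ ⟨v, ⟨hv1, hv2⟩, huv⟩
    rw [SetLike.mem_coe] at hu1 hu2 hv1 hv2
    rw [Submodule.mkQ_apply, Submodule.mkQ_apply, Submodule.Quotient.eq, hJ.mem_weight] at huv
    rw [Submodule.mkQ_apply, Submodule.Quotient.mk_eq_zero, hJ.mem_weight]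
    rintro ⟨r, s⟩ hx
    simp only at hx
    by_cases hr : r < p
    · exact hJ.mem_hodge.1 hu1 _ hr
    · have h1 := huv (r, s) hx
      rw [map_sub] at h1
      by_cases hm : m < r + s
      · exact hJ.mem_weight.1 hu2 _ hm
      · rw [hJ.mem_conj_hodge.1 hv1 (r, s) (by simp only; omega), zero_sub, neg_eq_zero] at h1
        exact h1
  · apply le_antisymm
    · exact sup_le (Submodule.map_mono (inf_le_inf_right _ le_top))
        (Submodule.map_mono (inf_le_inf_right _ le_top))
    · rw [gr, gr, gr, ← Submodule.map_sup]
      rintro _ ⟨v, ⟨-, hv⟩, rfl⟩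
      rw [SetLike.mem_coe] at hv
      rw [sum_proj hS.internal v, map_sum]
      refine Submodule.sum_mem _ fun x _ => ?_
      by_cases hx : m - 1 < x.1 + x.2
      · by_cases hx' : m < x.1 + x.2
        · rw [hJ.mem_weight.1 hv x hx', map_zero]; exact zero_mem _
        · have h1 := hJ.mem_iff.1 (proj_mem hS.internal x v)
          refine ⟨_, ?_, rfl⟩
          have h2 : proj hS.internal x v ∈ WC (realWt J) m := by
            rw [WC_realWt hS]
            exact SplitData.wt_mono (not_lt.1 hx') (by rw [← WC_realWt hS]; exact h1.2.2)
          by_cases hp : p ≤ x.1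
          · refine Submodule.mem_sup_left ⟨?_, h2⟩
            rw [SetLike.mem_coe, hJ.mem_hodge] at *
            exact fun y hy => h1.1 y (by omega)
          · refine Submodule.mem_sup_right ⟨?_, h2⟩
            rw [SetLike.mem_coe, hJ.mem_conj_hodge] at *
            exact fun y hy => h1.2.1 y (by omega)
      · have : (WC (realWt J) (m - 1)).mkQ (proj hS.internal x v) = 0 := by
          rw [Submodule.mkQ_apply, Submodule.Quotient.mk_eq_zero, WC_realWt hS]
          exact SplitData.mem_wt_of_mem (not_lt.1 hx) (proj_mem _ _ _)
        rw [this]; exact zero_mem _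

end Realization


/-! ### Polarization, the nilpotent orbit and the resulting PMHS -/

section Realization

variable {V : Type*} [AddCommGroup V] [Module ℝ V] [FiniteDimensional ℝ V]
  {n : ℤ} {Q : LinearMap.BilinForm ℝ V} {h : ℤ → ℕ}
  {J : ℤ × ℤ → Submodule ℂ (Cx V)}

/-- By `wt_orth` the form Q(·, N^l ·) on weight n + l ignores terms of lower weight. Classes in the
quotient may thus be replaced by representatives in F^p, or in J(p,q) for positivity. -/
lemma isPolarized_of_splitData {N : Module.End ℝ V}
    (hS : SplitData n (conj V) (QC Q) (N.baseChange ℂ) J)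
    (hiso : ∀ p, ∀ u ∈ hodgeFil J p, ∀ v ∈ hodgeFil J (n + 1 - p), QC Q u v = 0) :
    IsPolarized n Q N (realWt J) (hodgeFil J) := by
  have hJ := isSplitting_of_splitData hS
  have hW := WC_realWt hS
  constructor
  · rintro l p u v ⟨hu, -⟩ ⟨hv, -⟩ ⟨u', ⟨hu1, hu2⟩, hu3⟩ ⟨v', ⟨hv1, hv2⟩, hv3⟩
    rw [Submodule.mkQ_apply, Submodule.mkQ_apply, Submodule.Quotient.eq, hW] at hu3 hv3
    rw [SetLike.mem_coe] at hu1 hu2 hv1 hv2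
    rw [hW] at hu hv hu2 hv2
    have e : QC Q u ((N.baseChange ℂ ^ l) v) = QC Q u' ((N.baseChange ℂ ^ l) v')
        - QC Q (u' - u) ((N.baseChange ℂ ^ l) v) - QC Q u' ((N.baseChange ℂ ^ l) (v' - v)) := by
      simp only [map_sub, LinearMap.sub_apply]
      ring
    rw [e, hS.wt_orth (by linarith) hu3 (hS.pow_mem_wt l hv),
      hS.wt_orth (by linarith) hu2 (hS.pow_mem_wt l hv3), sub_zero, sub_zero]
    refine hiso p _ hu1 _ ?_
    rw [hJ.mem_hodge] at hv1 ⊢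
    intro x hx
    rw [hS.proj_pow', hv1 _ (by simp only; linarith), map_zero]
  · rintro l p q hpq v ⟨hv, hv'⟩ ⟨u, ⟨hu1, hu2⟩, hu3⟩ ⟨w, ⟨hw1, hw2⟩, hw3⟩ hne
    rw [Submodule.mkQ_apply, Submodule.mkQ_apply, Submodule.Quotient.eq, hW, hS.mem_wt] at hu3 hw3
    rw [SetLike.mem_coe] at hu1 hu2 hw1 hw2
    rw [hW] at hv hv' hu2 hw2
    rw [Submodule.mkQ_apply, Ne, Submodule.Quotient.mk_eq_zero, hW] at hne
    set a := proj hS.internal (p, q) v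
    have ha : a ∈ J (p, q) := proj_mem _ _ _
    have hva : v - a ∈ SplitData.wt J (n + l - 1) := by
      rw [hS.mem_wt]
      rintro ⟨r, s⟩ hx
      simp only at hx
      rw [map_sub]
      by_cases hrs : (r, s) = (p, q)
      · rw [hrs, proj_of_mem _ ha, sub_self]
      · rw [proj_of_mem_ne _ (Ne.symm hrs) ha, sub_zero]
        by_cases hlt : n + l < r + s
        · exact hS.mem_wt.1 hv _ hlt
        · have hrs' : ¬ (r = p ∧ s = q) := by rintro ⟨rfl, rfl⟩; exact hrs rfl
          by_cases hr : r < p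
          · have h1 := hu3 (r, s) hx
            rw [map_sub, hJ.mem_hodge.1 hu1 _ hr, zero_sub, neg_eq_zero] at h1
            exact h1
          · have h1 := hw3 (r, s) hx
            rw [map_sub, hJ.mem_conj_hodge.1 hw1 (r, s) (by simp only; omega), zero_sub,
              neg_eq_zero] at h1
            exact h1
    have ha0 : a ≠ 0 := by
      intro h0
      rw [h0, sub_zero] at hva
      exact hne hva
    -- Primitivity is only known modulo W_{n-l-3}. The image of a is a component of weight n-l-2,
    -- hence vanishes exactly.
    have haN : (N.baseChange ℂ ^ (l + 1)) a = 0 := by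
      rw [← hS.proj_pow]
      exact hS.mem_wt.1 hv' _ (by push_cast; linarith)
    have haw : a ∈ SplitData.wt J (n + l) := SplitData.mem_wt_of_mem (by simp only; linarith) ha
    have hconj : ∀ {m : ℤ} {x : Cx V}, x ∈ SplitData.wt J m → conj V x ∈ SplitData.wt J m := by
      intro m x hx
      rw [← hW] at hx ⊢
      exact conj_mem_WC hx
    have e : QC Q v ((N.baseChange ℂ ^ l) (conj V v)) = QC Q a ((N.baseChange ℂ ^ l) (conj V a))
        + QC Q (v - a) ((N.baseChange ℂ ^ l) (conj V v))
        + QC Q a ((N.baseChange ℂ ^ l) (conj V (v - a))) := by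
      simp only [map_sub, LinearMap.sub_apply]
      ring
    rw [e, hS.wt_orth (by linarith) hva (hS.pow_mem_wt l (hconj hv)),
      hS.wt_orth (by linarith) haw (hS.pow_mem_wt l (hconj hva)), add_zero, add_zero]
    exact hS.pos l p q hpq a ha haN ha0

/-- The real scaling factors on the bigrading. -/
noncomputable def expWeight (n : ℤ) (ρ : ℝ) (x : ℤ × ℤ) : ℂ :=
  ((Real.exp (ρ * ((n - x.1 - x.2 : ℤ) : ℝ)) : ℝ) : ℂ)

lemma expWeight_ne_zero (n : ℤ) (ρ : ℝ) (x : ℤ × ℤ) : expWeight n ρ x ≠ 0 :=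
  Complex.ofReal_ne_zero.2 (Real.exp_pos _).ne'

/-- The scaling by `expWeight` as an automorphism. -/
noncomputable def scaleEquiv (hJ : DirectSum.IsInternal J) {c : ℤ × ℤ → ℂ} (hc : ∀ x, c x ≠ 0) :
    Cx V ≃ₗ[ℂ] Cx V :=
  LinearEquiv.ofLinearMap (scaleBy hJ c) (scaleBy hJ c⁻¹)
    (LinearMap.ext fun v => by
      rw [LinearMap.comp_apply, scaleBy_mul,
        show c * c⁻¹ = 1 from funext fun x => mul_inv_cancel₀ (hc x), scaleBy_one]
      rfl)
    (LinearMap.ext fun v => by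
      rw [LinearMap.comp_apply, scaleBy_mul,
        show c⁻¹ * c = 1 from funext fun x => inv_mul_cancel₀ (hc x), scaleBy_one]
      rfl)

/-- The nilpotent orbit of a split polarized mixed Hodge structure lies in one orbit of the
identity component. -/
lemma nilOrbit_mem_connDomain {N : Module.End ℝ V}
    (hS : SplitData n (conj V) (QC Q) (N.baseChange ℂ) J) (hN : IsNilpotent N) {φ : CFil V}
    (hφ : ∀ p, φ p = (hodgeFil J p).map (nexp (Complex.I • N.baseChange ℂ))) {z : ℂ}
    (hz : 0 < z.im) : nilOrbit (hodgeFil J) N z ∈ connDomain Q φ := by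
  have hA := isNilpotent_baseChange hN
  -- A two-parameter family of isometries commuting with conjugation: a scaling of the weights
  -- followed by e^{sN}. It descends to elements g s ρ of Aut(V,Q).
  let T : ℝ → ℝ → Cx V ≃ₗ[ℂ] Cx V := fun s ρ =>
    (scaleEquiv hS.internal (expWeight_ne_zero n ρ)).trans (nexpEquiv hA (s : ℂ))
  have hTapply : ∀ s ρ v, T s ρ v
      = nexp ((s : ℂ) • N.baseChange ℂ) (scaleBy hS.internal (expWeight n ρ) v) :=
    fun _ _ _ => rfl
  have hTconj : ∀ s ρ v, T s ρ (conj V v) = conj V (T s ρ v) := by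
    intro s ρ v
    rw [hTapply, hTapply, hS.conj_nexp, hS.conj_scaleBy]
    intro p q
    rw [expWeight, Complex.conj_ofReal, expWeight]
    congr 4
    ring
  have hTQ : ∀ s ρ u v, QC Q (T s ρ u) (T s ρ v) = QC Q u v := by
    intro s ρ u v
    rw [hTapply, hTapply, nexp_isometry hA _ hS.skew, hS.scaleBy_isometry]
    intro p q
    rw [expWeight, expWeight, ← Complex.ofReal_mul, ← Real.exp_add, ← mul_add, ← Int.cast_add]
    simp only
    rw [show (n - p - q + (n - (n - p) - (n - q)) : ℤ) = 0 by ring]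
    simp
  choose g hg using fun s ρ => exists_equiv_baseChange_eq (T s ρ) (hTconj s ρ)
  have hg' : ∀ s ρ v, (g s ρ : V →ₗ[ℝ] V).baseChange ℂ v = T s ρ v :=
    fun s ρ v => LinearMap.congr_fun (hg s ρ) v
  have hgQ : ∀ s ρ, g s ρ ∈ autQ Q := by
    intro s ρ u v
    have := hTQ s ρ ((1 : ℂ) ⊗ₜ u) ((1 : ℂ) ⊗ₜ v)
    rw [← hg', ← hg', LinearMap.baseChange_tmul, LinearMap.baseChange_tmul, QC_one_tmul,
      QC_one_tmul] at this
    exact_mod_cast this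
  -- N lowers the weight by 2, so the scaling with parameter μ multiplies N by e^{2μ} = Im z and
  -- carries e^{iN}F to the point of the nilpotent orbit at i Im z. The path scales both parameters
  -- linearly from 0.
  set μ : ℝ := Real.log z.im / 2 with hμ
  refine ⟨g z.re μ, ⟨fun r => g (r * z.re) (r * μ), ?_, ?_, ?_, ?_⟩, ?_⟩
  · have h1 : (g 0 0 : V →ₗ[ℝ] V) = LinearMap.id := by
      apply baseChange_injective
      refine LinearMap.ext fun v => ?_
      have h2 : expWeight n 0 = 1 := by
        funext x
        simp [expWeight]
      rw [hg', hTapply, h2, scaleBy_one, Complex.ofReal_zero, nexp_zero_smul,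
        LinearMap.baseChange_id]
      rfl
    have h3 : g 0 0 = 1 := LinearEquiv.toLinearMap_injective h1
    simpa using h3
  · simp
  · intro t _
    exact hgQ _ _
  · intro v l
    refine Continuous.continuousOn ?_
    let L : Cx V →ₗ[ℝ] ℝ := l ∘ₗ reV V
    have hL : ∀ (r : ℝ) (x : Cx V), L ((r : ℂ) • x) = r * L x := by
      intro r x
      rw [real_smul, map_smul, smul_eq_mul]
    obtain ⟨k, hk⟩ := hA
    -- Matrix coefficients are finite sums of powers of s times exponentials in ρ, so they are
    -- continuous.
    have hform : ∀ s ρ, l (g s ρ v) = ∑ j ∈ Finset.range k,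
        ∑ x ∈ (finite_ne_bot hS.internal).toFinset,
          ((j.factorial : ℝ)⁻¹ * s ^ j * Real.exp (ρ * ((n - x.1 - x.2 : ℤ) : ℝ)))
          * L ((N.baseChange ℂ ^ j) (proj hS.internal x ((1 : ℂ) ⊗ₜ[ℝ] v))) := by
      intro s ρ
      have h1 : l (g s ρ v) = L (T s ρ ((1 : ℂ) ⊗ₜ[ℝ] v)) := by
        rw [← hg', LinearMap.baseChange_tmul]
        simp [L]
      have h2 : ((s : ℂ) • N.baseChange ℂ) ^ k = 0 := by rw [smul_pow, hk, smul_zero]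
      rw [h1, hTapply, nexp_eq_sum h2, LinearMap.sum_apply, map_sum]
      refine Finset.sum_congr rfl fun j _ => ?_
      conv_lhs => rw [sum_proj hS.internal (scaleBy hS.internal (expWeight n ρ) _)]
      rw [map_sum, map_sum]
      refine Finset.sum_congr rfl fun x _ => ?_
      rw [← hL]
      congr 1
      rw [proj_scaleBy, smul_pow, LinearMap.smul_apply, LinearMap.smul_apply, map_smul, smul_smul,
        smul_smul, expWeight]
      congr 1
      push_cast
      ring
    simp only [hform]
    fun_prop
  · funext p
    rw [nilOrbit_eq hN, act, hg, hφ, ← Submodule.map_comp]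
    have h1 : ((T z.re μ : Cx V →ₗ[ℂ] Cx V)) ∘ₗ nexp (Complex.I • N.baseChange ℂ)
        = nexp (z • N.baseChange ℂ) ∘ₗ scaleBy hS.internal (expWeight n μ) := by
      refine LinearMap.ext fun v => ?_
      rw [LinearMap.comp_apply, LinearMap.comp_apply, LinearEquiv.coe_coe, hTapply,
        scaleBy_nexp hS.internal hA (fun x v hv => hS.lower _ _ v hv) (t := (z.im : ℂ)),
        ← Module.End.mul_apply, ← nexp_add_smul hA, Complex.re_add_im]
      intro x
      rw [expWeight, expWeight, ← Complex.ofReal_mul]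
      congr 1
      conv_rhs => rw [← Real.exp_log hz]
      rw [← Real.exp_add]
      congr 1
      rw [hμ]
      push_cast
      ring
    rw [h1, Submodule.map_comp]
    congr 1
    exact (map_scaleBy_coord hS.internal (expWeight_ne_zero n μ) _).symm

/-- Split data on `V_ℂ` with `e^{iN} F = φ` define an `ℝ`-split polarized mixed Hodge structure on
the connected period domain of `φ`. -/
theorem exists_rSplitPMHS {A : Module.End ℂ (Cx V)} {φ : CFil V} (hcd : IsCompactDual n Q h φ)
    (hS : SplitData n (conj V) (QC Q) A J)
    (hφ : ∀ p, φ p = (hodgeFil J p).map (nexp (Complex.I • A))) :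
    ∃ x : RSplitPMHS n Q h (connDomain Q φ), ∀ a, x.diamond a = Module.finrank ℂ (J a) := by
  obtain ⟨N, rfl⟩ := exists_baseChange_eq A (fun v => (hS.conj_N v).symm)
  have hA := hS.nilpotent
  have hN : IsNilpotent N := by
    obtain ⟨k, hk⟩ := hA
    refine ⟨k, baseChange_injective ?_⟩
    rw [LinearMap.baseChange_pow, hk, LinearMap.baseChange_zero]
  have hJ := isSplitting_of_splitData hS
  have hφ' : ∀ p, φ p = (hodgeFil J p).map (nexpEquiv hA Complex.I : Cx V →ₗ[ℂ] Cx V) := hφ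
  have hfin : ∀ p, Module.finrank ℂ (hodgeFil J p) = Module.finrank ℂ (φ p) := fun p => by
    rw [hφ', LinearEquiv.finrank_map_eq]
  have hiso : ∀ p, ∀ u ∈ hodgeFil J p, ∀ v ∈ hodgeFil J (n + 1 - p), QC Q u v = 0 := by
    intro p u hu v hv
    rw [← nexp_isometry hA (QC Q) hS.skew Complex.I]
    refine hcd.isotropic p _ ?_ _ ?_
    · rw [hφ]; exact ⟨u, hu, rfl⟩
    · rw [hφ]; exact ⟨v, hv, rfl⟩
  have hanti : Antitone (hodgeFil J) := fun p q hpq =>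
    iSup₂_le fun x hx => le_iSup₂_of_le x (hpq.trans hx) le_rfl
  let x : RSplitPMHS n Q h (connDomain Q φ) :=
    { F := hodgeFil J
      N := N
      W := realWt J
      compactDual :=
        { anti := hanti
          exists_top := by
            obtain ⟨a, ha⟩ := hcd.exists_top
            refine ⟨a, Submodule.eq_top_of_finrank_eq ?_⟩
            rw [hfin, ha, finrank_top]
          exists_bot := by
            obtain ⟨b, hb⟩ := hcd.exists_bot
            refine ⟨b, Submodule.finrank_eq_zero.1 ?_⟩
            rw [hfin, hb, finrank_bot]
          finrank_eq := fun p => by rw [hfin, hfin, hcd.finrank_eq]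
          isotropic := hiso }
      nilpotent := hN
      skew := fun u v => by
        have := hS.skew ((1 : ℂ) ⊗ₜ u) ((1 : ℂ) ⊗ₜ v)
        rw [LinearMap.baseChange_tmul, LinearMap.baseChange_tmul, QC_one_tmul, QC_one_tmul] at this
        have h1 : Q (N u) v = - Q u (N v) := by exact_mod_cast this
        rw [h1, neg_add_cancel]
      weight := isWeightFil_of_splitData hS
      horizontal := by
        rintro p _ ⟨v, hv, rfl⟩
        rw [SetLike.mem_coe, hJ.mem_hodge] at hv
        rw [hJ.mem_hodge]
        intro y hy
        have := hS.proj_pow' 1 y v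
        rw [pow_one] at this
        rw [this, hv _ (by push_cast; linarith), map_zero]
      mhs := isMHS_of_splitData hS
      polarized := isPolarized_of_splitData hS hiso
      split := ⟨J, hJ.internal, hJ.hodge, hJ.weight, hJ.conjSub_eq⟩
      onD := ⟨0, fun z hz => nilOrbit_mem_connDomain hS hN hφ hz⟩ }
  exact ⟨x, fun a => x.diamond_eq hJ a⟩

end Realization


/-! ### The standard model with prescribed strings -/

open Polynomial in
/-- The invariant pairing on polynomials of degree at most `l`. -/
noncomputable def pair (l : ℕ) (f g : ℂ[X]) : ℂ :=
  ∑ k ∈ Finset.range (l + 1),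
    (-1) ^ k * (k.factorial : ℂ) * ((l - k).factorial : ℂ) * (f.coeff k * g.coeff (l - k))

section Pair

open Polynomial

lemma pair_zero_left (l : ℕ) (g : ℂ[X]) : pair l 0 g = 0 := by simp [pair]

lemma pair_zero_right (l : ℕ) (f : ℂ[X]) : pair l f 0 = 0 := by simp [pair]

lemma pair_add_left (l : ℕ) (f f' g : ℂ[X]) : pair l (f + f') g = pair l f g + pair l f' g := by
  simp only [pair, coeff_add, add_mul, mul_add, Finset.sum_add_distrib]

lemma pair_add_right (l : ℕ) (f g g' : ℂ[X]) : pair l f (g + g') = pair l f g + pair l f g' := by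
  simp only [pair, coeff_add, mul_add, Finset.sum_add_distrib]

lemma pair_smul_left (l : ℕ) (c : ℂ) (f g : ℂ[X]) : pair l (c • f) g = c * pair l f g := by
  simp only [pair, coeff_smul, smul_eq_mul, Finset.mul_sum]
  exact Finset.sum_congr rfl fun k _ => by ring

lemma pair_smul_right (l : ℕ) (c : ℂ) (f g : ℂ[X]) : pair l f (c • g) = c * pair l f g := by
  simp only [pair, coeff_smul, smul_eq_mul, Finset.mul_sum]
  exact Finset.sum_congr rfl fun k _ => by ring

lemma pair_flip (l : ℕ) (f g : ℂ[X]) : pair l f g = (-1) ^ l * pair l g f := by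
  rw [pair, pair, ← Finset.sum_range_reflect, Finset.mul_sum]
  refine Finset.sum_congr rfl fun k hk => ?_
  have hk' : k ≤ l := by simpa [Nat.lt_succ_iff] using hk
  rw [show l + 1 - 1 - k = l - k by omega, show l - (l - k) = k by omega]
  have h1 : ((-1) ^ l : ℂ) = (-1) ^ (l - k) * (-1) ^ k := by
    rw [← pow_add, Nat.sub_add_cancel hk']
  have h2 : ((-1) ^ k * (-1) ^ k : ℂ) = 1 := by rw [← mul_pow]; simp
  rw [h1]
  linear_combination (-(-1) ^ (l - k) * (k.factorial : ℂ) * ((l - k).factorial : ℂ)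
    * f.coeff (l - k) * g.coeff k) * h2

lemma pair_map (l : ℕ) (f g : ℂ[X]) :
    pair l (f.map (starRingEnd ℂ)) (g.map (starRingEnd ℂ)) = starRingEnd ℂ (pair l f g) := by
  simp only [pair, coeff_map, map_sum, map_mul, map_pow, map_neg, map_one, map_natCast]

/-- The weights k!(l-k)! absorb the factors produced by differentiation, so after shifting k by one
the terms cancel in pairs. The degree bound removes the boundary terms. -/
lemma pair_derivative {l : ℕ} {f g : ℂ[X]} (hf : f ∈ degreeLT ℂ (l + 1))
    (hg : g ∈ degreeLT ℂ (l + 1)) :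
    pair l (derivative f) g = - pair l f (derivative g) := by
  have hf' : f.coeff (l + 1) = 0 := (degree_lt_iff_coeff_zero f _).1 (mem_degreeLT.1 hf) _ le_rfl
  have hg' : g.coeff (l + 1) = 0 := (degree_lt_iff_coeff_zero g _).1 (mem_degreeLT.1 hg) _ le_rfl
  rw [pair, pair, Finset.sum_range_succ, Finset.sum_range_succ']
  simp only [coeff_derivative, hf', Nat.sub_zero, hg', zero_mul, mul_zero, add_zero]
  rw [← Finset.sum_neg_distrib]
  refine Finset.sum_congr rfl fun k hk => ?_
  have hk' : k < l := by simpa using hk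
  obtain ⟨j, rfl⟩ := Nat.exists_eq_add_of_lt hk'
  rw [show k + j + 1 - k = j + 1 by omega, show k + j + 1 - (k + 1) = j by omega,
    Nat.factorial_succ, Nat.factorial_succ]
  push_cast
  ring

lemma pair_X_pow_mul {l m m' : ℕ} (f g : ℂ[X]) (h : l < m + m') :
    pair l (X ^ m * f) (X ^ m' * g) = 0 := by
  refine Finset.sum_eq_zero fun k hk => ?_
  rw [coeff_X_pow_mul', coeff_X_pow_mul']
  have hk' : k < l + 1 := by simpa using hk
  split_ifs with h1 h2
  · omega
  all_goals simp

lemma pair_X_pow_mul_eq {l m m' : ℕ} (f g : ℂ[X]) (h : m + m' = l) :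
    pair l (X ^ m * f) (X ^ m' * g)
      = (-1) ^ m * (m.factorial : ℂ) * (m'.factorial : ℂ) * (f.coeff 0 * g.coeff 0) := by
  rw [pair, Finset.sum_eq_single m]
  · rw [coeff_X_pow_mul', coeff_X_pow_mul', if_pos le_rfl, show l - m = m' by omega,
      if_pos le_rfl, Nat.sub_self, Nat.sub_self]
  · intro k hk hkm
    have : k < l + 1 := by simpa using hk
    rw [coeff_X_pow_mul', coeff_X_pow_mul']
    split_ifs with h1 h2
    · omega
    all_goals simp
  · intro hm
    exact absurd (Finset.mem_range.2 (by omega)) hm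

/-- The polynomials `(X + i) ^ m (X - i) ^ (l - m)`. -/
noncomputable def cayley (l m : ℕ) : ℂ[X] :=
  (X + C Complex.I) ^ m * (X - C Complex.I) ^ (l - m)

lemma cayley_mem {l m : ℕ} (h : m ≤ l) : cayley l m ∈ degreeLT ℂ (l + 1) := by
  rw [mem_degreeLT, cayley, degree_mul, degree_pow, degree_pow, degree_X_add_C, degree_X_sub_C]
  simp only [nsmul_eq_mul, mul_one]
  norm_cast
  omega

lemma map_cayley {l m : ℕ} (h : m ≤ l) :
    (cayley l m).map (starRingEnd ℂ) = cayley l (l - m) := by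
  rw [cayley, cayley, Nat.sub_sub_self h]
  simp [Polynomial.map_mul, Polynomial.map_pow, sub_eq_add_neg, mul_comm]

/-- This shift puts the zero of order m at the origin, and the shift by +i the zero of order l - m.
Each yields one of the two vanishing conditions for pairings of Cayley polynomials. -/
lemma taylor_neg_cayley (l m : ℕ) :
    taylor (-Complex.I) (cayley l m) = X ^ m * (X - C (2 * Complex.I)) ^ (l - m) := by
  rw [cayley, taylor_mul, taylor_pow, taylor_pow, map_add, map_sub, taylor_X, taylor_C]
  congr 2
  · simp
  · simp [two_mul]
    ring

lemma taylor_cayley (l m : ℕ) :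
    taylor Complex.I (cayley l m) = X ^ (l - m) * (X + C (2 * Complex.I)) ^ m := by
  rw [cayley, taylor_mul, taylor_pow, taylor_pow, map_add, map_sub, taylor_X, taylor_C, mul_comm]
  congr 2
  · simp
  · simp [two_mul]
    ring

end Pair

/-- Combinatorial data of the strings of an `ℝ`-split polarized mixed Hodge structure: the string
`s` starts in bidegree `(a s, b s)`, and complex conjugation maps it to `bar s`. -/
structure StringSystem (n : ℤ) (S : Type) where
  a : S → ℤ
  b : S → ℤ
  len : S → ℕ
  bar : S → S
  bar_bar : ∀ s, bar (bar s) = s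
  a_bar : ∀ s, a (bar s) = b s
  len_eq : ∀ s, a s + b s = n + len s

namespace StringSystem

open Polynomial

variable {n : ℤ} {S : Type} (D : StringSystem n S)

lemma b_bar (s : S) : D.b (D.bar s) = D.a s := by rw [← D.a_bar, D.bar_bar]

lemma len_bar (s : S) : D.len (D.bar s) = D.len s := by
  have h1 := D.len_eq s
  have h2 := D.len_eq (D.bar s)
  rw [D.a_bar, D.b_bar] at h2
  omega

lemma pair_len_bar (s : S) (f g : ℂ[X]) : pair (D.len (D.bar s)) f g = pair (D.len s) f g := by
  rw [len_bar]

/-- The underlying vector space: one polynomial of degree at most `len s` for every string `s`. -/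
abbrev Model : Type := ∀ s : S, degreeLT ℂ (D.len s + 1)

variable {D} in
lemma Model.coeff_eq_zero (v : D.Model) {s : S} {k : ℕ} (h : D.len s < k) :
    (v s : ℂ[X]).coeff k = 0 :=
  (degree_lt_iff_coeff_zero _ _).1 (mem_degreeLT.1 (v s).2) _ h

variable {D} in
lemma Model.ext_coeff {u v : D.Model}
    (h : ∀ s k, (u s : ℂ[X]).coeff k = (v s : ℂ[X]).coeff k) : u = v :=
  funext fun s => Subtype.ext (Polynomial.ext (h s))

variable {D} in
lemma Model.mem_bar (v : D.Model) (s : S) :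
    (v (D.bar s) : ℂ[X]) ∈ degreeLT ℂ (D.len s + 1) := by
  have h : degreeLT ℂ (D.len (D.bar s) + 1) = degreeLT ℂ (D.len s + 1) := by rw [D.len_bar]
  exact h ▸ (v (D.bar s)).2

/-- Complex conjugation on the model. -/
noncomputable def conjMap : D.Model →ₛₗ[starRingEnd ℂ] D.Model where
  toFun v s := ⟨(v (D.bar s) : ℂ[X]).map (starRingEnd ℂ), by
    rw [mem_degreeLT, degree_lt_iff_coeff_zero]
    intro m hm
    rw [coeff_map, v.coeff_eq_zero (by rw [D.len_bar]; omega), map_zero]⟩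
  map_add' u v := by ext; simp
  map_smul' c v := by ext; simp

/-- The nilpotent endomorphism of the model: differentiation. -/
noncomputable def deriv : Module.End ℂ D.Model where
  toFun v s := ⟨derivative (v s : ℂ[X]), by
    rw [mem_degreeLT, degree_lt_iff_coeff_zero]
    intro m hm
    rw [coeff_derivative, v.coeff_eq_zero (by omega), zero_mul]⟩
  map_add' u v := by ext; simp
  map_smul' c v := by ext; simp

/-- The sign of the form on a string. -/
noncomputable def sgn (s : S) : ℂ := Complex.I ^ (D.b s - D.a s) * (-1) ^ D.len s

/-- The polarization of the model. -/
noncomputable def form [Fintype S] : LinearMap.BilinForm ℂ D.Model :=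
  LinearMap.mk₂ ℂ (fun u v => ∑ s, D.sgn s * pair (D.len s) (u s) (v (D.bar s)))
    (fun u u' v => by
      simp only [Pi.add_apply, Submodule.coe_add, pair_add_left, mul_add, Finset.sum_add_distrib])
    (fun c u v => by
      simp only [Pi.smul_apply, Submodule.coe_smul, pair_smul_left, Finset.mul_sum, smul_eq_mul,
        mul_left_comm])
    (fun u v v' => by
      simp only [Pi.add_apply, Submodule.coe_add, pair_add_right, mul_add, Finset.sum_add_distrib])
    (fun c u v => by
      simp only [Pi.smul_apply, Submodule.coe_smul, pair_smul_right, Finset.mul_sum, smul_eq_mul,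
        mul_left_comm])

lemma form_apply [Fintype S] (u v : D.Model) :
    D.form u v = ∑ s, D.sgn s * pair (D.len s) (u s) (v (D.bar s)) := rfl

@[simp] lemma conjMap_apply (v : D.Model) (s : S) :
    (D.conjMap v s : ℂ[X]) = (v (D.bar s) : ℂ[X]).map (starRingEnd ℂ) := rfl

@[simp] lemma deriv_apply (v : D.Model) (s : S) :
    (D.deriv v s : ℂ[X]) = derivative (v s : ℂ[X]) := rfl

lemma deriv_pow_apply (k : ℕ) (v : D.Model) (s : S) :
    ((D.deriv ^ k) v s : ℂ[X]) = derivative^[k] (v s : ℂ[X]) := by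
  induction k generalizing v with
  | zero => rfl
  | succ k ih => rw [pow_succ, Module.End.mul_apply, ih, deriv_apply, Function.iterate_succ_apply]

lemma conj_conj (v : D.Model) : D.conjMap (D.conjMap v) = v := by
  refine Model.ext_coeff fun s k => ?_
  rw [conjMap_apply, conjMap_apply, D.bar_bar, coeff_map, coeff_map, Complex.conj_conj]

lemma conj_deriv (v : D.Model) : D.conjMap (D.deriv v) = D.deriv (D.conjMap v) := by
  refine Model.ext_coeff fun s k => ?_
  rw [conjMap_apply, deriv_apply, deriv_apply, conjMap_apply, derivative_map]

/-- Conjugation as a permutation of the strings. -/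
def barEquiv : Equiv.Perm S := Function.Involutive.toPerm D.bar D.bar_bar

lemma sgn_bar (s : S) : D.sgn (D.bar s) = starRingEnd ℂ (D.sgn s) := by
  rw [sgn, sgn, D.a_bar, D.b_bar, D.len_bar, map_mul, map_pow, map_neg, map_one, map_zpow₀,
    Complex.conj_I, ← Complex.inv_I, inv_zpow, ← zpow_neg, neg_sub]

/-- Written as powers of i, the exponents differ by a multiple of 4 because a + b = n + len. This
gives the form its parity. -/
lemma sgn_flip (s : S) : (-1 : ℂ) ^ n * (-1) ^ D.len s * D.sgn (D.bar s) = D.sgn s := by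
  have h1 : (-1 : ℂ) = Complex.I ^ (2 : ℤ) := by
    rw [zpow_ofNat, Complex.I_sq]
  have hI := Complex.I_ne_zero
  rw [sgn, sgn, D.a_bar, D.b_bar, D.len_bar]
  simp only [← zpow_natCast (-1 : ℂ)]
  rw [h1]
  simp only [← zpow_mul, ← zpow_add₀ hI]
  have h2 := D.len_eq s
  rw [show 2 * n + 2 * (D.len s : ℤ) + (D.a s - D.b s + 2 * (D.len s : ℤ))
    = 4 * (D.a s - D.len s + D.len s) + (D.b s - D.a s + 2 * D.len s) by
      linear_combination (-2) * h2, zpow_add₀ hI, zpow_mul]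
  rw [show (Complex.I ^ (4 : ℤ) : ℂ) = 1 by rw [zpow_ofNat, Complex.I_pow_four]]
  simp

section Form

variable [Fintype S]

lemma form_conj (u v : D.Model) :
    D.form (D.conjMap u) (D.conjMap v) = starRingEnd ℂ (D.form u v) := by
  rw [form_apply, form_apply, map_sum, ← Equiv.sum_comp D.barEquiv]
  refine Finset.sum_congr rfl fun s _ => ?_
  change D.sgn (D.bar s) * pair (D.len (D.bar s)) (D.conjMap u (D.bar s))
    (D.conjMap v (D.bar (D.bar s))) = _
  rw [conjMap_apply, conjMap_apply, pair_map, sgn_bar, pair_len_bar, D.bar_bar, map_mul]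

lemma form_flip (u v : D.Model) : D.form u v = (-1) ^ n * D.form v u := by
  rw [form_apply, form_apply, Finset.mul_sum, ← Equiv.sum_comp D.barEquiv (fun s => (-1) ^ n * _)]
  refine Finset.sum_congr rfl fun s _ => ?_
  change _ = (-1) ^ n * (D.sgn (D.bar s) * pair (D.len (D.bar s)) (v (D.bar s))
    (u (D.bar (D.bar s))))
  rw [D.bar_bar, pair_len_bar, pair_flip, ← D.sgn_flip s]
  have h2 : ((-1) ^ D.len s * (-1) ^ D.len s : ℂ) = 1 := by rw [← mul_pow]; simp
  linear_combination ((-1) ^ n * D.sgn (D.bar s)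
    * pair (D.len s) (v (D.bar s) : ℂ[X]) (u s : ℂ[X])) * h2

lemma form_skew (u v : D.Model) : D.form (D.deriv u) v = - D.form u (D.deriv v) := by
  rw [form_apply, form_apply, ← Finset.sum_neg_distrib]
  refine Finset.sum_congr rfl fun s _ => ?_
  rw [deriv_apply, deriv_apply, pair_derivative (u s).2 (v.mem_bar s), mul_neg]

end Form

end StringSystem


lemma iSup_span_basis {K E ι S : Type*} [Field K] [AddCommGroup E] [Module K E]
    (β : Module.Basis S K E) (d : S → ι) (P : ι → Prop) :
    ⨆ x, ⨆ _ : P x, Submodule.span K (β '' (d ⁻¹' {x}))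
      = Submodule.span K (β '' {i | P (d i)}) := by
  simp only [← Submodule.span_iUnion]
  congr 1
  ext v
  simp only [Set.mem_iUnion, Set.mem_image, Set.mem_preimage, Set.mem_singleton_iff,
    Set.mem_ofPred_eq]
  constructor
  · rintro ⟨y, hy, s, rfl, rfl⟩; exact ⟨s, hy, rfl⟩
  · rintro ⟨s, hs, rfl⟩; exact ⟨d s, hs, s, rfl, rfl⟩

/-! ### The monomial bigrading of the model -/

namespace StringSystem

open Polynomial

variable {n : ℤ} {S : Type} (D : StringSystem n S)

/-- Index set of the bases of the model. -/
abbrev Idx : Type := Σ s : S, Fin (D.len s + 1)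

/-- The bidegree of a monomial. -/
def deg (x : D.Idx) : ℤ × ℤ := (n - D.b x.1 + x.2, n - D.a x.1 + x.2)

/-- The bidegree of a basis vector of the Hodge structure `e^{iN} F`. -/
def hodgeDeg (x : D.Idx) : ℤ × ℤ := (n - D.b x.1 + x.2, D.b x.1 - x.2)

/-- The involution of the index set given by complex conjugation of the Hodge structure. -/
def inv (x : D.Idx) : D.Idx :=
  ⟨D.bar x.1, ⟨D.len x.1 - x.2, by rw [D.len_bar]; omega⟩⟩

lemma inv_injective : Function.Injective D.inv := by
  rintro ⟨s, k⟩ ⟨t, m⟩ h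
  have h1 : D.bar s = D.bar t := congrArg Sigma.fst h
  have h2 : s = t := by rw [← D.bar_bar s, h1, D.bar_bar]
  subst h2
  have h3 := congrArg Fin.val (eq_of_heq (Sigma.mk.inj h).2)
  simp only at h3
  have hk := k.2
  have hm := m.2
  exact congrArg (Sigma.mk s) (Fin.ext (by omega))

lemma hodgeDeg_inv (x : D.Idx) : D.hodgeDeg (D.inv x) = (D.hodgeDeg x).swap := by
  have h1 := D.len_eq x.1
  have h2 : (x.2 : ℕ) ≤ D.len x.1 := Nat.lt_succ_iff.1 x.2.2
  simp only [hodgeDeg, inv, D.b_bar, Prod.swap, Prod.mk.injEq]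
  push_cast [h2]
  omega

lemma fst_add_snd_hodgeDeg (x : D.Idx) : (D.hodgeDeg x).1 + (D.hodgeDeg x).2 = n := by
  simp only [hodgeDeg]
  ring

section Basis

variable [Fintype S]

/-- The monomial basis. -/
noncomputable def stdBasis : Module.Basis D.Idx ℂ D.Model :=
  Pi.basis fun s => degreeLT.basis ℂ (D.len s + 1)

lemma mem_span_stdBasis (T : Set D.Idx) (v : D.Model) :
    v ∈ Submodule.span ℂ (D.stdBasis '' T) ↔
      ∀ (s : S) (k : Fin (D.len s + 1)), (v s : ℂ[X]).coeff k ≠ 0 → (⟨s, k⟩ : D.Idx) ∈ T := by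
  rw [Module.Basis.mem_span_image]
  constructor
  · intro h s k hk
    refine h ((Finsupp.mem_support_iff (f := D.stdBasis.repr v)).2 ?_)
    exact hk
  · rintro h ⟨s, k⟩ hx
    exact h s k ((Finsupp.mem_support_iff (f := D.stdBasis.repr v)).1 hx)

/-- The Deligne bigrading of the model. -/
noncomputable def piece (x : ℤ × ℤ) : Submodule ℂ D.Model :=
  Submodule.span ℂ (D.stdBasis '' (D.deg ⁻¹' {x}))

lemma mem_piece {p q : ℤ} {v : D.Model} : v ∈ D.piece (p, q) ↔
    ∀ (s : S) (k : ℕ), (v s : ℂ[X]).coeff k ≠ 0 → n - D.b s + k = p ∧ n - D.a s + k = q := by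
  rw [piece, mem_span_stdBasis]
  constructor
  · intro h s k hk
    have hk' : k < D.len s + 1 := by
      by_contra hlt
      exact hk (v.coeff_eq_zero (by omega))
    have := h s ⟨k, hk'⟩ hk
    simpa [deg] using this
  · intro h s k hk
    have := h s k hk
    simpa [deg] using this

lemma deriv_pow_eq_zero : D.deriv ^ (Finset.univ.sup D.len + 1) = 0 := by
  refine LinearMap.ext fun v => Model.ext_coeff fun s k => ?_
  rw [deriv_pow_apply, coeff_iterate_derivative, v.coeff_eq_zero, smul_zero]
  · simp
  · have := Finset.le_sup (f := D.len) (Finset.mem_univ s)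
    omega

/-- Taylor's formula: the exponential of z d/dX is translation by z. -/
lemma nexp_apply (z : ℂ) (v : D.Model) (s : S) :
    (nexp (z • D.deriv) v s : ℂ[X]) = taylor z (v s : ℂ[X]) := by
  have h0 : (z • D.deriv) ^ (Finset.univ.sup D.len + 1) = 0 := by
    rw [_root_.smul_pow, D.deriv_pow_eq_zero, smul_zero]
  have hs := Finset.le_sup (f := D.len) (Finset.mem_univ s)
  have hdeg : (v s : ℂ[X]).natDegree ≤ D.len s :=
    natDegree_le_iff_coeff_eq_zero.2 fun k hk => v.coeff_eq_zero hk
  rw [nexp_eq_sum h0]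
  ext j
  rw [taylor_coeff, eval_eq_sum_range' (n := Finset.univ.sup D.len + 1)
    ((natDegree_hasseDeriv_le _ _).trans_lt (by omega))]
  simp only [LinearMap.sum_apply, Finset.sum_apply, AddSubmonoidClass.coe_finsetSum,
    finsetSum_coeff, LinearMap.smul_apply, _root_.smul_pow, Pi.smul_apply, Submodule.coe_smul,
    coeff_smul, deriv_pow_apply, coeff_iterate_derivative, hasseDeriv_coeff, smul_eq_mul,
    nsmul_eq_mul]
  refine Finset.sum_congr rfl fun i _ => ?_
  have hi : (i.factorial : ℂ) ≠ 0 := by exact_mod_cast i.factorial_ne_zero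
  rw [Nat.descFactorial_eq_factorial_mul_choose, add_comm j i, Nat.choose_symm_add]
  push_cast
  field_simp

/-- By invariance under translation the form can be evaluated after whichever shift makes the
polynomials vanish to high order at 0. -/
lemma form_eq_taylor (z : ℂ) (u v : D.Model) : D.form u v
    = ∑ s, D.sgn s * pair (D.len s) (taylor z (u s : ℂ[X])) (taylor z (v (D.bar s) : ℂ[X])) := by
  rw [← nexp_isometry ⟨_, D.deriv_pow_eq_zero⟩ D.form D.form_skew z u v, form_apply]
  refine Finset.sum_congr rfl fun s _ => ?_
  rw [nexp_apply, nexp_apply]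

/-- The monomial bigrading of the model is a split polarized mixed Hodge structure. -/
theorem splitData : SplitData n D.conjMap D.form D.deriv D.piece where
  internal := isInternal_span_basis D.stdBasis D.deg
  conj_mem p q v hv := by
    rw [mem_piece] at hv ⊢
    intro s k hk
    have := hv (D.bar s) k (fun h => hk (by rw [conjMap_apply, coeff_map, h, map_zero]))
    rw [D.a_bar, D.b_bar] at this
    exact this.symm
  lower p q v hv := by
    rw [mem_piece] at hv ⊢
    intro s k hk
    have := hv s (k + 1) (fun h => hk (by rw [deriv_apply, coeff_derivative, h, zero_mul]))
    push_cast at this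
    omega
  inj l p q hpq v hv h0 := by
    rw [mem_piece] at hv
    refine Model.ext_coeff fun s k => ?_
    by_contra hk
    have hk : (v s : ℂ[X]).coeff k ≠ 0 := by simpa using hk
    have h1 := hv s k hk
    have h2 := D.len_eq s
    have h3 : k ≤ D.len s := by
      by_contra hlt
      exact hk (v.coeff_eq_zero (by omega))
    -- Weight n + l means 2k = len s + l, and k ≤ len s then gives k ≥ l. So the l-th derivative
    -- does not kill the monomial of degree k.
    have h4 : ((D.deriv ^ l) v s : ℂ[X]).coeff (k - l) = 0 := by rw [h0]; simp
    rw [deriv_pow_apply, coeff_iterate_derivative, Nat.sub_add_cancel (by omega)] at h4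
    rw [nsmul_eq_mul, mul_eq_zero, Nat.cast_eq_zero, Nat.descFactorial_eq_zero_iff_lt] at h4
    rcases h4 with h4 | h4
    · omega
    · exact hk h4
  surj l p q hpq v hv := by
    suffices hle : D.piece (p - l, q - l) ≤ (D.piece (p, q)).map (D.deriv ^ l) by
      exact hle hv
    classical
    refine Submodule.span_le.2 ?_
    rintro _ ⟨⟨s, k⟩, hx, rfl⟩
    simp only [deg, Set.mem_preimage, Set.mem_singleton_iff, Prod.mk.injEq] at hx
    have h2 := D.len_eq s
    have hk := k.2
    -- The l-th derivative of X^{k+l} is a nonzero multiple of X^k; the weight condition 2k + l =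
    -- len s keeps k + l within the string.
    let w : D.Model := D.stdBasis ⟨s, ⟨k + l, by omega⟩⟩
    have hw : w ∈ D.piece (p, q) := by
      refine Submodule.subset_span ⟨_, ?_, rfl⟩
      simp only [deg, Set.mem_preimage, Set.mem_singleton_iff, Prod.mk.injEq]
      push_cast
      omega
    have hd : (((k + l).descFactorial l : ℕ) : ℂ) ≠ 0 := by
      rw [Nat.cast_ne_zero, Ne, Nat.descFactorial_eq_zero_iff_lt]
      omega
    refine ⟨(((k + l).descFactorial l : ℕ) : ℂ)⁻¹ • w, Submodule.smul_mem _ _ hw, ?_⟩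
    rw [map_smul]
    refine Model.ext_coeff fun t j => ?_
    rw [Pi.smul_apply, Submodule.coe_smul, deriv_pow_apply]
    simp only [w, stdBasis, Pi.basis_apply]
    by_cases hts : t = s
    · subst hts
      rw [Pi.single_eq_same, Pi.single_eq_same, degreeLT.basis_val, degreeLT.basis_val,
        coeff_smul, coeff_iterate_derivative, coeff_X_pow, coeff_X_pow]
      by_cases hj : j = k
      · subst hj
        simp only [if_true, nsmul_eq_mul, smul_eq_mul, mul_one]
        exact inv_mul_cancel₀ hd
      · simp [hj]
    · rw [Pi.single_eq_of_ne hts, Pi.single_eq_of_ne hts]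
      simp
  conj_conj := D.conj_conj
  conj_N := D.conj_deriv
  form_conj := D.form_conj
  form_flip := D.form_flip
  skew := D.form_skew
  orth p q r s hpr u hu v hv := by
    rw [mem_piece] at hu hv
    rw [form_apply]
    refine Finset.sum_eq_zero fun t _ => ?_
    rw [pair, Finset.sum_eq_zero, mul_zero]
    intro k hk
    have hk' : k < D.len t + 1 := by simpa using hk
    by_cases h1 : (u t : ℂ[X]).coeff k = 0
    · rw [h1]; ring
    by_cases h2 : (v (D.bar t) : ℂ[X]).coeff (D.len t - k) = 0
    · rw [h2]; ring
    have h3 := hu _ _ h1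
    have h4 := hv _ _ h2
    rw [D.a_bar, D.b_bar] at h4
    have h5 := D.len_eq t
    omega
  pos l p q hpq v hv h0 hne := by
    rw [mem_piece] at hv
    -- Primitive vectors involve only top monomials: the weight gives 2k = len s + l with k ≤ len s,
    -- and N^{l+1} v = 0 gives k ≤ l, so k = l = len s.
    have key : ∀ s k, (v s : ℂ[X]).coeff k ≠ 0 →
        k = D.len s ∧ D.len s = l ∧ p = D.a s ∧ q = D.b s := by
      intro s k hk
      have h1 := hv s k hk
      have h2 := D.len_eq s
      have h3 : k ≤ D.len s := by
        by_contra hlt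
        exact hk (v.coeff_eq_zero (by omega))
      have h5 : k < l + 1 := by
        by_contra hlt
        have h4 : ((D.deriv ^ (l + 1)) v s : ℂ[X]).coeff (k - (l + 1)) = 0 := by rw [h0]; simp
        rw [deriv_pow_apply, coeff_iterate_derivative, Nat.sub_add_cancel (by omega)] at h4
        rw [nsmul_eq_mul, mul_eq_zero, Nat.cast_eq_zero, Nat.descFactorial_eq_zero_iff_lt] at h4
        rcases h4 with h4 | h4
        · omega
        · exact hk h4
      omega
    have hterm : ∀ s, Complex.I ^ (p - q) * (D.sgn s * pair (D.len s) (v s)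
        ((D.deriv ^ l) (D.conjMap v) (D.bar s)))
        = (((D.len s).factorial ^ 2 * ‖(v s : ℂ[X]).coeff (D.len s)‖ ^ 2 : ℝ) : ℂ) := by
      intro s
      have hz : ∀ k ∈ Finset.range (D.len s + 1), k ≠ D.len s →
          ((-1) ^ k * (k.factorial : ℂ) * ((D.len s - k).factorial : ℂ) *
            ((v s : ℂ[X]).coeff k *
              ((D.deriv ^ l) (D.conjMap v) (D.bar s) : ℂ[X]).coeff (D.len s - k))) = 0 := by
        intro k _ hk
        have : (v s : ℂ[X]).coeff k = 0 := by
          by_contra h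
          exact hk (key s k h).1
        rw [this]; ring
      rw [pair, Finset.sum_eq_single _ hz (fun h => absurd (Finset.self_mem_range_succ _) h)]
      rw [Nat.sub_self, deriv_pow_apply, coeff_iterate_derivative, conjMap_apply, D.bar_bar,
        coeff_map, zero_add]
      by_cases hs : (v s : ℂ[X]).coeff (D.len s) = 0
      · simp [hs]
      obtain ⟨-, h2, h3, h4⟩ := key s _ hs
      rw [← h2, h3, h4, Nat.descFactorial_self, sgn]
      -- The normalization `sgn` is made for this cancellation: its power of i cancels i^{p-q}, and
      -- its sign cancels that of the top term of `pair`.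
      have hI : Complex.I ^ (D.a s - D.b s) * Complex.I ^ (D.b s - D.a s) = 1 := by
        rw [← zpow_add₀ Complex.I_ne_zero]; simp
      have hm : ((-1) ^ D.len s * (-1) ^ D.len s : ℂ) = 1 := by rw [← mul_pow]; simp
      have hc := Complex.mul_conj' ((v s : ℂ[X]).coeff (D.len s))
      push_cast
      rw [← hc, nsmul_eq_mul, Nat.factorial_zero, Nat.cast_one]
      generalize (v s : ℂ[X]).coeff (D.len s) = c
      generalize ((D.len s).factorial : ℂ) = a
      linear_combination (a ^ 2 * c * (starRingEnd ℂ) c) * ((-1) ^ D.len s * (-1) ^ D.len s) * hI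
        + (a ^ 2 * c * (starRingEnd ℂ) c) * hm
    rw [form_apply, Finset.mul_sum, Finset.sum_congr rfl fun s _ => hterm s, ← Complex.ofReal_sum,
      Complex.ofReal_re]
    obtain ⟨s, hs⟩ : ∃ s, (v s : ℂ[X]).coeff (D.len s) ≠ 0 := by
      by_contra! hall
      refine hne (Model.ext_coeff fun s k => ?_)
      by_contra hk
      have hk : (v s : ℂ[X]).coeff k ≠ 0 := by simpa using hk
      have := (key s k hk).1
      subst this
      exact hk (hall s)
    refine Finset.sum_pos' (fun s _ => by positivity) ⟨s, Finset.mem_univ s, ?_⟩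
    have : 0 < ‖(v s : ℂ[X]).coeff (D.len s)‖ := norm_pos_iff.2 hs
    positivity

end Basis

end StringSystem


/-! ### The Cayley basis and the Hodge structure at e^{iN}F -/

namespace StringSystem

open Polynomial

variable {n : ℤ} {S : Type} (D : StringSystem n S) [DecidableEq S]

/-- The vectors `(X + i) ^ m (X - i) ^ (len s - m)` in the string `s`. -/
noncomputable def cay (x : D.Idx) : D.Model :=
  Pi.single x.1 ⟨cayley (D.len x.1) x.2, cayley_mem (Nat.lt_succ_iff.1 x.2.2)⟩

lemma cay_self (x : D.Idx) : (D.cay x x.1 : ℂ[X]) = cayley (D.len x.1) x.2 := by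
  rw [cay, Pi.single_eq_same]

lemma cay_of_ne (x : D.Idx) {s : S} (h : s ≠ x.1) : D.cay x s = 0 := by
  rw [cay, Pi.single_eq_of_ne h]

lemma conj_cay (x : D.Idx) : D.conjMap (D.cay x) = D.cay (D.inv x) := by
  refine funext fun s => Subtype.ext ?_
  rw [conjMap_apply]
  by_cases h : s = D.bar x.1
  · subst h
    rw [D.bar_bar, cay_self, map_cayley (Nat.lt_succ_iff.1 x.2.2)]
    refine Eq.trans ?_ (D.cay_self (D.inv x)).symm
    change _ = cayley (D.len (D.bar x.1)) (D.len x.1 - x.2)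
    rw [D.len_bar]
  · have h1 : D.bar s ≠ x.1 := by
      rintro h1
      exact h (by rw [← h1, D.bar_bar])
    rw [D.cay_of_ne x h1, D.cay_of_ne (D.inv x) h]
    simp

section Form

variable [Fintype S]

lemma form_cay (z : ℂ) (x : D.Idx) (v : D.Model) : D.form (D.cay x) v
    = D.sgn x.1 * pair (D.len x.1) (taylor z (cayley (D.len x.1) x.2))
      (taylor z (v (D.bar x.1) : ℂ[X])) := by
  rw [D.form_eq_taylor z, Finset.sum_eq_single x.1]
  · rw [cay_self]
  · intro s _ hs
    rw [D.cay_of_ne x hs, Submodule.coe_zero, map_zero, pair_zero_left, mul_zero]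
  · intro h
    exact absurd (Finset.mem_univ _) h

/-- Translating by -i rules out m + m' > len, translating by i rules out m + m' < len, so m' = len -
m. Different strings pair only with their conjugates. -/
lemma eq_inv_of_form_ne_zero {x y : D.Idx} (h : D.form (D.cay x) (D.cay y) ≠ 0) :
    y = D.inv x := by
  obtain ⟨s, m⟩ := x
  obtain ⟨t, m'⟩ := y
  by_cases ht : D.bar s = t
  · subst ht
    have h1 := fun z => D.form_cay z ⟨s, m⟩ (D.cay ⟨D.bar s, m'⟩)
    simp only [D.cay_self ⟨D.bar s, m'⟩] at h1
    have hm := m.2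
    have hm' := m'.2
    have hbar := D.len_bar s
    have h2 : ¬ D.len s < m + m' := fun hlt => h (by
      rw [h1 (-Complex.I), taylor_neg_cayley, taylor_neg_cayley, pair_X_pow_mul _ _ hlt, mul_zero])
    have h3 : ¬ D.len s < (D.len s - m) + (D.len (D.bar s) - m') := fun hlt => h (by
      rw [h1 Complex.I, taylor_cayley, taylor_cayley, pair_X_pow_mul _ _ hlt, mul_zero])
    refine congrArg (Sigma.mk (D.bar s)) (Fin.ext ?_)
    change (m' : ℕ) = D.len s - m
    omega
  · refine absurd ?_ h
    rw [D.form_cay 0, D.cay_of_ne ⟨t, m'⟩ ht, Submodule.coe_zero, map_zero, pair_zero_right,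
      mul_zero]

/-- After translation by -i only the term k = m survives. Its constant coefficients are powers of
-2i, whose phases cancel those of i^{p-q} and `sgn` and leave a positive number. -/
lemma form_cay_inv (x : D.Idx) :
    Complex.I ^ ((D.hodgeDeg x).1 - (D.hodgeDeg x).2) * D.form (D.cay x) (D.cay (D.inv x))
      = ((2 ^ D.len x.1 * (x.2 : ℕ).factorial * (D.len x.1 - x.2).factorial : ℝ) : ℂ) := by
  obtain ⟨s, m⟩ := x
  have hm : (m : ℕ) ≤ D.len s := Nat.lt_succ_iff.1 m.2
  have h1 : (D.cay (D.inv ⟨s, m⟩) (D.bar s) : ℂ[X]) = cayley (D.len s) (D.len s - m) := by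
    refine (D.cay_self (D.inv ⟨s, m⟩)).trans ?_
    change cayley (D.len (D.bar s)) (D.len s - m) = _
    rw [D.len_bar]
  rw [D.form_cay (-Complex.I)]
  simp only [h1]
  rw [taylor_neg_cayley, taylor_neg_cayley, pair_X_pow_mul_eq _ _ (by omega),
    coeff_zero_eq_eval_zero, coeff_zero_eq_eval_zero, Nat.sub_sub_self hm]
  simp only [eval_pow, eval_sub, eval_X, eval_C, zero_sub, hodgeDeg, sgn]
  obtain ⟨j, hj⟩ := Nat.exists_eq_add_of_le hm
  have hI := Complex.I_ne_zero
  have hs := D.len_eq s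
  have h2 : Complex.I ^ (n - D.b s + (m : ℤ) - (D.b s - m)) * Complex.I ^ (D.b s - D.a s)
      = Complex.I ^ (2 * (m : ℤ)) * Complex.I ^ (-(D.len s : ℤ)) := by
    rw [← zpow_add₀ hI, ← zpow_add₀ hI]
    congr 1
    omega
  have h3 : Complex.I ^ (2 * (m : ℤ)) = (-1) ^ (m : ℕ) := by
    rw [zpow_mul, zpow_ofNat, Complex.I_sq, zpow_natCast]
  rw [h3] at h2
  have h4 : Complex.I ^ (-(D.len s : ℤ)) * Complex.I ^ D.len s = 1 := by
    rw [← zpow_natCast, ← zpow_add₀ hI]; simp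
  have h5 : ((-1) ^ (m : ℕ) * (-1) ^ (m : ℕ) : ℂ) = 1 := by rw [← mul_pow]; simp
  have h6 : ((-1) ^ D.len s * (-1) ^ D.len s : ℂ) = 1 := by rw [← mul_pow]; simp
  have h7 : (-(2 * Complex.I)) ^ (D.len s - m) * (-(2 * Complex.I)) ^ (m : ℕ)
      = (-1) ^ D.len s * 2 ^ D.len s * Complex.I ^ D.len s := by
    rw [← pow_add, Nat.sub_add_cancel hm, ← mul_pow, ← mul_pow]
    congr 1
    ring
  rw [h7]
  push_cast
  generalize ((m : ℕ).factorial : ℂ) = a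
  generalize ((D.len s - m).factorial : ℂ) = b
  set X := Complex.I ^ (n - D.b s + (m : ℤ) - (D.b s - m))
  set Y := Complex.I ^ (D.b s - D.a s)
  set Z := Complex.I ^ (-(D.len s : ℤ))
  set W := Complex.I ^ D.len s
  set e : ℂ := (-1) ^ (m : ℕ)
  set f : ℂ := (-1) ^ D.len s
  set g : ℂ := 2 ^ D.len s
  linear_combination (f * f * e * a * b * g * W) * h2 + f * f * e * e * a * b * g * h4
    + f * f * a * b * g * h5 + a * b * g * h6

lemma form_cay_inv_ne_zero (x : D.Idx) : D.form (D.cay x) (D.cay (D.inv x)) ≠ 0 := by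
  intro h
  have h1 := D.form_cay_inv x
  rw [h, mul_zero] at h1
  have h2 : (0 : ℝ) < 2 ^ D.len x.1 * (x.2 : ℕ).factorial * (D.len x.1 - x.2).factorial := by
    positivity
  exact h2.ne (by exact_mod_cast h1)

lemma linearIndependent_cay : LinearIndependent ℂ D.cay := by
  refine linearIndependent_of_dual D.cay (fun x => LinearMap.flip D.form (D.cay (D.inv x))) ?_ ?_
  · intro x
    rw [LinearMap.flip_apply]
    exact D.form_cay_inv_ne_zero x
  · intro x y hxy
    rw [LinearMap.flip_apply]
    by_contra h
    exact hxy (D.inv_injective (D.eq_inv_of_form_ne_zero h)).symm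

/-- The basis of the vectors `cay x`. -/
noncomputable def cayBasis : Module.Basis D.Idx ℂ D.Model :=
  Module.Basis.mk D.linearIndependent_cay
    (D.linearIndependent_cay.span_eq_top_of_card_eq_finrank'
      (Module.finrank_eq_card_basis D.stdBasis).symm).ge

@[simp] lemma cayBasis_apply (x : D.Idx) : D.cayBasis x = D.cay x := by
  rw [cayBasis, Module.Basis.mk_apply]

/-- The Hodge decomposition of `e^{iN} F`. -/
noncomputable def hodge (x : ℤ × ℤ) : Submodule ℂ D.Model :=
  Submodule.span ℂ (D.cayBasis '' (D.hodgeDeg ⁻¹' {x}))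

lemma hodge_eq_zero {p q : ℤ} (h : p + q ≠ n) {v : D.Model} (hv : v ∈ D.hodge (p, q)) : v = 0 := by
  have h1 : D.hodgeDeg ⁻¹' {(p, q)} = ∅ := by
    refine Set.eq_empty_of_forall_notMem fun x hx => h ?_
    simp only [hodgeDeg, Set.mem_preimage, Set.mem_singleton_iff, Prod.mk.injEq] at hx
    omega
  rw [hodge, h1, Set.image_empty, Submodule.span_empty] at hv
  exact (Submodule.mem_bot ℂ).1 hv

lemma hodge_orth {p q r s : ℤ} (hpr : n < p + r) {u v : D.Model} (hu : u ∈ D.hodge (p, q))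
    (hv : v ∈ D.hodge (r, s)) : D.form u v = 0 := by
  refine Submodule.span_induction (p := fun u _ => D.form u v = 0) ?_ (by simp)
    (fun u u' _ _ h h' => by rw [map_add, LinearMap.add_apply, h, h', add_zero])
    (fun c u _ h => by rw [map_smul, LinearMap.smul_apply, h, smul_zero]) hu
  rintro _ ⟨x, hx, rfl⟩
  refine Submodule.span_induction (p := fun v _ => D.form (D.cayBasis x) v = 0) ?_ (map_zero _)
    (fun u u' _ _ h h' => by rw [map_add, h, h', add_zero])
    (fun c u _ h => by rw [map_smul, h, smul_zero]) hv
  rintro _ ⟨y, hy, rfl⟩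
  rw [cayBasis_apply, cayBasis_apply]
  by_contra hne
  have hxy := D.eq_inv_of_form_ne_zero hne
  have hx : D.hodgeDeg x = (p, q) := hx
  have hy : D.hodgeDeg y = (r, s) := hy
  have h1 := D.fst_add_snd_hodgeDeg x
  rw [hxy, hodgeDeg_inv, hx, Prod.swap_prod_mk, Prod.mk.injEq] at hy
  rw [hx] at h1
  simp only at h1
  omega

/-- The Cayley vectors are orthogonal for the Hermitian form, with the explicit positive norms of
`form_cay_inv`. -/
lemma hodge_pos {p q : ℤ} {v : D.Model} (hv : v ∈ D.hodge (p, q)) (hne : v ≠ 0) :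
    0 < (Complex.I ^ (p - q) * D.form v (D.conjMap v)).re := by
  rw [hodge, Module.Basis.mem_span_image] at hv
  set c := D.cayBasis.repr v
  have hsum : v = ∑ x, c x • D.cay x := by
    rw [← D.cayBasis.sum_repr v]
    simp [c]
  have hexp : Complex.I ^ (p - q) * D.form v (D.conjMap v)
      = ∑ x, ((‖c x‖ ^ 2 *
        (2 ^ D.len x.1 * (x.2 : ℕ).factorial * (D.len x.1 - x.2).factorial) : ℝ) : ℂ) := by
    conv_lhs => rw [hsum]
    simp only [map_sum, LinearMap.sum_apply, map_smulₛₗ, LinearMap.smul_apply, conj_cay,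
      smul_eq_mul, RingHom.id_apply]
    rw [Finset.mul_sum]
    refine Finset.sum_congr rfl fun x _ => ?_
    rw [Finset.sum_eq_single x]
    · by_cases hx : c x = 0
      · simp [hx]
      have hdeg : D.hodgeDeg x = (p, q) := hv (Finsupp.mem_support_iff.2 hx)
      have h1 := D.form_cay_inv x
      rw [hdeg] at h1
      rw [Complex.ofReal_mul, ← h1, Complex.ofReal_pow, ← Complex.mul_conj']
      ring
    · intro y _ hy
      have : D.form (D.cay y) (D.cay (D.inv x)) = 0 := by
        by_contra h
        exact hy (D.inv_injective (D.eq_inv_of_form_ne_zero h)).symm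
      simp [this]
    · intro h
      exact absurd (Finset.mem_univ _) h
  rw [hexp, ← Complex.ofReal_sum, Complex.ofReal_re]
  obtain ⟨x, hx⟩ : ∃ x, c x ≠ 0 := by
    by_contra! hall
    exact hne (by rw [hsum]; simp [hall])
  refine Finset.sum_pos' (fun x _ => by positivity) ⟨x, Finset.mem_univ x, ?_⟩
  have : 0 < ‖c x‖ := norm_pos_iff.2 hx
  positivity

/-- The limiting nilpotent orbit of the model passes through a polarized Hodge structure. -/
theorem hodge_splitData : SplitData n D.conjMap D.form (0 : Module.End ℂ D.Model) D.hodge where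
  internal := isInternal_span_basis D.cayBasis D.hodgeDeg
  conj_mem p q v hv := by
    suffices h : D.hodge (p, q) ≤ (D.hodge (q, p)).comap D.conjMap from h hv
    refine Submodule.span_le.2 ?_
    rintro _ ⟨x, hx, rfl⟩
    have hx : D.hodgeDeg x = (p, q) := hx
    change D.conjMap (D.cayBasis x) ∈ D.hodge (q, p)
    rw [cayBasis_apply, conj_cay, ← cayBasis_apply]
    refine Submodule.subset_span ⟨_, ?_, rfl⟩
    rw [Set.mem_preimage, hodgeDeg_inv, hx]
    rfl
  lower p q v _ := by rw [LinearMap.zero_apply]; exact zero_mem _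
  inj l p q hpq v hv h0 := by
    rcases l with - | l
    · simpa using h0
    · exact D.hodge_eq_zero (by push_cast at hpq; omega) hv
  surj l p q hpq v hv := by
    rcases l with - | l
    · exact ⟨v, by simpa using hv, by simp⟩
    · refine ⟨0, zero_mem _, ?_⟩
      rw [map_zero, D.hodge_eq_zero (by push_cast at hpq ⊢; omega) hv]
  conj_conj := D.conj_conj
  conj_N v := by simp
  form_conj := D.form_conj
  form_flip := D.form_flip
  skew u v := by simp
  orth p q r s hpr u hu v hv := D.hodge_orth hpr hu hv
  pos l p q hpq v hv _ hne := by
    rcases l with - | l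
    · rw [pow_zero, Module.End.one_apply]
      exact D.hodge_pos hv hne
    · exact absurd (D.hodge_eq_zero (by push_cast at hpq; omega) hv) hne

/-- e^{-iN} maps the m-th Cayley vector to X^m (X-2i)^{len-m}, which contains only monomials of
degree at least m, hence lies in F^p if m does. The dimensions agree because `deg` and `hodgeDeg`
have the same first component. -/
lemma map_nexp_piece (p : ℤ) :
    (⨆ x : ℤ × ℤ, ⨆ _ : p ≤ x.1, D.piece x).map (nexp (Complex.I • D.deriv))
      = ⨆ x : ℤ × ℤ, ⨆ _ : p ≤ x.1, D.hodge x := by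
  have hN : IsNilpotent D.deriv := ⟨_, D.deriv_pow_eq_zero⟩
  simp only [piece, hodge]
  rw [iSup_span_basis D.stdBasis D.deg fun x => p ≤ x.1,
    iSup_span_basis D.cayBasis D.hodgeDeg fun x => p ≤ x.1]
  symm
  apply Submodule.eq_of_le_of_finrank_eq
  · refine Submodule.span_le.2 ?_
    rintro _ ⟨x, hx, rfl⟩
    refine ⟨nexp ((-Complex.I) • D.deriv) (D.cay x), ?_, ?_⟩
    · refine (D.mem_span_stdBasis _ _).2 fun s k hk => ?_
      rw [nexp_apply] at hk
      by_cases hs : s = x.1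
      · subst hs
        rw [cay_self, taylor_neg_cayley, coeff_X_pow_mul'] at hk
        have hk' : (x.2 : ℕ) ≤ k := by
          by_contra h
          exact hk (if_neg h)
        have hx : p ≤ n - D.b x.1 + (x.2 : ℕ) := hx
        change p ≤ n - D.b x.1 + (k : ℕ)
        omega
      · rw [D.cay_of_ne x hs] at hk
        simp at hk
    · rw [cayBasis_apply, nexp_smul_neg_apply hN]
  · have h1 := (nexpEquiv hN Complex.I).finrank_map_eq
      (Submodule.span ℂ (D.stdBasis '' {i | p ≤ (D.deg i).1}))
    refine Eq.trans ?_ h1.symm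
    rw [finrank_span_basis, finrank_span_basis]
    rfl

end Form

end StringSystem


/-- Transport of split data along an isomorphism of the underlying polarized real spaces. -/
lemma SplitData.map {n : ℤ} {E E' : Type*} [AddCommGroup E] [Module ℂ E] [AddCommGroup E']
    [Module ℂ E'] {σ : E →ₛₗ[starRingEnd ℂ] E} {B : LinearMap.BilinForm ℂ E}
    {N : Module.End ℂ E} {J : ℤ × ℤ → Submodule ℂ E} (hS : SplitData n σ B N J)
    {σ' : E' →ₛₗ[starRingEnd ℂ] E'} {B' : LinearMap.BilinForm ℂ E'} (T : E ≃ₗ[ℂ] E')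
    (hσ : ∀ v, T (σ v) = σ' (T v)) (hB : ∀ u v, B' (T u) (T v) = B u v) :
    SplitData n σ' B' (T.conj N) (fun x => (J x).map (T : E →ₗ[ℂ] E')) := by
  have hN : ∀ v, T.conj N (T v) = T (N v) := fun v => by
    rw [LinearEquiv.conj_apply_apply, LinearEquiv.symm_apply_apply]
  have hNl : ∀ (l : ℕ) v, (T.conj N ^ l) (T v) = T ((N ^ l) v) := by
    intro l
    induction l with
    | zero => intro v; rfl
    | succ l ih =>
      intro v
      rw [pow_succ, pow_succ, Module.End.mul_apply, hN, ih, Module.End.mul_apply]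
  constructor
  · refine DirectSum.isInternal_submodule_of_iSupIndep_of_iSup_eq_top ?_ ?_
    · exact hS.internal.submodule_iSupIndep.map_orderIso (Submodule.orderIsoMapComap T)
    · rw [← Submodule.map_iSup, hS.internal.submodule_iSup_eq_top, Submodule.map_top,
        LinearEquiv.range]
  · rintro p q _ ⟨v, hv, rfl⟩
    exact ⟨σ v, hS.conj_mem _ _ _ hv, hσ v⟩
  · rintro p q _ ⟨v, hv, rfl⟩
    exact ⟨N v, hS.lower _ _ _ hv, (hN v).symm⟩
  · rintro l p q hpq _ ⟨v, hv, rfl⟩ h0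
    rw [LinearEquiv.coe_coe, hNl, LinearEquiv.map_eq_zero_iff] at h0
    rw [hS.inj l p q hpq v hv h0, map_zero]
  · rintro l p q hpq _ ⟨v, hv, rfl⟩
    obtain ⟨w, hw, rfl⟩ := hS.surj l p q hpq v hv
    exact ⟨T w, ⟨w, hw, rfl⟩, hNl l w⟩
  · intro v
    obtain ⟨v, rfl⟩ := T.surjective v
    rw [← hσ, ← hσ, hS.conj_conj]
  · intro v
    obtain ⟨v, rfl⟩ := T.surjective v
    rw [hN, ← hσ, ← hσ, hS.conj_N, hN]
  · intro u v
    obtain ⟨u, rfl⟩ := T.surjective u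
    obtain ⟨v, rfl⟩ := T.surjective v
    rw [← hσ, ← hσ, hB, hB, hS.form_conj]
  · intro u v
    obtain ⟨u, rfl⟩ := T.surjective u
    obtain ⟨v, rfl⟩ := T.surjective v
    rw [hB, hB, hS.form_flip]
  · intro u v
    obtain ⟨u, rfl⟩ := T.surjective u
    obtain ⟨v, rfl⟩ := T.surjective v
    rw [hN, hN, hB, hB, hS.skew]
  · rintro p q r s hpr _ ⟨u, hu, rfl⟩ _ ⟨v, hv, rfl⟩
    exact (hB u v).trans (hS.orth p q r s hpr u hu v hv)
  · rintro l p q hpq _ ⟨v, hv, rfl⟩ h0 hne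
    rw [LinearEquiv.coe_coe] at h0 hne ⊢
    rw [hNl, LinearEquiv.map_eq_zero_iff] at h0
    rw [← hσ, hNl, hB]
    exact hS.pos l p q hpq v hv h0 (fun h => hne (by rw [h, map_zero]))

/-! ### The strings of a Hodge diamond -/

/-- The strings of a Hodge diamond `f`: the string `(a, b, i)` starts in bidegree `(a, b)`. -/
def Strings (n : ℤ) (f : ℤ × ℤ → ℕ) : Type :=
  {s : ℤ × ℤ × ℕ // n ≤ s.1 + s.2.1 ∧ f (s.1 + 1, s.2.1 + 1) ≤ s.2.2 ∧ s.2.2 < f (s.1, s.2.1)}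

namespace IsAdmissible

variable {n : ℤ} {h : ℤ → ℕ} {f : ℤ × ℤ → ℕ}

lemma anti (hf : IsAdmissible n h f) {p q : ℤ} (hpq : n ≤ p + q) (j : ℕ) :
    f (p + j, q + j) ≤ f (p, q) := by
  induction j with
  | zero => simp
  | succ j ih =>
    refine le_trans ?_ ih
    rw [hf.symm' (p + j), hf.symm' (p + ((j + 1 : ℕ) : ℤ))]
    have := hf.mono (n - (q + j)) (n - (p + j)) (by omega)
    push_cast
    rwa [sub_sub, sub_sub, add_assoc, add_assoc] at this

/-- Along a diagonal f is symmetric about weight n and decreases away from it, so its value where a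
string starts bounds it from below along the string. -/
lemma le_of_string (hf : IsAdmissible n h f) {a b p q : ℤ} {k l : ℕ} (hab : a + b = n + l)
    (hk : k ≤ l) (hp : n - b + k = p) (hq : n - a + k = q) : f (a, b) ≤ f (p, q) := by
  by_cases hpq : n ≤ p + q
  · have := hf.anti hpq (l - k)
    rwa [show p + ((l - k : ℕ) : ℤ) = a by omega, show q + ((l - k : ℕ) : ℤ) = b by omega] at this
  · have := hf.anti (p := n - q) (q := n - p) (by omega) k
    rwa [← hf.symm', show n - q + (k : ℤ) = a by omega, show n - p + (k : ℤ) = b by omega] at this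

lemma finite_support (hf : IsAdmissible n h f) (hh : (Function.support h).Finite) :
    (Function.support f).Finite := by
  have key : ∀ p q, f (p, q) ≠ 0 → h p ≠ 0 := by
    intro p q hpq h0
    have h1 := single_le_finsum (f := fun q => f (p, q)) q (hf.finite_col p) (fun _ => Nat.zero_le _)
    rw [hf.sum_col, h0] at h1
    exact hpq (Nat.le_zero.1 h1)
  refine (hh.prod hh).subset ?_
  rintro ⟨p, q⟩ hpq
  exact ⟨key p q hpq, key q p (by rwa [← hf.symm])⟩

lemma finite_strings (hf : IsAdmissible n h f) (hh : (Function.support h).Finite) :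
    Finite (Strings n f) := by
  refine Set.Finite.to_subtype (Set.Finite.subset (((hf.finite_support hh).biUnion fun x _ =>
    (Set.finite_Iio (f x)).image fun i => ((x.1, x.2, i) : ℤ × ℤ × ℕ))) ?_)
  rintro ⟨a, b, i⟩ ⟨_, _, hi⟩
  simp only at hi
  exact Set.mem_biUnion (x := (a, b)) (Nat.ne_zero_of_lt hi) ⟨i, hi, rfl⟩

/-- The string system of an admissible Hodge diamond. -/
def stringSystem (hf : IsAdmissible n h f) : StringSystem n (Strings n f) where
  a s := s.1.1
  b s := s.1.2.1
  len s := (s.1.1 + s.1.2.1 - n).toNat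
  bar s := ⟨(s.1.2.1, s.1.1, s.1.2.2), by
    have := s.2
    refine ⟨by change n ≤ s.1.2.1 + s.1.1; omega, ?_, ?_⟩
    · rw [hf.symm]; exact this.2.1
    · rw [hf.symm]; exact this.2.2⟩
  bar_bar _ := rfl
  a_bar _ := rfl
  len_eq s := by
    have := s.2.1
    omega

/-- The strings starting at (a,b) are labelled by the heights in [f(a+1,b+1), f(a,b)). For the
starting points of the strings through (p,q) these intervals tile [0, f(p,q)), so the height labels
these strings bijectively. -/
lemma card_deg (hf : IsAdmissible n h f) (hh : (Function.support h).Finite) (p q : ℤ) :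
    Nat.card (hf.stringSystem.deg ⁻¹' {(p, q)}) = f (p, q) := by
  have hmem : ∀ x : hf.stringSystem.Idx, hf.stringSystem.deg x = (p, q) ↔
      n - x.1.1.2.1 + (x.2 : ℕ) = p ∧ n - x.1.1.1 + (x.2 : ℕ) = q := fun x => Prod.mk_inj
  have hlen : ∀ x : hf.stringSystem.Idx, ((x.2 : ℕ) : ℤ) ≤ x.1.1.1 + x.1.1.2.1 - n := fun x => by
    have h1 : (x.2 : ℕ) < (x.1.1.1 + x.1.1.2.1 - n).toNat + 1 := x.2.2
    have h2 := x.1.2.1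
    omega
  have hlt : ∀ x ∈ hf.stringSystem.deg ⁻¹' {(p, q)}, x.1.1.2.2 < f (p, q) := by
    intro x hx
    obtain ⟨h1, h2⟩ := (hmem x).1 hx
    have h3 := hlen x
    have h4 := x.1.2.1
    refine lt_of_lt_of_le x.1.2.2.2 (hf.le_of_string (l := (x.1.1.1 + x.1.1.2.1 - n).toNat)
      (by omega) (by omega) h1 h2)
  rw [← Nat.card_fin (f (p, q))]
  refine Nat.card_congr (Equiv.ofBijective (fun x => ⟨x.1.1.1.2.2, hlt x.1 x.2⟩) ⟨?_, ?_⟩)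
  · have key : ∀ x ∈ hf.stringSystem.deg ⁻¹' {(p, q)}, ∀ y ∈ hf.stringSystem.deg ⁻¹' {(p, q)},
        x.1.1.2.2 = y.1.1.2.2 → ¬ x.1.1.1 < y.1.1.1 := by
      intro x hx y hy hxy hlt
      obtain ⟨h1, h2⟩ := (hmem x).1 hx
      obtain ⟨h3, h4⟩ := (hmem y).1 hy
      have h5 := hf.anti (p := x.1.1.1 + 1) (q := x.1.1.2.1 + 1) (by have := x.1.2.1; omega)
        (y.1.1.1 - x.1.1.1 - 1).toNat
      rw [show x.1.1.1 + 1 + (((y.1.1.1 - x.1.1.1 - 1).toNat : ℕ) : ℤ) = y.1.1.1 by omega,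
        show x.1.1.2.1 + 1 + (((y.1.1.1 - x.1.1.1 - 1).toNat : ℕ) : ℤ) = y.1.1.2.1 by omega] at h5
      have h6 := x.1.2.2.1
      have h7 := y.1.2.2.2
      omega
    rintro ⟨x, hx⟩ ⟨y, hy⟩ hxy
    have hi : x.1.1.2.2 = y.1.1.2.2 := congrArg Fin.val hxy
    have ha : x.1.1.1 = y.1.1.1 :=
      le_antisymm (not_lt.1 (key y hy x hx hi.symm)) (not_lt.1 (key x hx y hy hi))
    obtain ⟨h1, h2⟩ := (hmem x).1 hx
    obtain ⟨h3, h4⟩ := (hmem y).1 hy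
    have hs : x.1 = y.1 := by
      refine Subtype.ext (Prod.ext ha (Prod.ext ?_ hi))
      omega
    refine Subtype.ext ?_
    obtain ⟨s, k⟩ := x
    obtain ⟨t, m⟩ := y
    simp only at hs
    subst hs
    simp only at h2 h4
    exact congrArg (Sigma.mk s) (Fin.ext (by omega))
  · rintro ⟨i, hi⟩
    -- If (p,q) lies below weight n it is replaced by its mirror image on the same diagonal, where f
    -- has the same value.
    obtain ⟨r, s, hrs, hfrs, hr, hs⟩ : ∃ r s : ℤ, n ≤ r + s ∧ f (r, s) = f (p, q) ∧
        (p ≤ r ∧ r - s = p - q) ∧ 0 ≤ p - n + s := by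
      by_cases hpq : n ≤ p + q
      · exact ⟨p, q, hpq, rfl, ⟨le_rfl, rfl⟩, by omega⟩
      · exact ⟨n - q, n - p, by omega, (hf.symm' p q).symm, by omega, by omega⟩
    -- The string of height i starts where f first drops to at most i at the next step up the
    -- diagonal. Finite support ensures that it does.
    have hex : ∃ j : ℕ, f (r + j + 1, s + j + 1) ≤ i := by
      by_contra! hall
      refine Set.infinite_of_injective_forall_mem (f := fun j : ℕ => (r + j + 1, s + j + 1)) ?_
        (fun j => Nat.ne_zero_of_lt (hall j)) (hf.finite_support hh)
      intro j j' hj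
      have := congrArg Prod.fst hj
      simp only at this
      omega
    classical
    have hj := Nat.find_spec hex
    have hj' : i < f (r + Nat.find hex, s + Nat.find hex) := by
      rcases hj0 : Nat.find hex with - | j
      · simpa [hfrs] using hi
      · have := Nat.find_min hex (m := j) (by omega)
        push_cast
        rw [← add_assoc, ← add_assoc]
        exact not_le.1 this
    set j := Nat.find hex
    refine ⟨⟨⟨⟨(r + j, s + j, i), by change n ≤ r + j + (s + j); omega, hj, hj'⟩, ⟨(p - n + s + j).toNat, ?_⟩⟩, ?_⟩, rfl⟩
    · change (p - n + s + j).toNat < (r + j + (s + j) - n).toNat + 1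
      omega
    · refine (hmem _).2 ⟨?_, ?_⟩
      · simp only
        omega
      · simp only
        omega

/-- The first components of `hodgeDeg` and `deg` coincide, so the count is the column sum of f. -/
lemma card_hodgeDeg (hf : IsAdmissible n h f) (hh : (Function.support h).Finite) (p : ℤ) :
    Nat.card (hf.stringSystem.hodgeDeg ⁻¹' {(p, n - p)}) = h p := by
  classical
  have := hf.finite_strings hh
  let _ := Fintype.ofFinite (Strings n f)
  set D := hf.stringSystem
  let s : Finset D.Idx := Finset.univ.filter fun x => (D.deg x).1 = p
  have h1 : D.hodgeDeg ⁻¹' {(p, n - p)} = (s : Set D.Idx) := by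
    ext x
    have h2 := D.fst_add_snd_hodgeDeg x
    have h3 : (D.hodgeDeg x).1 = (D.deg x).1 := rfl
    simp only [Set.mem_preimage, Set.mem_singleton_iff, s, Finset.coe_filter, Finset.mem_univ,
      true_and, Set.mem_ofPred_eq, Prod.ext_iff]
    omega
  have h2 : ∀ q, (s.filter fun x => (D.deg x).2 = q).card = f (p, q) := by
    intro q
    have h3 : D.deg ⁻¹' {(p, q)} = ((s.filter fun x => (D.deg x).2 = q : Finset D.Idx) : Set _) := by
      ext x
      simp only [Set.mem_preimage, Set.mem_singleton_iff, s, Finset.coe_filter, Finset.mem_filter,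
        Finset.mem_univ, true_and, Set.mem_ofPred_eq, Prod.ext_iff]
    rw [← hf.card_deg hh p q, h3, Nat.card_coe_set_eq, Set.ncard_coe_finset]
  rw [h1, Nat.card_coe_set_eq, Set.ncard_coe_finset, ← hf.sum_col p,
    finsum_eq_sum_of_support_subset (s := s.image fun x => (D.deg x).2),
    Finset.card_eq_sum_card_fiberwise (f := fun x => (D.deg x).2) (t := s.image fun x => (D.deg x).2)]
  · exact Finset.sum_congr rfl fun q _ => h2 q
  · intro x hx
    exact Finset.mem_image_of_mem _ hx
  · intro q hq
    have : (s.filter fun x => (D.deg x).2 = q).card ≠ 0 := by rw [h2]; exact hq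
    obtain ⟨x, hx⟩ := Finset.card_ne_zero.1 this
    rw [Finset.mem_filter] at hx
    exact Finset.mem_coe.2 (Finset.mem_image.2 ⟨x, hx⟩)

end IsAdmissible

/-- Every admissible function is the Hodge diamond of an `ℝ`-split polarized mixed Hodge structure
on the connected period domain. -/
theorem IsAdmissible.exists_rSplitPMHS {V : Type*} [AddCommGroup V] [Module ℝ V]
    [FiniteDimensional ℝ V] {n : ℤ} {Q : LinearMap.BilinForm ℝ V} {h : ℤ → ℕ} {f : ℤ × ℤ → ℕ}
    (hf : IsAdmissible n h f) (hsymm : ∀ u v, Q u v = (-1 : ℝ) ^ n * Q v u) {φ : CFil V}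
    (hφ : φ ∈ periodDomain n Q h) :
    ∃ x : RSplitPMHS n Q h (connDomain Q φ), x.diamond = f := by
  classical
  have hH := hodge_splitData hsymm hφ
  have hh : (Function.support h).Finite := by
    refine ((finite_ne_bot hH.internal).image Prod.fst).subset fun p hp => ⟨(p, n - p), ?_, rfl⟩
    intro hbot
    refine hp ?_
    rw [← finrank_hodgePiece hφ, hbot, finrank_bot]
  have := hf.finite_strings hh
  let _ := Fintype.ofFinite (Strings n f)
  set D := hf.stringSystem
  have hN : IsNilpotent D.deriv := ⟨_, D.deriv_pow_eq_zero⟩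
  have hdim : ∀ x, Module.finrank ℂ (D.hodge x) = Module.finrank ℂ (hodgePiece n φ x) := by
    rintro ⟨p, q⟩
    by_cases hpq : p + q = n
    · obtain rfl : q = n - p := by omega
      rw [finrank_hodgePiece hφ, StringSystem.hodge, finrank_span_basis]
      exact hf.card_hodgeDeg hh p
    · have h1 : D.hodge (p, q) = ⊥ :=
        (Submodule.eq_bot_iff _).2 fun v hv => D.hodge_eq_zero hpq hv
      rw [h1, hodgePiece, if_neg hpq, finrank_bot, finrank_bot]
  -- The classification with N = 0: polarized Hodge structures with equal Hodge numbers are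
  -- isomorphic. T carries e^{iN}F of the model to φ, and the operator d/dX and the monomial
  -- bigrading are transported along it.
  obtain ⟨T, hTσ, -, hTB, hTJ⟩ := D.hodge_splitData.exists_iso hH hdim
  have hTN : ∀ v, T ((Complex.I • D.deriv) v) = (Complex.I • T.conj D.deriv) (T v) := fun v => by
    rw [LinearMap.smul_apply, LinearMap.smul_apply, LinearEquiv.conj_apply_apply,
      LinearEquiv.symm_apply_apply, map_smul]
  have hS := D.splitData.map T hTσ hTB
  obtain ⟨x, hx⟩ := PeriodDomain.exists_rSplitPMHS hφ.1 hS (by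
    intro p
    have h1 : (nexp (Complex.I • T.conj D.deriv)) ∘ₗ (T : D.Model →ₗ[ℂ] Cx V)
        = (T : D.Model →ₗ[ℂ] Cx V) ∘ₗ nexp (Complex.I • D.deriv) :=
      LinearMap.ext fun v => (nexp_intertwine (hN.smul _) (hS.nilpotent.smul _)
        (T : D.Model →ₗ[ℂ] Cx V) hTN v).symm
    have h2 : hodgeFil (fun x => (D.piece x).map (T : D.Model →ₗ[ℂ] Cx V)) p
        = (⨆ x : ℤ × ℤ, ⨆ _ : p ≤ x.1, D.piece x).map (T : D.Model →ₗ[ℂ] Cx V) := by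
      simp only [hodgeFil, Submodule.map_iSup]
    rw [h2, ← Submodule.map_comp, h1, Submodule.map_comp, D.map_nexp_piece, hodge_eq_iSup hφ p]
    simp only [Submodule.map_iSup, hTJ])
  refine ⟨x, funext fun a => ?_⟩
  rw [hx, LinearEquiv.finrank_map_eq, StringSystem.piece, finrank_span_basis]
  exact hf.card_deg hh a.1 a.2

end PeriodDomain


theorem proposition5p1 {V : Type*} [AddCommGroup V] [Module ℝ V] [FiniteDimensional ℝ V]
    (n : ℤ) (Q : LinearMap.BilinForm ℝ V) (h : ℤ → ℕ)
    (hsymm : ∀ u v, Q u v = (-1 : ℝ) ^ n * Q v u) (hnd : Q.Nondegenerate)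
    (φ : PeriodDomain.CFil V) (hφ : φ ∈ PeriodDomain.periodDomain n Q h) :
    (∀ f : ℤ × ℤ → ℕ, PeriodDomain.IsAdmissible n h f →
      ∃ x : PeriodDomain.RSplitPMHS n Q h (PeriodDomain.connDomain Q φ), x.diamond = f) ∧
    (∀ x y : PeriodDomain.RSplitPMHS n Q h (PeriodDomain.periodDomain n Q h),
      x.diamond = y.diamond ↔ PeriodDomain.cls x = PeriodDomain.cls y) ∧
    (∀ x : PeriodDomain.RSplitPMHS n Q h (PeriodDomain.periodDomain n Q h),
      ∃! L : PeriodDomain.CFil V, PeriodDomain.IsNaiveLimit x.F x.N L) ∧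
    ∃ Φ : PeriodDomain.PsiBar n Q h → PeriodDomain.DeltaBar n Q h,
      (∀ (x : PeriodDomain.RSplitPMHS n Q h (PeriodDomain.periodDomain n Q h))
        (L : PeriodDomain.CFil V), PeriodDomain.IsNaiveLimit x.F x.N L →
        (Φ (PeriodDomain.cls x) : Set (PeriodDomain.CFil V)) = PeriodDomain.orbit Q L) ∧
      Function.Bijective Φ :=
  ⟨fun _ hf => hf.exists_rSplitPMHS hsymm hφ,
    fun x y => PeriodDomain.RSplitPMHS.diamond_eq_iff hsymm x y,
    fun x => x.exists_naiveLimit, PeriodDomain.exists_limit_bijection hsymm⟩
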